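/- **Dressing data.** Let $X$ be the disjoint union of finitely many points $n$, finitely many compact intervals $\gamma_m\subset\mathbb R$ and finitely many compact sets $\Sigma_\ell\subset\mathbb R^2$ that are closures of their interiors (e.g. compact two-dimensional submanifolds with boundary), with $dp$ the counting measure on the points and Lebesgue measure on $\gamma_m$, $\Sigma_\ell$. Let $\mathcal D$ be the space of functions on $X$ that are Hölder continuous on each $\gamma_m$ and $\Sigma_\ell$; $\tilde f\in\mathcal D$ represents the distribution $f(\xi)=\int_X\tilde f(p)\,\delta(\xi-\zeta(p))\,dp$. Let $\zeta,\eta:X\to\mathbb C\setminus\{0\}$ be Lipschitz and injective on each $\gamma_m$ and $\Sigma_\ell$ (e.g. $C^1$ embeddings), let $\tilde R_0\in\mathcal D$, and $$R_0(\zeta,\eta)=\int_X\tilde R_0(p)\,\delta(\zeta-\zeta(p))\,\delta(\eta-\eta(p))\,dp .$$ For a phase $\phi(\lambda,\tau)$ depending on parameters $\tau$ put $R(\zeta,\eta,\tau)=e^{\phi(\eta,\tau)-\phi(\zeta,\tau)}R_0(\zeta,\eta)$ and $$K(\zeta,\xi)=\frac1\pi\iint_{\mathbb C}\frac{R(\zeta,\eta)}{\eta-\xi}d^2\eta,\quad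 g(\zeta)=\iint_{\mathbb C} R(\zeta,\eta)\,d^2\eta,\quad \mathcal Lf(\zeta)=f(\zeta)-\iint_{\mathbb C} K(\zeta,\xi)f(\xi)\,d^2\xi ,$$ where singular integrals are principal values. Assume that for every $\tau$ in a parameter domain $\Omega$ the operator $\mathcal L:\mathcal D\to\mathcal D$ is well defined with trivial nullspace and that $f=f(\cdot,\tau)\in\mathcal D$ solves $\mathcal Lf=g$. If the sets $\zeta(X)$ and $\eta(X)$ intersect, assume moreover that $f$ depends holomorphically on $\tau$ as an element of $\mathcal D$ (pointwise holomorphic on $X$, and locally in $\tau$ bounded in a Hölder norm); if they are disjoint nothing more is assumed. Let $\varphi$ be a continuous branch on $\Omega$ of $$\varphi=-\log\Bigl(1-\frac1\pi\iint_{\mathbb C}\frac{f(\xi,\tau)}{\xi}\,d^2\xi\Bigr).$$ **(1) The (2+1)D system.** Let $a,\alpha,\beta\in\mathbb C$, let $\Omega\subset\mathbb C^3$ be open with coordinates $\tau=(u,v,t)$, and let $$\phi(\lambda,u,v,t)=\lambda u+a\lambda^{-1}v+(\alpha\lambda^2+a^2\beta\lambda^{-2})t,\qquad \eta=-\frac1\pi\frac{\partial}{\partial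 v}\iint_{\mathbb C} f(\xi,u,v,t)\,d^2\xi-\frac12\varphi_{uv}.$$ Then there is $\Pi$ such that $\varphi,\eta,\Pi$ are holomorphic on $\Omega$ and solve there the complex (2+1)D Kaup–Broer system $$\varphi_t+\alpha\varphi_u^2-\beta\varphi_v^2+\Pi=0,$$ $$\eta_t+2\alpha(\varphi_u\eta)_u-2\beta(\varphi_v\eta)_v-2a\alpha\varphi_{uu}+2a\beta\varphi_{vv}+\frac\alpha2\varphi_{uuuv}-\frac\beta2\varphi_{uvvv}=0,$$ $$\Pi_{uv}=2\alpha\eta_{uu}-2\beta\eta_{vv}.$$ **(2) The hierarchy.** Let $a\ne0$ and $\phi(\lambda,u_1,v_1,u_2,v_2,\dots)=\sum_{n\ge1}(u_n\lambda^n+v_n\lambda^{-n})$, where $\Omega$ is a set of sequences of times for which this series converges for all $\lambda\neq0$ and which is open in every finite set of times (continuity and holomorphy are understood in every finite set of times). Then $\varphi$ and $$\eta=-\frac a\pi\frac{\partial}{\partial v_1}\iint_{\mathbb C} f\,d^2\xi-\frac a2\varphi_{u_1v_1}$$ solve the complex (2+1)D Kaup–Broer hierarchy on $\Omega$, that is,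 the hierarchy of isospectral deformations at fixed energy of $$L=a(\partial_{u_1}\partial_{v_1}+\varphi_{u_1}\partial_{v_1})+\eta+\tfrac a2\varphi_{u_1v_1}-a .$$ Explicitly: $\varphi,\eta$ are holomorphic, and there are differential operators with holomorphic coefficients $A_{u_n}=\partial_{u_1}^n+(\text{terms }\partial_{u_1}^k,\ k\le n-2)$ and $A_{v_n}=\partial_{v_1}^n+n\varphi_{v_1}\partial_{v_1}^{n-1}+(\text{terms }\partial_{v_1}^k,\ 1\le k\le n-2)$ for $n\ge2$, $A_{u_1}=\partial_{u_1}$, $A_{v_1}=\partial_{v_1}$, such that for any two times $s,s'$ and every local solution $\psi(u_1,v_1)$ of $L\psi=0$ (other times frozen) $$\Bigl(\frac{\partial L}{\partial s}-[A_s,L]\Bigr)\psi=0,\qquad \Bigl(\frac{\partial A_{s}}{\partial s'}-\frac{\partial A_{s'}}{\partial s}-[A_{s'},A_{s}]\Bigr)\psi=0,$$ and such that the equations $L\psi=0$, $\partial\psi/\partial s=A_s\psi$ for all times $s$ have formal solutions $e^{\phi}(1+O(\lambda^{-1}))$ at $\lambda=\infty$ and $e^{\phi}(e^{-\varphi}+O(\lambda))$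 at $\lambda=0$. **(3) Reductions.** Let $a\ne0$ and $(\alpha,\beta)\neq(0,0)$ be complex. For each $\varepsilon=\pm1$ and $\mu=\pm\frac14$ there are nonzero $p,q,\kappa,s,\sigma,\tau\in\mathbb C$ such that for all holomorphic $\Phi,H$ on an open subset of $\mathbb C^2$ the ansatz $$\varphi=\kappa\,\Phi(pu+qv,\tau t),\qquad \eta=s\,H(pu+qv,\tau t),\qquad \Pi=\sigma\,H(pu+qv,\tau t)$$ satisfies the (2+1)D system of (1) at a point if and only if $(\Phi,H)$ satisfies the (1+1)D Kaup–Broer system $$\Phi_{t}+\frac12\Phi_x^2+\varepsilon H=0,\qquad H_t+\Phi_{xx}+(H\Phi_x)_x+\mu\Phi_{xxxx}=0$$ at the point $(x,t)\leftarrow(pu+qv,\tau t)$; and, if $\Phi,H$ are real on real points, then at every point with $x=pu+qv$ and $\tau t$ real this is equivalent to the real (1+1)D system for the restrictions of $\Phi,H$ to real variables. Thus the single complex system reduces to all four scaling classes of the real (1+1)D Kaup–Broer system. -/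

import Mathlib

open Filter Topology MeasureTheory

noncomputable section

namespace KaupBroer

/-! ## Dressing functions and the space of densities -/

/-- The sets over which dressing functions are integrated: finitely many atoms, finitely many
compact intervals, and finitely many compact two-dimensional pieces of the plane (a compact
two-dimensional submanifold with boundary is the closure of its interior). -/
structure DressingSupport where
  numAtoms : ℕ
  numCurves : ℕ
  numPatches : ℕ
  lo : Fin numCurves → ℝ
  hi : Fin numCurves → ℝ
  lo_lt_hi : ∀ m, lo m < hi m
  patchSet : Fin numPatches → Set (ℝ × ℝ)
  isCompact_patchSet : ∀ l, IsCompact (patchSet l)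
  closure_interior_patchSet : ∀ l, closure (interior (patchSet l)) = patchSet l

/-- The parameter space: the disjoint union of the atoms, the intervals and the patches. -/
abbrev DressingSupport.Pt (X : DressingSupport) : Type :=
  Fin X.numAtoms ⊕ ((m : Fin X.numCurves) × Set.Icc (X.lo m) (X.hi m)) ⊕
    ((l : Fin X.numPatches) × X.patchSet l)

namespace DressingSupport

variable (X : DressingSupport)

def atom (n : Fin X.numAtoms) : X.Pt := Sum.inl n

def curve (m : Fin X.numCurves) (s : Set.Icc (X.lo m) (X.hi m)) : X.Pt :=
  Sum.inr (Sum.inl ⟨m, s⟩)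

def patch (l : Fin X.numPatches) (p : X.patchSet l) : X.Pt :=
  Sum.inr (Sum.inr ⟨l, p⟩)

/-- Sum over the atoms plus the Lebesgue integrals over the intervals and over the patches. -/
def int (F : X.Pt → ℂ) : ℂ :=
  (∑ n, F (X.atom n)) + (∑ m, ∫ s, F (X.curve m s) ∂(volume.comap Subtype.val)) +
    ∑ l, ∫ p, F (X.patch l p) ∂(volume.comap Subtype.val)

/-- `F` is bounded by `C` and Hölder continuous with exponent `r` and constant `C` on each
interval and on each patch. -/
def HolderBound (r C : NNReal) (F : X.Pt → ℂ) : Prop :=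
  (∀ p, ‖F p‖ ≤ C) ∧ (∀ m, HolderWith C r fun s => F (X.curve m s)) ∧
    ∀ l, HolderWith C r fun p => F (X.patch l p)

/-- Membership in the space `𝒟`: numbers at the atoms, Hölder continuous functions on the
intervals and on the patches. -/
def IsHolder (F : X.Pt → ℂ) : Prop :=
  ∃ r C : NNReal, 0 < r ∧ r ≤ 1 ∧ X.HolderBound r C F

/-- A map into `ℂ` that is injective and Lipschitz on each interval and on each patch. Every
`C¹` embedding of these compact sets is of this kind. -/
def IsEmbedded (z : X.Pt → ℂ) : Prop :=
  (∀ m, Function.Injective (fun s => z (X.curve m s)) ∧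
    ∃ K, LipschitzWith K fun s => z (X.curve m s)) ∧
  ∀ l, Function.Injective (fun p => z (X.patch l p)) ∧
    ∃ K, LipschitzWith K fun p => z (X.patch l p)

/-- A family of elements of `𝒟` that depends holomorphically on the parameter in `W`: it is
holomorphic at each point of the support, and near each parameter it is bounded in a Hölder norm. -/
def HolFamily {E : Type*} [NormedAddCommGroup E] [NormedSpace ℂ E] (W : Set E)
    (F : E → X.Pt → ℂ) : Prop :=
  (∀ p, DifferentiableOn ℂ (fun τ => F τ p) W) ∧
    ∀ τ ∈ W, ∃ r C : NNReal, 0 < r ∧ r ≤ 1 ∧ ∀ᶠ τ' in 𝓝 τ, X.HolderBound r C (F τ')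

end DressingSupport

/-- The dressing function
`R₀(ζ, η) = ∑ rₙ δ(ζ - ζₙ) δ(η - ηₙ) + ∑ ∫ R(s) δ(ζ - ζ(s)) δ(η - η(s)) ds
  + ∑ ∬ R(p) δ(ζ - ζ(p)) δ(η - η(p)) d²p`,
supported away from the points `ζ = 0` and `η = 0` where the phases are singular. -/
structure DressingData extends DressingSupport where
  ζ : toDressingSupport.Pt → ℂ
  η : toDressingSupport.Pt → ℂ
  R : toDressingSupport.Pt → ℂ
  ζ_embedded : toDressingSupport.IsEmbedded ζ
  η_embedded : toDressingSupport.IsEmbedded η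
  R_holder : toDressingSupport.IsHolder R
  ζ_ne_zero : ∀ p, ζ p ≠ 0
  η_ne_zero : ∀ p, η p ≠ 0

namespace DressingData

variable (D : DressingData)

/-- `∬ f(ξ) / (z - ξ) d²ξ = c` for the distribution `f = ∫ F(p) δ(ξ - ζ(p))`, as a principal value;
`z` must not carry an atom. -/
def HasCauchyIntegral (F : D.Pt → ℂ) (z c : ℂ) : Prop :=
  (∀ n, D.ζ (D.atom n) ≠ z) ∧
    Tendsto (fun ε : ℝ => D.int fun q => open Classical in
      if ε < ‖z - D.ζ q‖ then F q / (z - D.ζ q) else 0) (𝓝[>] 0) (𝓝 c)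

/-- `G` is the density of `∬ K(ζ, ξ) f(ξ) d²ξ`, where `K(ζ, ξ) = π⁻¹ ∬ R(ζ, η) / (η - ξ) d²η`,
`R` is given by the density `R`, and `f` by the density `F`. -/
def IsKernelImage (R F G : D.Pt → ℂ) : Prop :=
  ∀ p, ∃ c : ℂ, (R p ≠ 0 → D.HasCauchyIntegral F (D.η p) c) ∧ G p = 1 / (Real.pi : ℂ) * R p * c

/-- `ℒ f = f - ∬ K(·, ξ) f(ξ) d²ξ` is a well-defined map `𝒟 → 𝒟`. -/
def WellDefined (R : D.Pt → ℂ) : Prop :=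
  ∀ F, D.IsHolder F → ∃ G, D.IsHolder G ∧ D.IsKernelImage R F G

/-- The nullspace of `ℒ` in `𝒟` is trivial. -/
def TrivialNullspace (R : D.Pt → ℂ) : Prop :=
  ∀ F, D.IsHolder F → D.IsKernelImage R F F → ∀ p, F p = 0

/-- `f ∈ 𝒟` solves `ℒ f = g`, where `g(ζ) = ∬ R(ζ, η) d²η` has density `R`. -/
def Solves (R f : D.Pt → ℂ) : Prop :=
  D.IsHolder f ∧ D.IsKernelImage R f fun p => f p - R p

/-- The density of `exp(θ(η) - θ(ζ)) R₀(ζ, η)`. -/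
def dress (θ : ℂ → ℂ) : D.Pt → ℂ :=
  fun p => Complex.exp (θ (D.η p) - θ (D.ζ p)) * D.R p

/-- For each parameter `τ ∈ Ω`, the operator `ℒ` of the dressing function with phase `θ τ` is well
defined with trivial nullspace, and `f τ` solves `ℒ f = g`. -/
structure IsDressedFamily {E : Type*} (θ : E → ℂ → ℂ) (Ω : Set E) (f : E → D.Pt → ℂ) :
    Prop where
  wellDefined : ∀ τ ∈ Ω, D.WellDefined (D.dress (θ τ))
  trivialNullspace : ∀ τ ∈ Ω, D.TrivialNullspace (D.dress (θ τ))
  solves : ∀ τ ∈ Ω, D.Solves (D.dress (θ τ)) (f τ)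

/-- The points `ζ` and the points `η` of the dressing function do not meet. -/
def NoOverlap : Prop := ∀ p q, D.ζ p ≠ D.η q

/-- `∬ f(ξ) d²ξ`. -/
def mass (F : D.Pt → ℂ) : ℂ := D.int F

/-- `∬ f(ξ) / ξ d²ξ`. -/
def massInv (F : D.Pt → ℂ) : ℂ := D.int fun p => F p / D.ζ p

end DressingData

/-- The partial derivative in the direction `e`. -/
def pd (𝕜 : Type*) [NontriviallyNormedField 𝕜] {E : Type*} [AddCommGroup E] [Module 𝕜 E]
    (e : E) (F : E → 𝕜) : E → 𝕜 :=
  fun τ => lineDeriv 𝕜 F τ e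

/-! ## The Kaup-Broer systems -/

/-- `∂/∂u`, `∂/∂v`, `∂/∂t` for functions of `(u, v, t) ∈ ℂ³`. -/
def dU (F : ℂ × ℂ × ℂ → ℂ) : ℂ × ℂ × ℂ → ℂ := pd ℂ (1, 0, 0) F
def dV (F : ℂ × ℂ × ℂ → ℂ) : ℂ × ℂ × ℂ → ℂ := pd ℂ (0, 1, 0) F
def dT (F : ℂ × ℂ × ℂ → ℂ) : ℂ × ℂ × ℂ → ℂ := pd ℂ (0, 0, 1) F

/-- The three equations of the complex (2+1)D Kaup-Broer system at the point `w = (u, v, t)`. -/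
def IsKB21At (a α β : ℂ) (φ η P : ℂ × ℂ × ℂ → ℂ) (w : ℂ × ℂ × ℂ) : Prop :=
  dT φ w + α * dU φ w ^ 2 - β * dV φ w ^ 2 + P w = 0 ∧
  dT η w + 2 * α * dU (fun z => dU φ z * η z) w - 2 * β * dV (fun z => dV φ z * η z) w
      - 2 * a * α * dU (dU φ) w + 2 * a * β * dV (dV φ) w
      + α / 2 * dV (dU (dU (dU φ))) w - β / 2 * dV (dV (dV (dU φ))) w = 0 ∧
  dV (dU P) w = 2 * α * dU (dU η) w - 2 * β * dV (dV η) w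

/-- A holomorphic solution of the complex (2+1)D Kaup-Broer system on `Ω`. -/
structure IsKB21Solution (a α β : ℂ) (Ω : Set (ℂ × ℂ × ℂ)) (φ η P : ℂ × ℂ × ℂ → ℂ) :
    Prop where
  φ_hol : DifferentiableOn ℂ φ Ω
  η_hol : DifferentiableOn ℂ η Ω
  P_hol : DifferentiableOn ℂ P Ω
  eqs : ∀ w ∈ Ω, IsKB21At a α β φ η P w

/-- The two equations of the (1+1)D Kaup-Broer system at the point `z = (x, t)`, with real
(`𝕜 = ℝ`) or complex (`𝕜 = ℂ`) variables and values. -/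
def IsKB11At {𝕜 : Type*} [RCLike 𝕜] (ε μ : 𝕜) (Φ H : 𝕜 × 𝕜 → 𝕜) (z : 𝕜 × 𝕜) : Prop :=
  pd 𝕜 (0, 1) Φ z + 1 / 2 * pd 𝕜 (1, 0) Φ z ^ 2 + ε * H z = 0 ∧
  pd 𝕜 (0, 1) H z + (pd 𝕜 (1, 0))^[2] Φ z + pd 𝕜 (1, 0) (fun y => H y * pd 𝕜 (1, 0) Φ y) z
      + μ * (pd 𝕜 (1, 0))^[4] Φ z = 0

/-- The phase of the (2+1)D Kaup-Broer system. -/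
def kbPhase (a α β : ℂ) (w : ℂ × ℂ × ℂ) (l : ℂ) : ℂ :=
  l * w.1 + a * l⁻¹ * w.2.1 + (α * l ^ 2 + a ^ 2 * β * (l ^ 2)⁻¹) * w.2.2

/-- The function `(u, v, t) ↦ F(p u + q v, τ t)`. -/
def pull (p q τ : ℂ) (F : ℂ × ℂ → ℂ) : ℂ × ℂ × ℂ → ℂ :=
  fun w => F (p * w.1 + q * w.2.1, τ * w.2.2)

/-- Under the ansatz `φ = κ Φ(p u + q v, τ t)`, `η = s H(p u + q v, τ t)`,
`Π = σ H(p u + q v, τ t)`, the complex (2+1)D Kaup-Broer system becomes the (1+1)D Kaup-Broer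
system with constants `ε`, `μ` for `(Φ, H)`: over the complex variables, and, where `Φ` and `H` are
real on the real points, over the real variables on the slice where `p u + q v` and `τ t` are
real. -/
def IsReduction (a α β : ℂ) (ε μ : ℝ) (p q κ s σ τ : ℂ) : Prop :=
  ∀ (U : Set (ℂ × ℂ)) (Φ H : ℂ × ℂ → ℂ), IsOpen U →
    DifferentiableOn ℂ Φ U → DifferentiableOn ℂ H U →
    (∀ w : ℂ × ℂ × ℂ, (p * w.1 + q * w.2.1, τ * w.2.2) ∈ U →
      (IsKB21At a α β (fun z => κ * pull p q τ Φ z) (fun z => s * pull p q τ H z)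
          (fun z => σ * pull p q τ H z) w ↔
        IsKB11At (ε : ℂ) (μ : ℂ) Φ H (p * w.1 + q * w.2.1, τ * w.2.2))) ∧
    ∀ Φr Hr : ℝ × ℝ → ℝ,
      (∀ x t : ℝ, ((x : ℂ), (t : ℂ)) ∈ U →
        Φ ((x : ℂ), (t : ℂ)) = (Φr (x, t) : ℂ) ∧ H ((x : ℂ), (t : ℂ)) = (Hr (x, t) : ℂ)) →
      ∀ (w : ℂ × ℂ × ℂ) (x t : ℝ), ((x : ℂ), (t : ℂ)) ∈ U →
        p * w.1 + q * w.2.1 = (x : ℂ) → τ * w.2.2 = (t : ℂ) →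
        (IsKB21At a α β (fun z => κ * pull p q τ Φ z) (fun z => s * pull p q τ H z)
            (fun z => σ * pull p q τ H z) w ↔
          IsKB11At ε μ Φr Hr (x, t))

/-! ## The Kaup-Broer hierarchy -/

/-- The times are indexed by the nonzero integers: `uₙ` has index `n`, `vₙ` has index `-n`. -/
abbrev FlowIdx : Type := {n : ℤ // n ≠ 0}

abbrev Times : Type := FlowIdx → ℂ

def u₁ : FlowIdx := ⟨1, by decide⟩

def v₁ : FlowIdx := ⟨-1, by decide⟩

/-- The direction of the time with index `n`. -/
def flow (n : FlowIdx) : Times := Pi.single n 1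

/-- Partial derivative with respect to the time with index `n`. -/
def dTime (n : FlowIdx) (F : Times → ℂ) : Times → ℂ := pd ℂ (flow n) F

/-- `∑ (uₙ λⁿ + vₙ λ⁻ⁿ)`. -/
def hierPhase (T : Times) (l : ℂ) : ℂ := ∑' n : FlowIdx, T n * l ^ (n : ℤ)

/-- The phase series converges for every nonzero `λ`. -/
def Admissible (T : Times) : Prop := ∀ l : ℂ, l ≠ 0 → Summable fun n : FlowIdx => T n * l ^ (n : ℤ)

/-- Change finitely many times of `T`. -/
def shift (T : Times) {k : ℕ} (i : Fin k → FlowIdx) (c : Fin k → ℂ) : Times :=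
  T + ∑ j, c j • flow (i j)

/-- The part of `Ω` that is reached from `T` by changing the times with indices `i`. -/
def slice (Ω : Set Times) (T : Times) {k : ℕ} (i : Fin k → FlowIdx) : Set (Fin k → ℂ) :=
  {c | shift T i c ∈ Ω}

/-- `Ω` is open in every finite set of times. -/
def SliceOpen (Ω : Set Times) : Prop :=
  ∀ (T : Times) (k : ℕ) (i : Fin k → FlowIdx), IsOpen (slice Ω T i)

/-- `F` is jointly holomorphic in every finite set of times. -/
def SliceHol (Ω : Set Times) (F : Times → ℂ) : Prop :=
  ∀ (T : Times) (k : ℕ) (i : Fin k → FlowIdx),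
    DifferentiableOn ℂ (fun c => F (shift T i c)) (slice Ω T i)

/-- `F` is jointly continuous in every finite set of times. -/
def SliceCont (Ω : Set Times) (F : Times → ℂ) : Prop :=
  ∀ (T : Times) (k : ℕ) (i : Fin k → FlowIdx),
    ContinuousOn (fun c => F (shift T i c)) (slice Ω T i)

/-- The Schrödinger-type operator at fixed energy
`L g = a (g_uv + φ_u g_v) + (η + (a/2) φ_uv - a) g`, where `u = u₁` and `v = v₁`. -/
def schr (a : ℂ) (φ η g : Times → ℂ) : Times → ℂ := fun T =>
  a * (dTime v₁ (dTime u₁ g) T + dTime u₁ φ T * dTime v₁ g T)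
    + (η T + a / 2 * dTime v₁ (dTime u₁ φ) T - a) * g T

/-- The operator `∂L/∂tₙ`, obtained by differentiating the coefficients of `L`. -/
def schrDot (a : ℂ) (φ η : Times → ℂ) (n : FlowIdx) (g : Times → ℂ) : Times → ℂ := fun T =>
  a * (dTime n (dTime u₁ φ) T * dTime v₁ g T)
    + (dTime n η T + a / 2 * dTime n (dTime v₁ (dTime u₁ φ)) T) * g T

/-- The flow of `uₙ` is generated by an operator in `∂/∂u₁`, that of `vₙ` by one in `∂/∂v₁`. -/
def base (n : FlowIdx) : FlowIdx := if 0 < n.1 then u₁ else v₁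

/-- `Aₙ g = ∑_{k ≤ |n|} c_{n,k} ∂ᵏ g`, where `∂ = ∂/∂u₁` for `n > 0` and `∂ = ∂/∂v₁` for `n < 0`. -/
def flowOp (c : FlowIdx → ℕ → Times → ℂ) (n : FlowIdx) (g : Times → ℂ) : Times → ℂ := fun T =>
  ∑ k ∈ Finset.range (n.1.natAbs + 1), c n k T * (dTime (base n))^[k] g T

/-- `g` is a function of `(u₁, v₁)`, holomorphic near `T`, that solves `L g = 0` near `T`; the other
times are frozen. -/
def IsLocalKernel (a : ℂ) (φ η : Times → ℂ) (T : Times) (g : Times → ℂ) : Prop :=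
  AnalyticAt ℂ (fun x : ℂ × ℂ => g (T + x.1 • flow u₁ + x.2 • flow v₁)) 0 ∧
    ∀ᶠ x : ℂ × ℂ in 𝓝 0, schr a φ η g (T + x.1 • flow u₁ + x.2 • flow v₁) = 0

/-- A formal series `∑ⱼ Wⱼ λʲ` stands for the function `exp(∑ tₙ λⁿ) ∑ⱼ Wⱼ λʲ`; this is the
action of `∂/∂tₙ` on such functions. -/
def covD (n : FlowIdx) (W : ℤ → Times → ℂ) : ℤ → Times → ℂ :=
  fun j T => dTime n (W j) T + W (j - n.1) T

/-- The formal wave function `W` solves the auxiliary linear problems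
`L ψ = 0` and `∂ψ/∂tₙ = Aₙ ψ` on `Ω`. -/
structure IsFormalWave (a : ℂ) (Ω : Set Times) (φ η : Times → ℂ)
    (c : FlowIdx → ℕ → Times → ℂ) (W : ℤ → Times → ℂ) : Prop where
  hol : ∀ j, SliceHol Ω (W j)
  schr_eq : ∀ T ∈ Ω, ∀ j,
    a * (covD v₁ (covD u₁ W) j T + dTime u₁ φ T * covD v₁ W j T)
      + (η T + a / 2 * dTime v₁ (dTime u₁ φ) T - a) * W j T = 0
  flow_eq : ∀ T ∈ Ω, ∀ n j,
    covD n W j T =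
      ∑ k ∈ Finset.range (n.1.natAbs + 1), c n k T * (covD (base n))^[k] W j T

/-- `(φ, η)` solves the complex (2+1)D Kaup-Broer hierarchy on `Ω`: the flows are the isospectral
deformations at fixed energy of the operator `L`. There are operators
`A_{uₙ} = ∂_u^n + (order ≤ n - 2)` and
`A_{vₙ} = ∂_v^n + n φ_v ∂_v^(n-1) + ⋯ ` without a term of order zero, such that, on the solutions
of `L g = 0`,
`∂L/∂tₙ = [Aₙ, L]` and `∂Aₙ/∂tₘ - ∂Aₘ/∂tₙ = [Aₘ, Aₙ]`
for all `m`, `n`. The integration constants in the coefficients are fixed by the formal wave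
functions `exp(∑ tₙ λⁿ) (1 + O(λ⁻¹))` at `λ = ∞` and `exp(∑ tₙ λⁿ) (exp(-φ) + O(λ))` at `λ = 0`. -/
def IsKBHierarchySolution (a : ℂ) (Ω : Set Times) (φ η : Times → ℂ) : Prop :=
  SliceHol Ω φ ∧ SliceHol Ω η ∧
  ∃ c : FlowIdx → ℕ → Times → ℂ,
    (∀ n k, SliceHol Ω (c n k)) ∧
    (∀ T ∈ Ω, ∀ n : FlowIdx, c n n.1.natAbs T = 1) ∧
    (∀ T ∈ Ω, ∀ n : FlowIdx, 0 < n.1 → c n (n.1.natAbs - 1) T = 0) ∧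
    (∀ T ∈ Ω, ∀ n : FlowIdx, n.1 < 0 → c n 0 T = 0) ∧
    (∀ T ∈ Ω, ∀ n : FlowIdx, n.1 < -1 →
      c n (n.1.natAbs - 1) T = (n.1.natAbs : ℂ) * dTime v₁ φ T) ∧
    (∀ T ∈ Ω, ∀ g, IsLocalKernel a φ η T g → ∀ n,
      schrDot a φ η n g T + schr a φ η (flowOp c n g) T = 0) ∧
    (∀ T ∈ Ω, ∀ g, IsLocalKernel a φ η T g → ∀ m n,
      flowOp (fun i k => dTime m (c i k)) n g T + flowOp c n (flowOp c m g) T =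
        flowOp (fun i k => dTime n (c i k)) m g T + flowOp c m (flowOp c n g) T) ∧
    (∃ W, IsFormalWave a Ω φ η c W ∧
      (∀ T ∈ Ω, W 0 T = 1) ∧ ∀ T ∈ Ω, ∀ j, 0 < j → W j T = 0) ∧
    ∃ W, IsFormalWave a Ω φ η c W ∧
      (∀ T ∈ Ω, W 0 T = Complex.exp (-φ T)) ∧ ∀ T ∈ Ω, ∀ j, j < 0 → W j T = 0

end KaupBroer

end

open KaupBroer

/-!
# Dressing solutions of the Kaup-Broer system and of its hierarchy

The proof is the nonlocal `∂̄` argument, carried out algebraically. The solution `f` of `ℒ f = g`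
defines the wave function `χ(λ) = 1 + π⁻¹ ∬ f(ξ) / (λ - ξ) d²ξ`, and `ℒ f = g` says that the
density of `χ` satisfies `f(ζ(p)) = R(p) χ(η(p))`. More generally a *wave function* is a Laurent
polynomial in `λ` plus a Cauchy integral of a density in `𝒟`, subject to the same relation. Two
facts carry everything.

* The relation is linear, and it is preserved by the covariant derivatives `∂/∂tₙ + (∂θ/∂tₙ)(λ)`,
  because the phase `θ` enters `R` as `exp(θ(η) - θ(ζ))` (`DressedDomain.cov_mem_waves`). This
  needs the product `λ χ` to be a wave function again, which changes the principal value of the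
  Cauchy integral by the total mass, and differentiation under the principal value. The latter is
  possible since the principal value is a bounded functional on sets with a uniform Hölder bound
  (`CauchyPoint.exists_norm_cauchy_le`, by the uniform boundedness principle) and since a
  holomorphic family with a uniform Hölder bound has a Taylor remainder with a Hölder bound of
  second order (`BddFunctional.hasFDerivAt`).
* A wave function without polynomial part is zero, as its density is in the nullspace of `ℒ`
  (`DressedDomain.eq_zero_of_mem_waves`).

A wave function is stored as its density together with its expansions at `λ = ∞` and `λ = 0`, with
coefficients in the ring of holomorphic functions of the times (`FlowDomain.Fun`). Given poles at
`λ = ∞` and `λ = 0` are removed by subtracting covariant derivatives of `χ`. What is left vanishes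
by the second fact, and this yields the linear equations `L ψ = 0` and `∂ψ/∂tₙ = Aₙ ψ`
(`IsPotential.schr_eq`, `IsPotential.exists_flow`).

For the (2+1)D system, the lowest coefficients of the linear equations at `λ = ∞` and `λ = 0`
imply the three equations by an identity in a ring with commuting derivations
(`kb21_of_coefficients`).

For the hierarchy, the operator equations must hold on *every* local solution `ψ` of `L ψ = 0`,
while the dressing only gives them on `χ`. The passage from one to the other is
`SolvedDomain.IsPotential.exists_submodule_pairs`: modulo `L` an operator in `∂_u`, `∂_v` is a
combination of pure powers `∂_u^k`, `∂_v^k`, whose values on `χ` have poles of different orders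
and so are linearly independent (`IsPotential.linearIndependent_derivs`). An operator that
annihilates `χ` is therefore a left multiple of `L`.

Holomorphic dependence on the times is assumed when the supports meet. When they are disjoint the
Cauchy integral is a compact operator on the continuous functions, so that trivial nullspace
implies invertibility, and the solution is analytic in the parameters
(`NoOverlap.holomorphic_solution`).

The reductions are a computation with the chain rule (`isKB21At_pull_iff`).
-/


open Filter Topology MeasureTheory

noncomputable section

namespace KaupBroer

/-! ### Holomorphic functions of several variables -/

section SeveralVariables

variable {E : Type*} [NormedAddCommGroup E] [NormedSpace ℂ E]

theorem norm_fderiv_le_of_norm_le {G : E → ℂ} {c : E} {r M : ℝ} (hr : 0 < r)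
    (hG : DifferentiableOn ℂ G (Metric.ball c r)) (hM : ∀ x ∈ Metric.ball c r, ‖G x‖ ≤ M) :
    ‖fderiv ℂ G c‖ ≤ 2 * M / r := by
  refine Complex.norm_fderiv_le_div_of_mapsTo_ball hG (fun x hx => ?_) hr
  rw [Metric.mem_closedBall, dist_eq_norm]
  have h1 := hM x hx
  have h2 := hM c (Metric.mem_ball_self hr)
  linarith [norm_sub_le (G x) (G c)]

/-- A second-order Taylor estimate that only uses a bound on the function. -/
theorem norm_sub_sub_fderiv_le {G : E → ℂ} {c z : E} {r M : ℝ} (hr : 0 < r)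
    (hG : DifferentiableOn ℂ G (Metric.ball c r)) (hM : ∀ x ∈ Metric.ball c r, ‖G x‖ ≤ M)
    (hz : z ∈ Metric.ball c r) :
    ‖G z - G c - fderiv ℂ G c (z - c)‖ ≤ 4 * M * (‖z - c‖ / r) ^ 2 := by
  have hc : DifferentiableAt ℂ G c := hG.differentiableAt (Metric.ball_mem_nhds _ hr)
  have h0 : 0 ≤ M := (norm_nonneg _).trans (hM c (Metric.mem_ball_self hr))
  have key := Complex.dist_le_mul_div_pow_of_mapsTo_ball_of_isLittleO
    (f := fun x => G x - fderiv ℂ G c (x - c)) (c := c) (z := z) (R₁ := r) (R₂ := 4 * M) (n := 1)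
    (hG.sub (by fun_prop)) (fun x hx => ?_) ?_ hz
  · simp only [dist_eq_norm, sub_self, map_zero, sub_zero] at key
    refine le_trans (le_of_eq ?_) key
    congr 1
    ring
  · rw [Metric.mem_closedBall, dist_eq_norm]
    simp only [sub_self, map_zero, sub_zero]
    have h1 := hM x hx
    have h2 := hM c (Metric.mem_ball_self hr)
    have h3 : ‖fderiv ℂ G c (x - c)‖ ≤ 2 * M := by
      refine (ContinuousLinearMap.le_opNorm _ _).trans ?_
      have h4 := norm_fderiv_le_of_norm_le hr hG hM
      have h5 : ‖x - c‖ ≤ r := by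
        rw [← dist_eq_norm]; exact (Metric.mem_ball.1 hx).le
      calc _ ≤ 2 * M / r * r := by gcongr
        _ = 2 * M := by field_simp
    calc ‖G x - fderiv ℂ G c (x - c) - G c‖
        ≤ ‖G x‖ + ‖fderiv ℂ G c (x - c)‖ + ‖G c‖ :=
          (norm_sub_le _ _).trans (by gcongr; exact norm_sub_le _ _)
      _ ≤ 4 * M := by linarith
  · have := hc.hasFDerivAt.isLittleO
    simp only [pow_one, sub_self, map_zero, sub_zero]
    refine (Asymptotics.isLittleO_norm_right.2 this).congr_left fun x => by ring

/-- Near a point of its domain a holomorphic function is bounded. -/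
theorem exists_ball_norm_le {G : E → ℂ} {U : Set E} (hU : IsOpen U) (hG : DifferentiableOn ℂ G U)
    {x : E} (hx : x ∈ U) : ∃ r > 0, ∃ M, Metric.ball x r ⊆ U ∧
      ∀ y ∈ Metric.ball x r, ‖G y‖ ≤ M := by
  have hc : ContinuousAt G x := (hG.differentiableAt (hU.mem_nhds hx)).continuousAt
  have h1 : ∀ᶠ y in 𝓝 x, ‖G y‖ < ‖G x‖ + 1 := hc.norm.eventually_lt_const (by linarith)
  obtain ⟨r, hr, h⟩ := Metric.eventually_nhds_iff_ball.1 (h1.and (hU.mem_nhds hx))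
  exact ⟨r, hr, ‖G x‖ + 1, fun y hy => (h y hy).2, fun y hy => (h y hy).1.le⟩

variable [FiniteDimensional ℂ E]

/-- Directional derivatives of holomorphic functions of several variables are holomorphic, by the
Cauchy integral formula on a complex line. -/
theorem differentiableOn_fderiv_apply {G : E → ℂ} {U : Set E} (hU : IsOpen U)
    (hG : DifferentiableOn ℂ G U) (e : E) : DifferentiableOn ℂ (fun x => fderiv ℂ G x e) U := by
  intro x hx
  refine DifferentiableAt.differentiableWithinAt ?_
  obtain ⟨r, hr, M, hrU, hM⟩ := exists_ball_norm_le hU hG hx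
  have hM0 : 0 ≤ M := (norm_nonneg _).trans (hM x (Metric.mem_ball_self hr))
  -- all points `y + s • e` with `y` near `x` and `‖s‖ ≤ ρ` stay in the ball of radius `r / 2`
  obtain ⟨ρ, hρ, hρe⟩ : ∃ ρ > 0, ρ * ‖e‖ < r / 4 := by
    refine ⟨r / 4 / (‖e‖ + 1), by positivity, ?_⟩
    rw [div_mul_eq_mul_div, div_lt_iff₀ (by positivity)]
    nlinarith [norm_nonneg e]
  have hmem : ∀ y ∈ Metric.ball x (r / 4), ∀ s : ℂ, ‖s‖ ≤ ρ →
      y + s • e ∈ Metric.ball x (r / 2) := by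
    intro y hy s hs
    rw [Metric.mem_ball, dist_eq_norm] at hy ⊢
    have h1 : ‖s • e‖ ≤ ρ * ‖e‖ := by rw [norm_smul]; gcongr
    calc ‖y + s • e - x‖ = ‖(y - x) + s • e‖ := by congr 1; abel
      _ ≤ ‖y - x‖ + ‖s • e‖ := norm_add_le _ _
      _ < r / 2 := by linarith
  have hdiff : ∀ y ∈ Metric.ball x (r / 2), DifferentiableAt ℂ G y := fun y hy =>
    hG.differentiableAt (hU.mem_nhds (hrU (Metric.ball_subset_ball (by linarith) hy)))
  have hbound : ∀ y ∈ Metric.ball x (r / 2), ‖fderiv ℂ G y‖ ≤ 2 * M / (r / 2) := by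
    intro y hy
    have hsub : Metric.ball y (r / 2) ⊆ Metric.ball x r :=
      Metric.ball_subset_ball' (by linarith [Metric.mem_ball.1 hy])
    exact norm_fderiv_le_of_norm_le (by linarith) (hG.mono (hsub.trans hrU))
      fun z hz => hM z (hsub hz)
  let k : ℝ → ℂ := fun t => (2 * Real.pi * Complex.I)⁻¹ *
    (deriv (circleMap 0 ρ) t * (1 / (circleMap 0 ρ t) ^ 2))
  have hcm : ∀ t, ‖circleMap 0 ρ t‖ = ρ := fun t => by simp [abs_of_pos hρ]
  have hne : ∀ t, circleMap 0 ρ t ≠ 0 := fun t => circleMap_ne_center hρ.ne'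
  have hk : Continuous k := by
    have h1 : Continuous fun t => circleMap 0 ρ t := continuous_circleMap 0 ρ
    simp only [k, deriv_circleMap]
    refine continuous_const.mul ((h1.mul continuous_const).mul ?_)
    exact continuous_const.div (h1.pow 2) fun t => pow_ne_zero 2 (hne t)
  have hformula : ∀ y ∈ Metric.ball x (r / 4),
      fderiv ℂ G y e = ∫ t in (0 : ℝ)..2 * Real.pi, k t * G (y + circleMap 0 ρ t • e) := by
    intro y hy
    have hline : ∀ s : ℂ, ‖s‖ ≤ ρ → HasDerivAt (fun s : ℂ => G (y + s • e))
        (fderiv ℂ G (y + s • e) e) s := by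
      intro s hs
      have h1 : HasDerivAt (fun s : ℂ => y + s • e) e s := by
        simpa using ((hasDerivAt_id s).smul_const e).const_add y
      exact (hdiff _ (hmem y hy s hs)).hasFDerivAt.comp_hasDerivAt s h1
    have h2 : DifferentiableOn ℂ (fun s : ℂ => G (y + s • e)) (Metric.closedBall 0 ρ) := fun s hs =>
      (hline s (by simpa using hs)).differentiableAt.differentiableWithinAt
    have h3 := h2.deriv_eq_smul_circleIntegral hρ
    have h4 : deriv (fun s : ℂ => G (y + s • e)) 0 = fderiv ℂ G y e := by
      simpa using (hline 0 (by simpa using hρ.le)).deriv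
    rw [h4] at h3
    have hpi : (2 * Real.pi * Complex.I : ℂ) ≠ 0 := Complex.two_pi_I_ne_zero
    rw [smul_eq_mul] at h3
    rw [← mul_right_inj' hpi, ← h3, circleIntegral, ← intervalIntegral.integral_const_mul]
    congr 1
    funext t
    simp only [k, smul_eq_mul, sub_zero]
    field_simp
  have hcont : ∀ y ∈ Metric.ball x (r / 4),
      Continuous fun t : ℝ => k t * G (y + circleMap 0 ρ t • e) := by
    intro y hy
    refine hk.mul (continuous_iff_continuousAt.2 fun t => ?_)
    have h1 : ContinuousAt (fun t : ℝ => y + circleMap 0 ρ t • e) t := by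
      have : Continuous fun t : ℝ => circleMap 0 ρ t := continuous_circleMap 0 ρ
      exact (continuous_const.add (this.smul continuous_const)).continuousAt
    exact ContinuousAt.comp (f := fun t : ℝ => y + circleMap 0 ρ t • e)
      (hdiff _ (hmem y hy _ (hcm t).le)).continuousAt h1
  have hD := intervalIntegral.hasFDerivAt_integral_of_dominated_of_fderiv_le (𝕜 := ℂ)
    (μ := volume) (a := 0) (b := 2 * Real.pi) (x₀ := x) (s := Metric.ball x (r / 4))
    (F := fun y t => k t * G (y + circleMap 0 ρ t • e))
    (F' := fun y t => k t • fderiv ℂ G (y + circleMap 0 ρ t • e))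
    (bound := fun t => ‖k t‖ * (2 * M / (r / 2)))
    (Metric.ball_mem_nhds x (by linarith))
    (by
      filter_upwards [Metric.ball_mem_nhds x (show 0 < r / 4 by linarith)] with y hy
      exact (hcont y hy).aestronglyMeasurable)
    ((hcont x (Metric.mem_ball_self (by linarith))).intervalIntegrable _ _)
    (by
      borelize E
      have h1 : Measurable fun t : ℝ => x + circleMap 0 ρ t • e := by
        have : Continuous fun t : ℝ => circleMap 0 ρ t := continuous_circleMap 0 ρ
        exact (continuous_const.add (this.smul continuous_const)).measurable
      have h2 := (measurable_fderiv ℂ G).comp h1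
      have : FiniteDimensional ℂ (E →L[ℂ] ℂ) := inferInstance
      have : ProperSpace (E →L[ℂ] ℂ) := FiniteDimensional.proper ℂ _
      exact hk.aestronglyMeasurable.smul h2.aestronglyMeasurable)
    (Eventually.of_forall fun t _ y hy => by
      rw [norm_smul]
      gcongr
      exact hbound _ (hmem y hy _ (hcm t).le))
    ((hk.norm.mul continuous_const).intervalIntegrable _ _)
    (Eventually.of_forall fun t _ y hy => by
      have h1 : HasFDerivAt (fun y : E => y + circleMap 0 ρ t • e) (ContinuousLinearMap.id ℂ E) y :=
        (hasFDerivAt_id y).add_const _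
      exact ((hdiff _ (hmem y hy _ (hcm t).le)).hasFDerivAt.comp y h1).const_mul (k t))
  refine (hD.congr_of_eventuallyEq ?_).differentiableAt
  filter_upwards [Metric.ball_mem_nhds x (show 0 < r / 4 by linarith)] with y hy
  exact hformula y hy

theorem contDiffOn_of_differentiableOn {G : E → ℂ} {U : Set E} (hU : IsOpen U)
    (hG : DifferentiableOn ℂ G U) (n : ℕ) : ContDiffOn ℂ n G U := by
  induction n generalizing G with
  | zero => exact contDiffOn_zero.2 hG.continuousOn
  | succ n ih =>
    push_cast
    rw [contDiffOn_succ_iff_fderiv_of_isOpen hU]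
    refine ⟨hG, by simp, ?_⟩
    rw [contDiffOn_clm_apply]
    exact fun e => ih (differentiableOn_fderiv_apply hU hG e)

end SeveralVariables

/-! ### The differential algebra of holomorphic functions of finitely many times -/

/-- A set in a complex vector space with a family of distinguished directions (the "times") that is
open in every finite set of directions. The space carries no topology. -/
structure FlowDomain (V I : Type*) [AddCommGroup V] [Module ℂ V] where
  dir : I → V
  carrier : Set V
  isOpen_slice : ∀ (T : V) (k : ℕ) (i : Fin k → I),
    IsOpen {c : Fin k → ℂ | T + ∑ j, c j • dir (i j) ∈ carrier}

namespace FlowDomain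

variable {V I : Type*} [AddCommGroup V] [Module ℂ V] (X : FlowDomain V I)

/-- Move from `T` by the amounts `c` along the directions `i`. -/
def move (T : V) {k : ℕ} (i : Fin k → I) (c : Fin k → ℂ) : V := T + ∑ j, c j • X.dir (i j)

/-- The displacements that keep `T` inside the domain. -/
def sliceAt (T : V) {k : ℕ} (i : Fin k → I) : Set (Fin k → ℂ) := {c | X.move T i c ∈ X.carrier}

theorem isOpen_sliceAt (T : V) {k : ℕ} (i : Fin k → I) : IsOpen (X.sliceAt T i) :=
  X.isOpen_slice T k i

theorem mem_sliceAt {T : V} {k : ℕ} {i : Fin k → I} {c : Fin k → ℂ} :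
    c ∈ X.sliceAt T i ↔ X.move T i c ∈ X.carrier := Iff.rfl

@[simp] theorem move_zero (T : V) {k : ℕ} (i : Fin k → I) : X.move T i 0 = T := by simp [move]

theorem move_add_smul_single (T : V) {k : ℕ} (i : Fin k → I) (c : Fin k → ℂ) (j : Fin k) (s : ℂ) :
    X.move T i (c + s • Pi.single j 1) = X.move T i c + s • X.dir (i j) := by
  simp [move, add_smul, Finset.sum_add_distrib, add_assoc, Pi.single_apply]

theorem move_cons (T : V) {k : ℕ} (i : Fin k → I) (c : Fin k → ℂ) (n : I) (s : ℂ) :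
    X.move T (Fin.cons n i : Fin (k + 1) → I) (Fin.cons s c : Fin (k + 1) → ℂ)
      = X.move T i c + s • X.dir n := by
  simp only [move, Fin.sum_univ_succ, Fin.cons_zero, Fin.cons_succ]
  abel

theorem zero_mem_sliceAt {T : V} (hT : T ∈ X.carrier) {k : ℕ} (i : Fin k → I) :
    (0 : Fin k → ℂ) ∈ X.sliceAt T i := by simpa [mem_sliceAt] using hT

theorem eventually_mem {T : V} (hT : T ∈ X.carrier) (n : I) :
    ∀ᶠ s : ℂ in 𝓝 0, T + s • X.dir n ∈ X.carrier := by
  have h : Tendsto (fun s : ℂ => s • (Pi.single 0 1 : Fin 1 → ℂ)) (𝓝 0) (𝓝 0) :=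
    Continuous.tendsto' (by fun_prop) _ _ (by simp)
  have h2 := h.eventually
    ((X.isOpen_sliceAt T (fun _ : Fin 1 => n)).mem_nhds (X.zero_mem_sliceAt hT _))
  filter_upwards [h2] with s hs
  have := X.move_add_smul_single T (fun _ : Fin 1 => n) 0 0 s
  rw [zero_add, move_zero] at this
  rw [← this]
  exact hs

/-- Joint holomorphy in every finite set of directions. -/
def Hol (F : V → ℂ) : Prop :=
  ∀ (T : V) (k : ℕ) (i : Fin k → I), DifferentiableOn ℂ (fun c => F (X.move T i c)) (X.sliceAt T i)

variable {X}

theorem Hol.congr {F G : V → ℂ} (hF : X.Hol F) (h : Set.EqOn G F X.carrier) : X.Hol G :=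
  fun T k i => (hF T k i).congr fun _ hc => h hc

theorem Hol.add {F G : V → ℂ} (hF : X.Hol F) (hG : X.Hol G) : X.Hol fun T => F T + G T :=
  fun T k i => (hF T k i).add (hG T k i)

theorem Hol.mul {F G : V → ℂ} (hF : X.Hol F) (hG : X.Hol G) : X.Hol fun T => F T * G T :=
  fun T k i => (hF T k i).mul (hG T k i)

theorem Hol.const (c : ℂ) : X.Hol fun _ => c := fun _ _ _ => differentiableOn_const c

theorem Hol.differentiableAt {F : V → ℂ} (hF : X.Hol F) (T : V) {k : ℕ} (i : Fin k → I)
    {c : Fin k → ℂ} (hc : c ∈ X.sliceAt T i) :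
    DifferentiableAt ℂ (fun c => F (X.move T i c)) c :=
  (hF T k i).differentiableAt ((X.isOpen_sliceAt T i).mem_nhds hc)

theorem Hol.hasDerivAt_line {F : V → ℂ} (hF : X.Hol F) (T : V) {k : ℕ} (i : Fin k → I)
    {c : Fin k → ℂ} (hc : c ∈ X.sliceAt T i) (j : Fin k) :
    HasDerivAt (fun s : ℂ => F (X.move T i c + s • X.dir (i j)))
      (fderiv ℂ (fun c => F (X.move T i c)) c (Pi.single j 1)) 0 := by
  have h1 : HasDerivAt (fun s : ℂ => c + s • (Pi.single j 1 : Fin k → ℂ)) (Pi.single j 1) 0 := by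
    simpa using ((hasDerivAt_id (0 : ℂ)).smul_const (Pi.single j 1 : Fin k → ℂ)).const_add c
  have h2 : HasFDerivAt (fun c => F (X.move T i c)) (fderiv ℂ (fun c => F (X.move T i c)) c)
      (c + (0 : ℂ) • (Pi.single j 1 : Fin k → ℂ)) := by
    simpa using (hF.differentiableAt T i hc).hasFDerivAt
  have h3 := h2.comp_hasDerivAt (0 : ℂ) h1
  simpa [Function.comp_def, move_add_smul_single] using h3

theorem Hol.pd_move {F : V → ℂ} (hF : X.Hol F) (T : V) {k : ℕ} (i : Fin k → I)
    {c : Fin k → ℂ} (hc : c ∈ X.sliceAt T i) (j : Fin k) :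
    pd ℂ (X.dir (i j)) F (X.move T i c)
      = fderiv ℂ (fun c => F (X.move T i c)) c (Pi.single j 1) :=
  (hF.hasDerivAt_line T i hc j).deriv

theorem Hol.hasDerivAt {F : V → ℂ} (hF : X.Hol F) {T : V} (hT : T ∈ X.carrier) (n : I) :
    HasDerivAt (fun s : ℂ => F (T + s • X.dir n)) (pd ℂ (X.dir n) F T) 0 := by
  have h0 := X.zero_mem_sliceAt hT (fun _ : Fin 1 => n)
  have h := hF.hasDerivAt_line T (fun _ : Fin 1 => n) h0 0
  have h2 := hF.pd_move T (fun _ : Fin 1 => n) h0 0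
  rw [move_zero] at h h2
  rwa [h2]

theorem pd_congr {F G : V → ℂ} (h : Set.EqOn F G X.carrier) {T : V} (hT : T ∈ X.carrier) (n : I) :
    pd ℂ (X.dir n) F T = pd ℂ (X.dir n) G T := by
  refine Filter.EventuallyEq.deriv_eq ?_
  filter_upwards [X.eventually_mem hT n] with s hs using h hs

theorem Hol.pd {F : V → ℂ} (hF : X.Hol F) (n : I) : X.Hol (pd ℂ (X.dir n) F) := by
  intro T k i
  -- the slice in the directions `i` is the hyperplane `s = 0` of the slice in the directions `n, i`
  let ι : (Fin k → ℂ) → (Fin (k + 1) → ℂ) := fun c => Fin.cons 0 c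
  have hι : Differentiable ℂ ι := by
    rw [differentiable_pi]
    intro j
    refine Fin.cases ?_ (fun j => ?_) j
    · simp [ι]
    · simp only [ι, Fin.cons_succ]; fun_prop
  have hmove : ∀ c, X.move T (Fin.cons n i : Fin (k + 1) → I) (ι c) = X.move T i c := fun c => by
    simp [ι, move_cons]
  have hmaps : Set.MapsTo ι (X.sliceAt T i) (X.sliceAt T (Fin.cons n i : Fin (k + 1) → I)) := by
    intro c hc
    rw [mem_sliceAt, hmove]; exact hc
  have h1 := (differentiableOn_fderiv_apply (X.isOpen_sliceAt T (Fin.cons n i : Fin (k + 1) → I))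
    (hF T (k + 1) (Fin.cons n i)) (Pi.single 0 1)).comp hι.differentiableOn hmaps
  refine h1.congr fun c hc => ?_
  have h2 := hF.pd_move T (Fin.cons n i : Fin (k + 1) → I) (hmaps hc) 0
  rw [hmove, Fin.cons_zero] at h2
  exact h2

theorem Hol.pd_comm {F : V → ℂ} (hF : X.Hol F) {T : V} (hT : T ∈ X.carrier) (m n : I) :
    KaupBroer.pd ℂ (X.dir m) (KaupBroer.pd ℂ (X.dir n) F) T
      = KaupBroer.pd ℂ (X.dir n) (KaupBroer.pd ℂ (X.dir m) F) T := by
  let i : Fin 2 → I := ![m, n]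
  let G : (Fin 2 → ℂ) → ℂ := fun c => F (X.move T i c)
  have h0 : (0 : Fin 2 → ℂ) ∈ X.sliceAt T i := X.zero_mem_sliceAt hT i
  have hopen := X.isOpen_sliceAt T i
  have hC : ContDiffAt ℂ 2 G 0 :=
    (contDiffOn_of_differentiableOn hopen (hF T 2 i) 2).contDiffAt (hopen.mem_nhds h0)
  have hsymm : IsSymmSndFDerivAt ℂ G 0 := hC.isSymmSndFDerivAt (by simp)
  have hd : DifferentiableAt ℂ (fderiv ℂ G) 0 :=
    (hC.fderiv_right (m := 1) (by norm_num)).differentiableAt (by norm_num)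
  have key : ∀ a b : Fin 2, KaupBroer.pd ℂ (X.dir (i a)) (KaupBroer.pd ℂ (X.dir (i b)) F) T
      = fderiv ℂ (fderiv ℂ G) 0 (Pi.single a 1) (Pi.single b 1) := by
    intro a b
    have h1 := (hF.pd (i b)).pd_move T i h0 a
    rw [move_zero] at h1
    rw [h1]
    have h2 : (fun c => KaupBroer.pd ℂ (X.dir (i b)) F (X.move T i c))
        =ᶠ[𝓝 0] fun c => fderiv ℂ G c (Pi.single b 1) := by
      filter_upwards [hopen.mem_nhds h0] with c hc using hF.pd_move T i hc b
    rw [h2.fderiv_eq, fderiv_clm_apply hd (by fun_prop)]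
    simp
  have h01 := key 0 1
  have h10 := key 1 0
  simp only [i, Matrix.cons_val_zero, Matrix.cons_val_one] at h01 h10
  rw [h01, h10]
  exact hsymm _ _

variable (X)

open Classical in
/-- Extension by zero of a function on the domain. -/
def ext (F : X.carrier → ℂ) : V → ℂ := fun T => if h : T ∈ X.carrier then F ⟨T, h⟩ else 0

/-- The subalgebra of holomorphic functions on the domain. -/
def holSubalgebra : Subalgebra ℂ (X.carrier → ℂ) where
  carrier := {F | X.Hol (X.ext F)}
  mul_mem' {F G} hF hG := (Hol.mul hF hG).congr fun T hT => by simp [ext, hT]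
  add_mem' {F G} hF hG := (Hol.add hF hG).congr fun T hT => by simp [ext, hT]
  algebraMap_mem' c := (Hol.const c).congr fun T hT => by
    simp [ext, hT, Pi.algebraMap_apply]

/-- The algebra of holomorphic functions on the domain. -/
def Fun : Type _ := X.holSubalgebra

instance : CommRing X.Fun := inferInstanceAs (CommRing X.holSubalgebra)

instance : Algebra ℂ X.Fun := inferInstanceAs (Algebra ℂ X.holSubalgebra)

/-- The function on the whole space that is given by an element of the algebra. -/
def val (x : X.Fun) : V → ℂ := X.ext (Subtype.val x)

theorem hol_val (x : X.Fun) : X.Hol (X.val x) := Subtype.property x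

variable {X}

theorem Fun.ext_val {x y : X.Fun} (h : ∀ T ∈ X.carrier, X.val x T = X.val y T) : x = y := by
  refine Subtype.ext ?_
  funext T
  have := h T.1 T.2
  simpa [val, FlowDomain.ext, T.2] using this

/-- A holomorphic function on the domain as an element of the algebra. -/
def Hol.toFun {F : V → ℂ} (hF : X.Hol F) : X.Fun :=
  (⟨fun T => F T.1, hF.congr fun T hT => by simp [ext, hT]⟩ : X.holSubalgebra)

theorem Hol.val_toFun {F : V → ℂ} (hF : X.Hol F) {T : V} (hT : T ∈ X.carrier) :
    X.val hF.toFun T = F T := by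
  simp only [val, ext, dif_pos hT]
  rfl

theorem val_of_mem (x : X.Fun) {T : V} (hT : T ∈ X.carrier) :
    X.val x T = Subtype.val x ⟨T, hT⟩ := by
  simp only [val, ext, dif_pos hT]

theorem val_of_notMem (x : X.Fun) {T : V} (hT : T ∉ X.carrier) : X.val x T = 0 := by
  simp only [val, ext, dif_neg hT]

theorem val_add (x y : X.Fun) (T : V) : X.val (x + y) T = X.val x T + X.val y T := by
  by_cases h : T ∈ X.carrier
  · simp only [val_of_mem _ h]; rfl
  · simp [val_of_notMem _ h]

theorem val_mul (x y : X.Fun) (T : V) : X.val (x * y) T = X.val x T * X.val y T := by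
  by_cases h : T ∈ X.carrier
  · simp only [val_of_mem _ h]; rfl
  · simp [val_of_notMem _ h]

theorem val_smul (c : ℂ) (x : X.Fun) (T : V) : X.val (c • x) T = c * X.val x T := by
  by_cases h : T ∈ X.carrier
  · simp only [val_of_mem _ h]; rfl
  · simp [val_of_notMem _ h]

theorem val_neg (x : X.Fun) (T : V) : X.val (-x) T = -X.val x T := by
  rw [← neg_one_smul ℂ x, val_smul, neg_one_mul]

theorem val_sub (x y : X.Fun) (T : V) : X.val (x - y) T = X.val x T - X.val y T := by
  rw [sub_eq_add_neg, val_add, val_neg, sub_eq_add_neg]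

theorem val_zero (T : V) : X.val (0 : X.Fun) T = 0 := by
  rw [← zero_smul ℂ (0 : X.Fun), val_smul, zero_mul]

theorem val_one {T : V} (hT : T ∈ X.carrier) : X.val (1 : X.Fun) T = 1 := by
  rw [val_of_mem _ hT]; rfl

theorem val_algebraMap (c : ℂ) {T : V} (hT : T ∈ X.carrier) :
    X.val (algebraMap ℂ X.Fun c) T = c := by
  rw [Algebra.algebraMap_eq_smul_one, val_smul, val_one hT, mul_one]

theorem val_sum {ι : Type*} (s : Finset ι) (x : ι → X.Fun) (T : V) :
    X.val (∑ k ∈ s, x k) T = ∑ k ∈ s, X.val (x k) T := by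
  classical
  induction s using Finset.induction_on with
  | empty => simp [val_zero]
  | insert a s ha ih => rw [Finset.sum_insert ha, Finset.sum_insert ha, val_add, ih]

variable (X)

/-- The derivation in the direction with index `n`. -/
def d (n : I) : Derivation ℂ X.Fun X.Fun :=
  Derivation.mk'
    { toFun := fun x => ((X.hol_val x).pd n).toFun
      map_add' := fun x y => Fun.ext_val fun T hT => by
        rw [Hol.val_toFun _ hT, val_add, Hol.val_toFun _ hT, Hol.val_toFun _ hT]
        have h := ((X.hol_val x).hasDerivAt hT n).add ((X.hol_val y).hasDerivAt hT n)
        rw [← h.deriv]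
        simp only [pd, lineDeriv, val_add]
        rfl
      map_smul' := fun c x => Fun.ext_val fun T hT => by
        rw [Hol.val_toFun _ hT, RingHom.id_apply, val_smul, Hol.val_toFun _ hT]
        rw [← (((X.hol_val x).hasDerivAt hT n).const_mul c).deriv]
        simp only [pd, lineDeriv, val_smul] }
    fun x y => Fun.ext_val fun T hT => by
      simp only [LinearMap.coe_mk, AddHom.coe_mk, smul_eq_mul]
      rw [Hol.val_toFun _ hT, val_add, val_mul, val_mul, Hol.val_toFun _ hT, Hol.val_toFun _ hT]
      have h := ((X.hol_val x).hasDerivAt hT n).mul ((X.hol_val y).hasDerivAt hT n)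
      simp only [zero_smul, add_zero] at h
      have h2 : pd ℂ (X.dir n) (X.val (x * y)) T =
          pd ℂ (X.dir n) (X.val x) T * X.val y T + X.val x T * pd ℂ (X.dir n) (X.val y) T := by
        rw [← h.deriv]
        simp only [pd, lineDeriv, val_mul]
        rfl
      rw [h2]
      ring

variable {X}

theorem val_d (n : I) (x : X.Fun) {T : V} (hT : T ∈ X.carrier) :
    X.val (X.d n x) T = pd ℂ (X.dir n) (X.val x) T :=
  Hol.val_toFun ((X.hol_val x).pd n) hT

theorem d_comm (m n : I) (x : X.Fun) : X.d m (X.d n x) = X.d n (X.d m x) := by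
  refine Fun.ext_val fun T hT => ?_
  rw [val_d m _ hT, val_d n _ hT,
    pd_congr (fun S hS => val_d n x hS) hT, pd_congr (fun S hS => val_d m x hS) hT]
  exact (X.hol_val x).pd_comm hT m n

/-- The function `F` on the whole space agrees on the domain with the element `x` of the algebra. -/
def Rep (X : FlowDomain V I) (F : V → ℂ) (x : X.Fun) : Prop := ∀ T ∈ X.carrier, F T = X.val x T

theorem Hol.rep {F : V → ℂ} (hF : X.Hol F) : X.Rep F hF.toFun := fun _ hT => (hF.val_toFun hT).symm

theorem rep_val (x : X.Fun) : X.Rep (X.val x) x := fun _ _ => rfl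

theorem Rep.hol {F : V → ℂ} {x : X.Fun} (h : X.Rep F x) : X.Hol F := (X.hol_val x).congr h

theorem Rep.pd {F : V → ℂ} {x : X.Fun} (h : X.Rep F x) (n : I) :
    X.Rep (pd ℂ (X.dir n) F) (X.d n x) := fun T hT => by
  rw [val_d n x hT, pd_congr h hT]

theorem Rep.add {F G : V → ℂ} {x y : X.Fun} (hF : X.Rep F x) (hG : X.Rep G y) :
    X.Rep (fun T => F T + G T) (x + y) := fun T hT => by
  simp only [val_add, hF T hT, hG T hT]

theorem Rep.sub {F G : V → ℂ} {x y : X.Fun} (hF : X.Rep F x) (hG : X.Rep G y) :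
    X.Rep (fun T => F T - G T) (x - y) := fun T hT => by
  simp only [val_sub, hF T hT, hG T hT]

theorem Rep.mul {F G : V → ℂ} {x y : X.Fun} (hF : X.Rep F x) (hG : X.Rep G y) :
    X.Rep (fun T => F T * G T) (x * y) := fun T hT => by
  simp only [val_mul, hF T hT, hG T hT]

theorem Rep.const_mul {F : V → ℂ} {x : X.Fun} (c : ℂ) (hF : X.Rep F x) :
    X.Rep (fun T => c * F T) (c • x) := fun T hT => by
  simp only [val_smul, hF T hT]

theorem Rep.unique {F : V → ℂ} {x y : X.Fun} (hF : X.Rep F x) (hG : X.Rep F y) : x = y :=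
  Fun.ext_val fun T hT => by rw [← hF T hT, ← hG T hT]

/-- A continuous logarithm of a holomorphic function without zeros is holomorphic. -/
theorem hol_of_exp_neg {φ : V → ℂ} {E : V → ℂ}
    (hφ : ∀ (T : V) (k : ℕ) (i : Fin k → I),
      ContinuousOn (fun c => φ (X.move T i c)) (X.sliceAt T i))
    (hE : X.Hol E) (h : ∀ T ∈ X.carrier, Complex.exp (-φ T) = E T) : X.Hol φ := by
  intro T k i c hc
  have hnhds := (X.isOpen_sliceAt T i).mem_nhds hc
  refine DifferentiableAt.differentiableWithinAt ?_
  have hcont : ContinuousAt (fun c => φ (X.move T i c)) c := (hφ T k i).continuousAt hnhds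
  -- near `c` the branch is `φ(c) - log (E / E(c))` with the principal branch of the logarithm
  have hlog : ∀ᶠ b in 𝓝 c, φ (X.move T i b) = φ (X.move T i c)
      - Complex.log (E (X.move T i b) / E (X.move T i c)) := by
    have h1 : ∀ᶠ b in 𝓝 c, ‖φ (X.move T i b) - φ (X.move T i c)‖ < 1 := by
      have := (Metric.tendsto_nhds.1 hcont.tendsto) 1 one_pos
      simpa [dist_eq_norm] using this
    filter_upwards [h1, hnhds] with b hb hbs
    rw [← h _ hbs, ← h _ hc, ← Complex.exp_sub, Complex.log_exp]
    · ring
    all_goals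
      have h2 := (Complex.abs_im_le_norm (φ (X.move T i b) - φ (X.move T i c))).trans_lt hb
      rw [abs_lt] at h2
      simp only [Complex.sub_im, Complex.neg_im] at h2 ⊢
      linarith [Real.pi_gt_three, h2.1, h2.2]
  refine DifferentiableAt.congr_of_eventuallyEq ?_ hlog
  have hEd := hE.differentiableAt T i hc
  have hne : E (X.move T i c) ≠ 0 := by rw [← h _ hc]; exact Complex.exp_ne_zero _
  refine (differentiableAt_const _).sub (DifferentiableAt.clog (by
    simpa only [div_eq_mul_inv] using hEd.mul_const _) ?_)
  rw [div_self hne]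
  exact Complex.one_mem_slitPlane

end FlowDomain

/-! ### Integration and Hölder bounds on the parameter space -/

namespace DressingSupport

variable (X : DressingSupport)

/-- Two points of the same interval or of the same patch, at the given distance. -/
inductive Linked : X.Pt → X.Pt → ℝ → Prop
  | curve (m s s') : Linked (X.curve m s) (X.curve m s') (dist s s')
  | patch (l p p') : Linked (X.patch l p) (X.patch l p') (dist p p')

variable {X}

theorem Linked.nonneg {p q : X.Pt} {δ : ℝ} (h : X.Linked p q δ) : 0 ≤ δ := by
  cases h <;> exact dist_nonneg

theorem holderWith_iff {Y : Type*} [PseudoMetricSpace Y] {C r : NNReal} {f : Y → ℂ} :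
    HolderWith C r f ↔ ∀ x y, ‖f x - f y‖ ≤ C * dist x y ^ (r : ℝ) := by
  refine ⟨fun h x y => by rw [← dist_eq_norm]; exact h.dist_le x y, fun h x y => ?_⟩
  have h1 := h x y
  rw [← dist_eq_norm] at h1
  rw [edist_dist, edist_dist, ENNReal.ofReal_rpow_of_nonneg dist_nonneg r.coe_nonneg,
    ← ENNReal.ofReal_coe_nnreal, ← ENNReal.ofReal_mul C.coe_nonneg]
  exact ENNReal.ofReal_le_ofReal h1

theorem holderBound_iff {r C : NNReal} {F : X.Pt → ℂ} :
    X.HolderBound r C F ↔ (∀ p, ‖F p‖ ≤ C) ∧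
      ∀ p q δ, X.Linked p q δ → ‖F p - F q‖ ≤ C * δ ^ (r : ℝ) := by
  simp only [HolderBound, holderWith_iff]
  refine and_congr_right fun _ => ⟨?_, fun h => ⟨fun m s s' => h _ _ _ (.curve m s s'),
    fun l p p' => h _ _ _ (.patch l p p')⟩⟩
  rintro ⟨h1, h2⟩ _ _ _ (⟨m, s, s'⟩ | ⟨l, p, p'⟩)
  · exact h1 m s s'
  · exact h2 l p p'

theorem HolderBound.mono {r C C' : NNReal} {F : X.Pt → ℂ} (h : X.HolderBound r C F)
    (hC : C ≤ C') : X.HolderBound r C' F :=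
  ⟨fun p => (h.1 p).trans (by exact_mod_cast hC), fun m => (h.2.1 m).mono hC,
    fun l => (h.2.2 l).mono hC⟩

/-- A Hölder bound can be traded for one with a smaller exponent. -/
theorem HolderBound.lower {r r' C : NNReal} {F : X.Pt → ℂ} (h : X.HolderBound r C F)
    (hr : r' ≤ r) : X.HolderBound r' (2 * C) F := by
  rw [holderBound_iff] at h ⊢
  push_cast
  refine ⟨fun p => (h.1 p).trans (by linarith [C.coe_nonneg]), fun p q δ hpq => ?_⟩
  have hδ := hpq.nonneg
  have hr' : (r' : ℝ) ≤ r := by exact_mod_cast hr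
  rcases le_total δ 1 with h1 | h1
  · refine (h.2 p q δ hpq).trans ?_
    have h2 : δ ^ (r : ℝ) ≤ δ ^ (r' : ℝ) := by
      rcases hδ.eq_or_lt with h0 | h0
      · rw [← h0]
        rcases r.coe_nonneg.eq_or_lt with h3 | h3
        · have : (r' : ℝ) = 0 := le_antisymm (hr'.trans h3.symm.le) r'.coe_nonneg
          rw [this]; simpa using Real.rpow_le_one le_rfl zero_le_one r.coe_nonneg
        · rw [Real.zero_rpow h3.ne']; exact Real.rpow_nonneg le_rfl _
      · exact Real.rpow_le_rpow_of_exponent_ge h0 h1 hr'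
    have h3 : (0 : ℝ) ≤ δ ^ (r' : ℝ) := Real.rpow_nonneg hδ _
    nlinarith [C.coe_nonneg, mul_le_mul_of_nonneg_left h2 C.coe_nonneg, mul_nonneg C.coe_nonneg h3]
  · have h2 : ‖F p - F q‖ ≤ 2 * C := by linarith [norm_sub_le (F p) (F q), h.1 p, h.1 q]
    refine h2.trans (le_mul_of_one_le_right (by positivity) ?_)
    exact Real.one_le_rpow h1 r'.coe_nonneg

theorem HolderBound.add {r C C' : NNReal} {F G : X.Pt → ℂ} (hF : X.HolderBound r C F)
    (hG : X.HolderBound r C' G) : X.HolderBound r (C + C') fun p => F p + G p := by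
  rw [holderBound_iff] at hF hG ⊢
  push_cast
  refine ⟨fun p => (norm_add_le _ _).trans (add_le_add (hF.1 p) (hG.1 p)), fun p q δ h => ?_⟩
  calc ‖F p + G p - (F q + G q)‖ = ‖(F p - F q) + (G p - G q)‖ := by congr 1; ring
    _ ≤ ‖F p - F q‖ + ‖G p - G q‖ := norm_add_le _ _
    _ ≤ (C + C') * δ ^ (r : ℝ) := by linarith [hF.2 p q δ h, hG.2 p q δ h]

theorem HolderBound.const_mul {r C : NNReal} {F : X.Pt → ℂ} (hF : X.HolderBound r C F) (c : ℂ)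
    {K : NNReal} (hc : ‖c‖ ≤ K) : X.HolderBound r (K * C) fun p => c * F p := by
  rw [holderBound_iff] at hF ⊢
  push_cast
  refine ⟨fun p => ?_, fun p q δ h => ?_⟩
  · rw [norm_mul]; exact mul_le_mul hc (hF.1 p) (norm_nonneg _) K.coe_nonneg
  · rw [← mul_sub, norm_mul, mul_assoc]
    exact mul_le_mul hc (hF.2 p q δ h) (norm_nonneg _) K.coe_nonneg

theorem HolderBound.mul {r C C' : NNReal} {F G : X.Pt → ℂ} (hF : X.HolderBound r C F)
    (hG : X.HolderBound r C' G) : X.HolderBound r (2 * C * C') fun p => F p * G p := by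
  rw [holderBound_iff] at hF hG ⊢
  push_cast
  refine ⟨fun p => ?_, fun p q δ h => ?_⟩
  · rw [norm_mul]
    nlinarith [hF.1 p, hG.1 p, norm_nonneg (F p), norm_nonneg (G p), C.coe_nonneg, C'.coe_nonneg,
      mul_le_mul (hF.1 p) (hG.1 p) (norm_nonneg _) C.coe_nonneg, mul_nonneg C.coe_nonneg C'.coe_nonneg]
  · have h1 := mul_le_mul (hF.2 p q δ h) (hG.1 p) (norm_nonneg _)
      ((norm_nonneg _).trans (hF.2 p q δ h))
    have h2 := mul_le_mul (hF.1 q) (hG.2 p q δ h) (norm_nonneg _) C.coe_nonneg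
    calc ‖F p * G p - F q * G q‖ = ‖(F p - F q) * G p + F q * (G p - G q)‖ := by congr 1; ring
      _ ≤ ‖F p - F q‖ * ‖G p‖ + ‖F q‖ * ‖G p - G q‖ := by
          refine (norm_add_le _ _).trans ?_
          rw [norm_mul, norm_mul]
      _ ≤ 2 * C * C' * δ ^ (r : ℝ) := by linarith

theorem HolderBound.isHolder {r C : NNReal} {F : X.Pt → ℂ} (hF : X.HolderBound r C F)
    (h0 : 0 < r) (h1 : r ≤ 1) : X.IsHolder F := ⟨r, C, h0, h1, hF⟩

theorem IsHolder.add {F G : X.Pt → ℂ} (hF : X.IsHolder F) (hG : X.IsHolder G) :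
    X.IsHolder fun p => F p + G p := by
  obtain ⟨r, C, h0, h1, h⟩ := hF
  obtain ⟨r', C', h0', h1', h'⟩ := hG
  exact ⟨min r r', _, lt_min h0 h0', (min_le_left _ _).trans h1,
    (h.lower (min_le_left _ _)).add (h'.lower (min_le_right _ _))⟩

theorem IsHolder.const_mul {F : X.Pt → ℂ} (hF : X.IsHolder F) (c : ℂ) :
    X.IsHolder fun p => c * F p := by
  obtain ⟨r, C, h0, h1, h⟩ := hF
  exact ⟨r, _, h0, h1, h.const_mul c (K := ‖c‖₊) le_rfl⟩

theorem IsHolder.mul {F G : X.Pt → ℂ} (hF : X.IsHolder F) (hG : X.IsHolder G) :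
    X.IsHolder fun p => F p * G p := by
  obtain ⟨r, C, h0, h1, h⟩ := hF
  obtain ⟨r', C', h0', h1', h'⟩ := hG
  exact ⟨min r r', _, lt_min h0 h0', (min_le_left _ _).trans h1,
    (h.lower (min_le_left _ _)).mul (h'.lower (min_le_right _ _))⟩

theorem measurable_of_pieces {Y : Type*} [MeasurableSpace Y] {F : X.Pt → Y}
    (hc : ∀ m, Measurable fun s => F (X.curve m s))
    (hp : ∀ l, Measurable fun p => F (X.patch l p)) : Measurable F := by
  refine measurable_fun_sum (measurable_of_finite _) (measurable_fun_sum ?_ ?_)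
  · intro s hs
    refine MeasurableSpace.measurableSet_iInf.2 ?_
    exact fun m => hc m hs
  · intro s hs
    refine MeasurableSpace.measurableSet_iInf.2 ?_
    exact fun m => hp m hs

end DressingSupport

namespace DressingSupport

variable (X : DressingSupport)

theorem measurable_curve (m : Fin X.numCurves) : Measurable (X.curve m) := by
  refine measurable_inr.comp (measurable_inl.comp ?_)
  exact fun s hs => MeasurableSpace.measurableSet_iInf.1 hs m

theorem measurable_patch (l : Fin X.numPatches) : Measurable (X.patch l) := by
  refine measurable_inr.comp (measurable_inr.comp ?_)
  exact fun s hs => MeasurableSpace.measurableSet_iInf.1 hs l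

/-- The measure `dp`: counting measure on the atoms, Lebesgue measure on the intervals and on the
patches. -/
def vol : Measure X.Pt :=
  (∑ n, Measure.dirac (X.atom n)) + (∑ m, (volume.comap Subtype.val).map (X.curve m)) +
    ∑ l, (volume.comap Subtype.val).map (X.patch l)

instance (m : Fin X.numCurves) :
    IsFiniteMeasure (volume.comap (Subtype.val : Set.Icc (X.lo m) (X.hi m) → ℝ)) := by
  refine ⟨?_⟩
  rw [(MeasurableEmbedding.subtype_coe measurableSet_Icc).comap_apply, Set.image_univ,
    Subtype.range_coe]
  exact isCompact_Icc.measure_lt_top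

instance (l : Fin X.numPatches) :
    IsFiniteMeasure (volume.comap (Subtype.val : X.patchSet l → ℝ × ℝ)) := by
  refine ⟨?_⟩
  rw [(MeasurableEmbedding.subtype_coe (X.isCompact_patchSet l).measurableSet).comap_apply,
    Set.image_univ, Subtype.range_coe]
  exact (X.isCompact_patchSet l).measure_lt_top

instance : IsFiniteMeasure X.vol := by
  have h2 : ∀ m, IsFiniteMeasure
      ((volume.comap (Subtype.val : Set.Icc (X.lo m) (X.hi m) → ℝ)).map (X.curve m)) := fun m =>
    Measure.isFiniteMeasure_map _ _
  have h3 : ∀ l, IsFiniteMeasure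
      ((volume.comap (Subtype.val : X.patchSet l → ℝ × ℝ)).map (X.patch l)) := fun l =>
    Measure.isFiniteMeasure_map _ _
  unfold vol
  infer_instance

/-- Bounded measurable functions on the parameter space. -/
structure BddMeas (F : X.Pt → ℂ) : Prop where
  measurable : Measurable F
  bdd : ∃ C, ∀ p, ‖F p‖ ≤ C

variable {X}

theorem BddMeas.integrable {F : X.Pt → ℂ} (hF : X.BddMeas F) (μ : Measure X.Pt)
    [IsFiniteMeasure μ] : Integrable F μ := by
  obtain ⟨C, hC⟩ := hF.bdd
  exact Integrable.of_bound hF.measurable.aestronglyMeasurable C (Eventually.of_forall hC)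

theorem int_eq_integral {F : X.Pt → ℂ} (hF : X.BddMeas F) : X.int F = ∫ p, F p ∂X.vol := by
  have h2 : ∀ m, IsFiniteMeasure
      ((volume.comap (Subtype.val : Set.Icc (X.lo m) (X.hi m) → ℝ)).map (X.curve m)) := fun m =>
    Measure.isFiniteMeasure_map _ _
  have h3 : ∀ l, IsFiniteMeasure
      ((volume.comap (Subtype.val : X.patchSet l → ℝ × ℝ)).map (X.patch l)) := fun l =>
    Measure.isFiniteMeasure_map _ _
  unfold vol int
  rw [integral_add_measure (hF.integrable _) (hF.integrable _),
    integral_add_measure (hF.integrable _) (hF.integrable _),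
    integral_finsetSum_measure fun _ _ => hF.integrable _,
    integral_finsetSum_measure fun _ _ => hF.integrable _,
    integral_finsetSum_measure fun _ _ => hF.integrable _]
  congr 1
  · congr 1
    · exact Finset.sum_congr rfl fun n _ =>
        (integral_dirac' _ _ hF.measurable.stronglyMeasurable).symm
    · exact Finset.sum_congr rfl fun m _ => (integral_map (X.measurable_curve m).aemeasurable
        hF.measurable.aestronglyMeasurable).symm
  · exact Finset.sum_congr rfl fun l _ => (integral_map (X.measurable_patch l).aemeasurable
      hF.measurable.aestronglyMeasurable).symm

theorem BddMeas.add {F G : X.Pt → ℂ} (hF : X.BddMeas F) (hG : X.BddMeas G) :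
    X.BddMeas fun p => F p + G p := by
  obtain ⟨C, hC⟩ := hF.bdd
  obtain ⟨C', hC'⟩ := hG.bdd
  exact ⟨hF.measurable.add hG.measurable, C + C', fun p =>
    (norm_add_le _ _).trans (add_le_add (hC p) (hC' p))⟩

theorem BddMeas.mul {F G : X.Pt → ℂ} (hF : X.BddMeas F) (hG : X.BddMeas G) :
    X.BddMeas fun p => F p * G p := by
  obtain ⟨C, hC⟩ := hF.bdd
  obtain ⟨C', hC'⟩ := hG.bdd
  refine ⟨hF.measurable.mul hG.measurable, C * C', fun p => ?_⟩
  rw [norm_mul]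
  exact mul_le_mul (hC p) (hC' p) (norm_nonneg _) ((norm_nonneg _).trans (hC p))

theorem bddMeas_const (c : ℂ) : X.BddMeas fun _ => c := ⟨measurable_const, ‖c‖, fun _ => le_rfl⟩

theorem HolderBound.bddMeas {r C : NNReal} {F : X.Pt → ℂ} (hF : X.HolderBound r C F)
    (hr : 0 < r) : X.BddMeas F :=
  ⟨measurable_of_pieces (fun m => ((hF.2.1 m).continuous hr).measurable)
    fun l => ((hF.2.2 l).continuous hr).measurable, C, hF.1⟩

theorem IsHolder.bddMeas {F : X.Pt → ℂ} (hF : X.IsHolder F) : X.BddMeas F := by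
  obtain ⟨r, C, h0, -, h⟩ := hF
  exact h.bddMeas h0

theorem int_add {F G : X.Pt → ℂ} (hF : X.BddMeas F) (hG : X.BddMeas G) :
    X.int (fun p => F p + G p) = X.int F + X.int G := by
  rw [int_eq_integral hF, int_eq_integral hG, int_eq_integral (hF.add hG),
    integral_add (hF.integrable _) (hG.integrable _)]

theorem int_const_mul (c : ℂ) {F : X.Pt → ℂ} (hF : X.BddMeas F) :
    X.int (fun p => c * F p) = c * X.int F := by
  rw [int_eq_integral hF, int_eq_integral ((bddMeas_const c).mul hF), integral_const_mul]

theorem norm_int_le {F : X.Pt → ℂ} (hF : X.BddMeas F) {C : ℝ} (hC : ∀ p, ‖F p‖ ≤ C) :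
    ‖X.int F‖ ≤ C * X.vol.real Set.univ := by
  rw [int_eq_integral hF]
  exact norm_integral_le_of_norm_le_const (Eventually.of_forall hC)

theorem int_zero : X.int (fun _ => 0) = 0 := by
  simpa using int_const_mul (X := X) 0 (bddMeas_const 0)

/-- A level set of an embedded map without atoms is a null set. -/
theorem vol_level_eq_zero {z : X.Pt → ℂ} (hz : X.IsEmbedded z) (hm : Measurable z) (w : ℂ)
    (ha : ∀ n, z (X.atom n) ≠ w) : X.vol {p | z p = w} = 0 := by
  have hS : MeasurableSet {p | z p = w} := hm (measurableSet_singleton w)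
  simp only [vol, Measure.add_apply, Measure.finsetSum_apply, add_eq_zero, Finset.sum_eq_zero_iff,
    Finset.mem_univ, true_imp_iff]
  refine ⟨⟨fun n => ?_, fun m => ?_⟩, fun l => ?_⟩
  · rw [Measure.dirac_apply' _ hS]
    simp [ha n]
  · rw [Measure.map_apply (X.measurable_curve m) hS,
      (MeasurableEmbedding.subtype_coe measurableSet_Icc).comap_apply]
    refine Set.Subsingleton.measure_zero (Set.Subsingleton.image ?_ _) _
    exact fun s hs s' hs' => (hz.1 m).1 (Eq.trans hs (Eq.symm hs'))
  · rw [Measure.map_apply (X.measurable_patch l) hS,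
      (MeasurableEmbedding.subtype_coe (X.isCompact_patchSet l).measurableSet).comap_apply]
    refine Set.Subsingleton.measure_zero (Set.Subsingleton.image ?_ _) _
    exact fun s hs s' hs' => (hz.2 l).1 (Eq.trans hs (Eq.symm hs'))

theorem IsEmbedded.measurable {z : X.Pt → ℂ} (hz : X.IsEmbedded z) : Measurable z :=
  measurable_of_pieces (fun m => (hz.1 m).2.choose_spec.continuous.measurable)
    fun l => (hz.2 l).2.choose_spec.continuous.measurable

instance (l : Fin X.numPatches) : CompactSpace (X.patchSet l) :=
  isCompact_iff_compactSpace.1 (X.isCompact_patchSet l)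

theorem continuous_of_pieces {Y : Type*} [TopologicalSpace Y] {F : X.Pt → Y}
    (hc : ∀ m, Continuous fun s => F (X.curve m s))
    (hp : ∀ l, Continuous fun p => F (X.patch l p)) : Continuous F :=
  continuous_sum_dom.2 ⟨continuous_of_discreteTopology,
    continuous_sum_dom.2 ⟨continuous_sigma hc, continuous_sigma hp⟩⟩

theorem IsEmbedded.continuous {z : X.Pt → ℂ} (hz : X.IsEmbedded z) : Continuous z :=
  continuous_of_pieces (fun m => (hz.1 m).2.choose_spec.continuous)
    fun l => (hz.2 l).2.choose_spec.continuous

theorem measurable_of_continuous {F : X.Pt → ℂ} (hF : Continuous F) : Measurable F :=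
  measurable_of_pieces
    (fun _ => (hF.comp (continuous_inr.comp (continuous_inl.comp continuous_sigmaMk))).measurable)
    fun _ => (hF.comp (continuous_inr.comp (continuous_inr.comp continuous_sigmaMk))).measurable

theorem exists_norm_le_of_continuous {F : X.Pt → ℂ} (hF : Continuous F) : ∃ C, ∀ p, ‖F p‖ ≤ C := by
  obtain ⟨C, hC⟩ := isCompact_univ.exists_bound_of_continuousOn hF.continuousOn
  exact ⟨C, fun p => hC p (Set.mem_univ p)⟩

theorem bddMeas_of_continuous {F : X.Pt → ℂ} (hF : Continuous F) : X.BddMeas F :=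
  ⟨measurable_of_continuous hF, exists_norm_le_of_continuous hF⟩

/-- The composition of an embedded map with a function that is Lipschitz on the image lies
in `𝒟`. -/
theorem IsEmbedded.exists_holderBound_comp {z : X.Pt → ℂ} (hz : X.IsEmbedded z) {h : ℂ → ℂ}
    {L : NNReal} (hL : LipschitzOnWith L h (Set.range z)) :
    ∃ C, X.HolderBound 1 C fun p => h (z p) := by
  have hcont : Continuous fun p => h (z p) :=
    hL.continuousOn.comp_continuous hz.continuous fun p => Set.mem_range_self p
  obtain ⟨C, hC⟩ := exists_norm_le_of_continuous hcont
  choose K hK using fun m : Fin X.numCurves => (hz.1 m).2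
  choose K' hK' using fun l : Fin X.numPatches => (hz.2 l).2
  let A : NNReal := ⟨max C 0, le_max_right _ _⟩ + L * (∑ m, K m + ∑ l, K' l)
  have hA : ∀ k, k ≤ ∑ m, K m + ∑ l, K' l → L * k ≤ A := fun k hk =>
    le_add_left (mul_le_mul_right hk L)
  refine ⟨A, fun p => (hC p).trans ?_, fun m => ?_, fun l => ?_⟩
  · have : C ≤ (⟨max C 0, le_max_right _ _⟩ : NNReal) := le_max_left _ _
    refine this.trans ?_
    exact NNReal.coe_le_coe.2 le_self_add
  · rw [holderWith_one]
    have h1 : LipschitzWith (L * K m) fun s => h (z (X.curve m s)) := by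
      rw [← lipschitzOnWith_univ]
      exact hL.comp ((hK m).lipschitzOnWith (s := Set.univ)) fun s _ => Set.mem_range_self _
    exact h1.weaken (hA _ (le_add_right (Finset.single_le_sum (f := K) (fun _ _ => zero_le)
      (Finset.mem_univ m))))
  · rw [holderWith_one]
    have h1 : LipschitzWith (L * K' l) fun s => h (z (X.patch l s)) := by
      rw [← lipschitzOnWith_univ]
      exact hL.comp ((hK' l).lipschitzOnWith (s := Set.univ)) fun s _ => Set.mem_range_self _
    exact h1.weaken (hA _ (le_add_left (Finset.single_le_sum (f := K') (fun _ _ => zero_le)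
      (Finset.mem_univ l))))

/-- A holomorphic function on a neighbourhood of a compact set is Lipschitz on that set. -/
theorem exists_lipschitzOnWith_of_differentiableOn {h : ℂ → ℂ} {U K : Set ℂ} (hU : IsOpen U)
    (hh : DifferentiableOn ℂ h U) (hK : IsCompact K) (hKU : K ⊆ U) :
    ∃ L, LipschitzOnWith L h K := by
  refine LocallyLipschitzOn.exists_lipschitzOnWith_of_compact hK fun x hx => ?_
  have h1 : ContDiffAt ℂ 1 h x :=
    (contDiffOn_of_differentiableOn hU hh 1).contDiffAt (hU.mem_nhds (hKU hx))
  obtain ⟨L, t, ht, hL⟩ := h1.exists_lipschitzOnWith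
  exact ⟨L, t ∩ K, inter_mem (nhdsWithin_le_nhds ht) self_mem_nhdsWithin,
    hL.mono Set.inter_subset_left⟩

theorem IsEmbedded.isHolder_comp {z : X.Pt → ℂ} (hz : X.IsEmbedded z) {h : ℂ → ℂ} {U : Set ℂ}
    (hU : IsOpen U) (hh : DifferentiableOn ℂ h U) (hzU : ∀ p, z p ∈ U) :
    ∃ C, X.HolderBound 1 C fun p => h (z p) := by
  obtain ⟨L, hL⟩ := exists_lipschitzOnWith_of_differentiableOn hU hh
    (isCompact_range hz.continuous) (Set.range_subset_iff.2 hzU)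
  exact hz.exists_holderBound_comp hL

theorem IsEmbedded.exists_holderBound_zpow {z : X.Pt → ℂ} (hz : X.IsEmbedded z)
    (h0 : ∀ p, z p ≠ 0) (n : ℤ) : ∃ C, X.HolderBound 1 C fun p => z p ^ n :=
  hz.isHolder_comp (h := fun w => w ^ n) isOpen_compl_singleton
    (fun _ hw => (differentiableAt_zpow.2 (Or.inl hw)).differentiableWithinAt) h0

end DressingSupport

/-! ### Bounded functionals on Hölder functions and holomorphic families -/

namespace DressingSupport

variable {X : DressingSupport}

/-- A functional that is linear on `𝒟` and bounded on each set with a uniform Hölder bound. -/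
structure BddFunctional (ℓ : (X.Pt → ℂ) → ℂ) : Prop where
  map_add : ∀ F G, X.IsHolder F → X.IsHolder G → ℓ (fun p => F p + G p) = ℓ F + ℓ G
  map_const_mul : ∀ (c : ℂ) F, X.IsHolder F → ℓ (fun p => c * F p) = c * ℓ F
  bound : ∀ r C : NNReal, 0 < r → r ≤ 1 → ∃ M, ∀ F, X.HolderBound r C F → ‖ℓ F‖ ≤ M

theorem BddFunctional.exists_le_mul {ℓ : (X.Pt → ℂ) → ℂ} (hℓ : BddFunctional ℓ) {r : NNReal}
    (h0 : 0 < r) (h1 : r ≤ 1) :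
    ∃ M, ∀ (K : NNReal) (F : X.Pt → ℂ), X.HolderBound r K F → ‖ℓ F‖ ≤ M * K := by
  obtain ⟨M, hM⟩ := hℓ.bound r 1 h0 h1
  refine ⟨M, fun K F hF => ?_⟩
  rcases eq_or_ne K 0 with rfl | hK
  · have hF0 : F = fun p => 0 * F p := by
      funext p
      have := hF.1 p
      simpa using this
    rw [hF0, hℓ.map_const_mul 0 F (hF.isHolder h0 h1)]
    simp
  · have h2 : X.HolderBound r 1 fun p => (K⁻¹ : ℂ) * F p := by
      have := hF.const_mul (K⁻¹ : ℂ) (K := K⁻¹) (by simp)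
      rwa [inv_mul_cancel₀ hK] at this
    have h3 := hM _ h2
    rw [hℓ.map_const_mul _ F (hF.isHolder h0 h1), norm_mul, norm_inv] at h3
    have hK' : (0 : ℝ) < K := by positivity
    have h4 : ‖((K : ℝ) : ℂ)‖ = K := by simp
    rw [h4, inv_mul_le_iff₀ hK'] at h3
    linarith

theorem bddFunctional_int : BddFunctional X.int where
  map_add _ _ hF hG := int_add hF.bddMeas hG.bddMeas
  map_const_mul c _ hF := int_const_mul c hF.bddMeas
  bound _ C h0 _ := ⟨C * X.vol.real Set.univ, fun _ hF => norm_int_le (hF.bddMeas h0) hF.1⟩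

section Family

variable {E : Type*} [NormedAddCommGroup E] [NormedSpace ℂ E]

/-- The derivative of a holomorphic family with a uniform Hölder bound has a Hölder bound. -/
theorem HolderBound.fderiv {G : E → X.Pt → ℂ} {r C : NNReal} {c : E} {R : NNReal} (hR : 0 < R)
    (hd : ∀ p, DifferentiableOn ℂ (fun τ => G τ p) (Metric.ball c R))
    (hb : ∀ τ ∈ Metric.ball c R, X.HolderBound r C (G τ)) (e : E) :
    X.HolderBound r (2 * C / R * ‖e‖₊) fun p => fderiv ℂ (fun τ => G τ p) c e := by
  have hR' : (0 : ℝ) < R := hR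
  have hda : ∀ p, DifferentiableAt ℂ (fun τ => G τ p) c := fun p =>
    (hd p).differentiableAt (Metric.ball_mem_nhds _ hR')
  rw [holderBound_iff]
  push_cast
  refine ⟨fun p => ?_, fun p q δ h => ?_⟩
  · refine (ContinuousLinearMap.le_opNorm _ _).trans ?_
    gcongr
    exact norm_fderiv_le_of_norm_le hR' (hd p) fun τ hτ => (hb τ hτ).1 p
  · have h1 := norm_fderiv_le_of_norm_le hR' ((hd p).sub (hd q)) (M := C * δ ^ (r : ℝ))
      fun τ hτ => (holderBound_iff.1 (hb τ hτ)).2 p q δ h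
    rw [fderiv_sub (hda p) (hda q)] at h1
    rw [← _root_.sub_apply]
    refine (ContinuousLinearMap.le_opNorm _ _).trans ?_
    calc _ ≤ 2 * (C * δ ^ (r : ℝ)) / R * ‖e‖ := by gcongr
      _ = _ := by ring

variable [FiniteDimensional ℂ E]

/-- A bounded functional may be differentiated along a holomorphic family with a uniform Hölder
bound: the Taylor remainder of the family has a Hölder bound of second order. -/
theorem BddFunctional.hasFDerivAt {ℓ : (X.Pt → ℂ) → ℂ} (hℓ : BddFunctional ℓ) {G : E → X.Pt → ℂ}
    {r C : NNReal} (h0 : 0 < r) (h1 : r ≤ 1) {c : E} {R : NNReal} (hR : 0 < R)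
    (hd : ∀ p, DifferentiableOn ℂ (fun τ => G τ p) (Metric.ball c R))
    (hb : ∀ τ ∈ Metric.ball c R, X.HolderBound r C (G τ)) :
    ∃ L : E →L[ℂ] ℂ, (∀ e, L e = ℓ fun p => fderiv ℂ (fun τ => G τ p) c e) ∧
      HasFDerivAt (fun τ => ℓ (G τ)) L c := by
  have hR' : (0 : ℝ) < R := hR
  have hda : ∀ p, DifferentiableAt ℂ (fun τ => G τ p) c := fun p =>
    (hd p).differentiableAt (Metric.ball_mem_nhds _ hR')
  have hH : ∀ e, X.IsHolder fun p => _root_.fderiv ℂ (fun τ => G τ p) c e := fun e =>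
    (HolderBound.fderiv hR hd hb e).isHolder h0 h1
  let L₀ : E →ₗ[ℂ] ℂ :=
    { toFun := fun e => ℓ fun p => _root_.fderiv ℂ (fun τ => G τ p) c e
      map_add' := fun e e' => by
        rw [← hℓ.map_add _ _ (hH e) (hH e')]
        simp only [_root_.map_add]
      map_smul' := fun s e => by
        rw [RingHom.id_apply, smul_eq_mul, ← hℓ.map_const_mul _ _ (hH e)]
        simp only [_root_.map_smul, smul_eq_mul] }
  refine ⟨LinearMap.toContinuousLinearMap L₀, fun e => rfl, ?_⟩
  obtain ⟨M, hM⟩ := hℓ.exists_le_mul h0 h1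
  have hbase : X.IsHolder (G c) := (hb c (Metric.mem_ball_self hR')).isHolder h0 h1
  have hrem : ∀ τ ∈ Metric.ball c (R : ℝ),
      ‖ℓ (G τ) - ℓ (G c) - LinearMap.toContinuousLinearMap L₀ (τ - c)‖
        ≤ M * (4 * C / R ^ 2) * ‖τ - c‖ ^ 2 := by
    intro τ hτ
    have e1 : ℓ (G τ) - ℓ (G c) - LinearMap.toContinuousLinearMap L₀ (τ - c)
        = ℓ fun p => G τ p + ((-1) * G c p +
          (-1) * _root_.fderiv ℂ (fun τ => G τ p) c (τ - c)) := by
      rw [hℓ.map_add _ _ ((hb τ hτ).isHolder h0 h1)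
          ((hbase.const_mul _).add ((hH _).const_mul _)),
        hℓ.map_add _ _ (hbase.const_mul _) ((hH _).const_mul _), hℓ.map_const_mul _ _ hbase,
        hℓ.map_const_mul _ _ (hH _)]
      simp only [LinearMap.coe_toContinuousLinearMap', L₀, LinearMap.coe_mk, AddHom.coe_mk]
      ring
    have e2 : X.HolderBound r (4 * C * (‖τ - c‖₊ / R) ^ 2) fun p => G τ p + ((-1) * G c p +
          (-1) * _root_.fderiv ℂ (fun τ => G τ p) c (τ - c)) := by
      rw [holderBound_iff]
      push_cast
      refine ⟨fun p => ?_, fun p q δ h => ?_⟩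
      · have := norm_sub_sub_fderiv_le hR' (hd p) (fun τ hτ => (hb τ hτ).1 p) hτ
        convert this using 2
        ring
      · have := norm_sub_sub_fderiv_le hR' ((hd p).sub (hd q)) (M := C * δ ^ (r : ℝ))
          (fun τ hτ => (holderBound_iff.1 (hb τ hτ)).2 p q δ h) hτ
        rw [fderiv_sub (hda p) (hda q)] at this
        refine (le_of_eq ?_).trans (this.trans (le_of_eq (by ring)))
        congr 1
        simp only [Pi.sub_apply, _root_.sub_apply]
        ring
    rw [e1]
    refine (hM _ _ e2).trans (le_of_eq ?_)
    push_cast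
    field_simp
  have hO : (fun τ => ℓ (G τ) - ℓ (G c) - LinearMap.toContinuousLinearMap L₀ (τ - c))
      =O[𝓝 c] fun τ => ‖τ - c‖ ^ 2 := by
    refine Asymptotics.IsBigO.of_bound (M * (4 * C / R ^ 2)) ?_
    filter_upwards [Metric.ball_mem_nhds c hR'] with τ hτ
    simpa using hrem τ hτ
  have h3 : HasFDerivAt (fun τ => ℓ (G τ) - ℓ (G c) -
      LinearMap.toContinuousLinearMap L₀ (τ - c)) (0 : E →L[ℂ] ℂ) c :=
    hO.hasFDerivAt (by norm_num)
  have h4 : HasFDerivAt (fun τ => LinearMap.toContinuousLinearMap L₀ (τ - c))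
      (LinearMap.toContinuousLinearMap L₀) c := by
    have := HasFDerivAt.comp (f := fun τ : E => τ - c) c
      (LinearMap.toContinuousLinearMap L₀).hasFDerivAt ((hasFDerivAt_id c).sub_const c)
    rwa [ContinuousLinearMap.comp_id] at this
  have h5 := (h3.add h4).add_const (ℓ (G c))
  rw [zero_add] at h5
  refine h5.congr_of_eventuallyEq (Eventually.of_forall fun τ => ?_)
  simp

end Family

/-- A family of functions on the parameter space with values holomorphic on a flow domain that is
bounded in a Hölder norm near each point of each finite-dimensional slice. -/
def LocHolder {V I : Type*} [AddCommGroup V] [Module ℂ V] (Y : FlowDomain V I)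
    (f : X.Pt → Y.Fun) : Prop :=
  ∀ (T : V) (k : ℕ) (i : Fin k → I), ∀ c ∈ Y.sliceAt T i, ∃ r C : NNReal, 0 < r ∧ r ≤ 1 ∧
    ∀ᶠ c' in 𝓝 c, X.HolderBound r C fun p => Y.val (f p) (Y.move T i c')

section Flow

variable {V I : Type*} [AddCommGroup V] [Module ℂ V] {Y : FlowDomain V I} {f g : X.Pt → Y.Fun}

theorem LocHolder.isHolder (hf : LocHolder Y f) {T : V} (hT : T ∈ Y.carrier) :
    X.IsHolder fun p => Y.val (f p) T := by
  obtain ⟨r, C, h0, h1, h⟩ := hf T 0 Fin.elim0 0 (Y.zero_mem_sliceAt hT _)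
  have := h.self_of_nhds
  rw [Y.move_zero] at this
  exact this.isHolder h0 h1

/-- On a small ball of a slice the family is holomorphic with a uniform Hölder bound. -/
theorem LocHolder.exists_ball (hf : LocHolder Y f) (T : V) {k : ℕ} (i : Fin k → I)
    {c : Fin k → ℂ} (hc : c ∈ Y.sliceAt T i) : ∃ r C R : NNReal, 0 < r ∧ r ≤ 1 ∧ 0 < R ∧
      (∀ p, DifferentiableOn ℂ (fun b => Y.val (f p) (Y.move T i b)) (Metric.ball c R)) ∧
      ∀ b ∈ Metric.ball c (R : ℝ), X.HolderBound r C fun p => Y.val (f p) (Y.move T i b) := by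
  obtain ⟨r, C, h0, h1, h⟩ := hf T k i c hc
  obtain ⟨R, hR, h2⟩ := Metric.eventually_nhds_iff_ball.1
    (h.and ((Y.isOpen_sliceAt T i).mem_nhds hc))
  exact ⟨r, C, ⟨R, hR.le⟩, h0, h1, hR,
    fun p => (Y.hol_val (f p) T k i).mono fun b hb => (h2 b hb).2, fun b hb => (h2 b hb).1⟩

theorem LocHolder.add (hf : LocHolder Y f) (hg : LocHolder Y g) :
    LocHolder Y fun p => f p + g p := by
  intro T k i c hc
  obtain ⟨r, C, h0, h1, h⟩ := hf T k i c hc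
  obtain ⟨r', C', h0', h1', h'⟩ := hg T k i c hc
  refine ⟨min r r', 2 * C + 2 * C', lt_min h0 h0', (min_le_left _ _).trans h1,
    (h.and h').mono fun b hb => ?_⟩
  simp only [FlowDomain.val_add]
  exact (hb.1.lower (min_le_left _ _)).add (hb.2.lower (min_le_right _ _))

theorem LocHolder.mul (hf : LocHolder Y f) (hg : LocHolder Y g) :
    LocHolder Y fun p => f p * g p := by
  intro T k i c hc
  obtain ⟨r, C, h0, h1, h⟩ := hf T k i c hc
  obtain ⟨r', C', h0', h1', h'⟩ := hg T k i c hc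
  refine ⟨min r r', 2 * (2 * C) * (2 * C'), lt_min h0 h0', (min_le_left _ _).trans h1,
    (h.and h').mono fun b hb => ?_⟩
  simp only [FlowDomain.val_mul]
  exact (hb.1.lower (min_le_left _ _)).mul (hb.2.lower (min_le_right _ _))

theorem locHolder_const (x : Y.Fun) : LocHolder Y fun _ : X.Pt => x := by
  intro T k i c hc
  obtain ⟨r, hr, M, -, hM⟩ := exists_ball_norm_le (Y.isOpen_sliceAt T i) (Y.hol_val x T k i) hc
  refine ⟨1, Real.toNNReal M, one_pos, le_rfl, ?_⟩
  filter_upwards [Metric.ball_mem_nhds c hr] with b hb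
  rw [holderBound_iff]
  refine ⟨fun _ => (hM b hb).trans (Real.le_coe_toNNReal M), fun p q δ h => ?_⟩
  rw [sub_self, norm_zero]
  exact mul_nonneg (NNReal.coe_nonneg _) (Real.rpow_nonneg h.nonneg _)

theorem locHolder_algebraMap {w : X.Pt → ℂ} (hw : X.IsHolder w) :
    LocHolder Y fun p => algebraMap ℂ Y.Fun (w p) := by
  intro T k i c hc
  obtain ⟨r, C, h0, h1, h⟩ := hw
  refine ⟨r, C, h0, h1, ?_⟩
  filter_upwards [(Y.isOpen_sliceAt T i).mem_nhds hc] with b hb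
  simpa only [FlowDomain.val_algebraMap _ (Y.mem_sliceAt.1 hb)] using h

theorem LocHolder.d (hf : LocHolder Y f) (n : I) : LocHolder Y fun p => Y.d n (f p) := by
  intro T k i c hc
  have hc' : (Fin.cons 0 c : Fin (k + 1) → ℂ) ∈ Y.sliceAt T (Fin.cons n i : Fin (k + 1) → I) := by
    rw [Y.mem_sliceAt, Y.move_cons]; simpa using Y.mem_sliceAt.1 hc
  obtain ⟨r, C, R, h0, h1, hR, hd, hb⟩ := hf.exists_ball T _ hc'
  have hR' : (0 : ℝ) < R := hR
  refine ⟨r, 2 * C / (R / 2) * ‖(Pi.single 0 1 : Fin (k + 1) → ℂ)‖₊, h0, h1, ?_⟩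
  filter_upwards [(Y.isOpen_sliceAt T i).mem_nhds hc, Metric.ball_mem_nhds c (half_pos hR')]
    with b hbs hb2
  have hdist : dist (Fin.cons 0 b : Fin (k + 1) → ℂ) (Fin.cons 0 c) < R / 2 := by
    rw [dist_pi_lt_iff (half_pos hR')]
    intro j
    refine Fin.cases ?_ (fun j => ?_) j
    · simpa using half_pos hR'
    · simpa using (dist_le_pi_dist b c j).trans_lt hb2
  have hsub : Metric.ball (Fin.cons 0 b : Fin (k + 1) → ℂ) ((R / 2 : NNReal) : ℝ)
      ⊆ Metric.ball (Fin.cons 0 c) R := by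
    refine Metric.ball_subset_ball' ?_
    push_cast
    linarith
  have key := HolderBound.fderiv (c := (Fin.cons 0 b : Fin (k + 1) → ℂ)) (half_pos hR)
    (fun p => (hd p).mono hsub) (fun τ hτ => hb τ (hsub hτ)) (Pi.single 0 1)
  convert key using 2 with p
  have hbs' : (Fin.cons 0 b : Fin (k + 1) → ℂ) ∈ Y.sliceAt T (Fin.cons n i : Fin (k + 1) → I) := by
    rw [Y.mem_sliceAt, Y.move_cons]; simpa using Y.mem_sliceAt.1 hbs
  have h3 := (Y.hol_val (f p)).pd_move T (Fin.cons n i : Fin (k + 1) → I) hbs' 0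
  rw [FlowDomain.val_d n (f p) hbs, ← h3, Y.move_cons]
  simp

/-- Bounded functionals preserve holomorphic dependence on the parameters. -/
theorem BddFunctional.hol {ℓ : (X.Pt → ℂ) → ℂ} (hℓ : BddFunctional ℓ) (hf : LocHolder Y f) :
    Y.Hol fun T => ℓ fun p => Y.val (f p) T := by
  intro T k i c hc
  obtain ⟨r, C, R, h0, h1, hR, hd, hb⟩ := hf.exists_ball T i hc
  obtain ⟨L, -, hL⟩ := hℓ.hasFDerivAt h0 h1 hR hd hb
  exact hL.differentiableAt.differentiableWithinAt

/-- Bounded functionals commute with derivatives with respect to the parameters. -/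
theorem BddFunctional.pd {ℓ : (X.Pt → ℂ) → ℂ} (hℓ : BddFunctional ℓ) (hf : LocHolder Y f)
    {T : V} (hT : T ∈ Y.carrier) (n : I) :
    pd ℂ (Y.dir n) (fun T => ℓ fun p => Y.val (f p) T) T = ℓ fun p => Y.val (Y.d n (f p)) T := by
  have hc := Y.zero_mem_sliceAt hT (fun _ : Fin 1 => n)
  obtain ⟨r, C, R, h0, h1, hR, hd, hb⟩ := hf.exists_ball T (fun _ : Fin 1 => n) hc
  obtain ⟨L, hL1, hL⟩ := hℓ.hasFDerivAt h0 h1 hR hd hb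
  have h2 := (hℓ.hol hf).pd_move T (fun _ : Fin 1 => n) hc 0
  rw [hL.fderiv, Y.move_zero, hL1] at h2
  rw [h2]
  congr 1
  funext p
  have h3 := (Y.hol_val (f p)).pd_move T (fun _ : Fin 1 => n) hc 0
  rw [← h3, Y.move_zero, FlowDomain.val_d n _ hT]

/-- The bounded functional `ℓ` applied to the members of the family, as an element of the
algebra. -/
def BddFunctional.toFun {ℓ : (X.Pt → ℂ) → ℂ} (hℓ : BddFunctional ℓ) (hf : LocHolder Y f) : Y.Fun :=
  (hℓ.hol hf).toFun

end Flow

end DressingSupport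

/-! ### The Cauchy integral as a bounded functional -/

namespace DressingData

variable (D : DressingData)

open Classical in
/-- The truncated Cauchy kernel with the density `F`. -/
def trunc (F : D.Pt → ℂ) (z : ℂ) (ε : ℝ) : D.Pt → ℂ :=
  fun q => if ε < ‖z - D.ζ q‖ then F q / (z - D.ζ q) else 0

variable {D}

theorem norm_trunc_le (F : D.Pt → ℂ) (z : ℂ) {ε : ℝ} (hε : 0 < ε) {C : ℝ} (hC : ∀ q, ‖F q‖ ≤ C)
    (q : D.Pt) : ‖D.trunc F z ε q‖ ≤ C / ε := by
  have hC0 : 0 ≤ C := (norm_nonneg _).trans (hC q)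
  unfold trunc
  split_ifs with h
  · rw [norm_div]
    exact div_le_div₀ hC0 (hC q) hε h.le
  · rw [norm_zero]; positivity

theorem measurable_ζ : Measurable D.ζ := D.ζ_embedded.measurable

theorem bddMeas_trunc {F : D.Pt → ℂ} (hF : D.BddMeas F) (z : ℂ) {ε : ℝ} (hε : 0 < ε) :
    D.BddMeas (D.trunc F z ε) := by
  obtain ⟨C, hC⟩ := hF.bdd
  refine ⟨?_, C / ε, norm_trunc_le F z hε hC⟩
  exact Measurable.ite
    (measurableSet_lt measurable_const (measurable_const.sub measurable_ζ).norm)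
    (hF.measurable.div (measurable_const.sub measurable_ζ)) measurable_const

theorem hasCauchyIntegral_iff {F : D.Pt → ℂ} {z c : ℂ} : D.HasCauchyIntegral F z c ↔
    (∀ n, D.ζ (D.atom n) ≠ z) ∧ Tendsto (fun ε => D.int (D.trunc F z ε)) (𝓝[>] 0) (𝓝 c) :=
  Iff.rfl

theorem HasCauchyIntegral.unique {F : D.Pt → ℂ} {z c c' : ℂ} (h : D.HasCauchyIntegral F z c)
    (h' : D.HasCauchyIntegral F z c') : c = c' :=
  tendsto_nhds_unique h.2 h'.2

theorem HasCauchyIntegral.add {F G : D.Pt → ℂ} {z c c' : ℂ} (hF : D.BddMeas F) (hG : D.BddMeas G)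
    (h : D.HasCauchyIntegral F z c) (h' : D.HasCauchyIntegral G z c') :
    D.HasCauchyIntegral (fun q => F q + G q) z (c + c') := by
  rw [hasCauchyIntegral_iff] at *
  refine ⟨h.1, (h.2.add h'.2).congr' ?_⟩
  filter_upwards [self_mem_nhdsWithin] with ε hε
  rw [← DressingSupport.int_add (bddMeas_trunc hF z hε) (bddMeas_trunc hG z hε)]
  congr 1
  funext q
  simp only [trunc]
  split_ifs <;> ring

theorem HasCauchyIntegral.const_mul {F : D.Pt → ℂ} {z c : ℂ} (hF : D.BddMeas F)
    (h : D.HasCauchyIntegral F z c) (a : ℂ) :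
    D.HasCauchyIntegral (fun q => a * F q) z (a * c) := by
  rw [hasCauchyIntegral_iff] at *
  refine ⟨h.1, (h.2.const_mul a).congr' ?_⟩
  filter_upwards [self_mem_nhdsWithin] with ε hε
  rw [← DressingSupport.int_const_mul a (bddMeas_trunc hF z hε)]
  congr 1
  funext q
  simp only [trunc]
  split_ifs <;> ring

/-- `ζ / (z - ζ) = z / (z - ζ) - 1`: here the points with `ζ = z`, which the principal value never
sees, must form a null set. -/
theorem HasCauchyIntegral.ζ_mul {F : D.Pt → ℂ} {z c : ℂ} (hF : D.BddMeas F)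
    (h : D.HasCauchyIntegral F z c) :
    D.HasCauchyIntegral (fun q => D.ζ q * F q) z (z * c - D.int F) := by
  rw [hasCauchyIntegral_iff] at *
  refine ⟨h.1, ?_⟩
  classical
  let G : ℝ → D.Pt → ℂ := fun ε q => if ε < ‖z - D.ζ q‖ then F q else 0
  obtain ⟨C, hC⟩ := hF.bdd
  have hG : ∀ ε, D.BddMeas (G ε) := fun ε =>
    ⟨Measurable.ite (measurableSet_lt measurable_const (measurable_const.sub measurable_ζ).norm)
      hF.measurable measurable_const, C, fun q => by
        simp only [G]
        split_ifs
        · exact hC q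
        · rw [norm_zero]; exact (norm_nonneg _).trans (hC q)⟩
  have hlim : Tendsto (fun ε => D.int (G ε)) (𝓝[>] 0) (𝓝 (D.int F)) := by
    simp only [fun ε => DressingSupport.int_eq_integral (hG ε), DressingSupport.int_eq_integral hF]
    refine tendsto_integral_filter_of_dominated_convergence (fun _ => C)
      (Eventually.of_forall fun ε => (hG ε).measurable.aestronglyMeasurable)
      (Eventually.of_forall fun ε => Eventually.of_forall fun q => ?_) (integrable_const _) ?_
    · simp only [G]
      split_ifs
      · exact hC q
      · rw [norm_zero]; exact (norm_nonneg _).trans (hC q)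
    · have h0 := DressingSupport.vol_level_eq_zero D.ζ_embedded measurable_ζ z h.1
      have h1 : ∀ᵐ q ∂D.vol, D.ζ q ≠ z := by
        rw [ae_iff]; simpa using h0
      filter_upwards [h1] with q hq
      refine tendsto_const_nhds.congr' ?_
      have hpos : 0 < ‖z - D.ζ q‖ := norm_pos_iff.2 (sub_ne_zero.2 hq.symm)
      filter_upwards [nhdsWithin_le_nhds (Iio_mem_nhds hpos)] with ε hε
      simp only [G]
      exact (if_pos (Set.mem_Iio.1 hε)).symm
  refine ((h.2.const_mul z).sub hlim).congr' ?_
  filter_upwards [self_mem_nhdsWithin] with ε hε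
  have hε' : (0 : ℝ) < ε := hε
  rw [← DressingSupport.int_const_mul z (bddMeas_trunc hF z hε), sub_eq_add_neg,
    neg_eq_neg_one_mul, ← DressingSupport.int_const_mul (-1) (hG ε),
    ← DressingSupport.int_add ((DressingSupport.bddMeas_const z).mul (bddMeas_trunc hF z hε))
      ((DressingSupport.bddMeas_const (-1)).mul (hG ε))]
  congr 1
  funext q
  simp only [trunc, G]
  split_ifs with hq
  · have : z - D.ζ q ≠ 0 := norm_pos_iff.1 (hε'.trans hq)
    field_simp
    ring
  · ring

/-- All densities in `𝒟` have a Cauchy integral at `z`. -/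
def CauchyPoint (D : DressingData) (z : ℂ) : Prop :=
  ∀ F, D.IsHolder F → ∃ c, D.HasCauchyIntegral F z c

open Classical in
/-- The principal value `∬ f(ξ) / (z - ξ) d²ξ`, with value `0` where it does not exist. -/
def cauchy (D : DressingData) (z : ℂ) (F : D.Pt → ℂ) : ℂ :=
  if h : ∃ c, D.HasCauchyIntegral F z c then h.choose else 0

theorem CauchyPoint.hasCauchyIntegral {z : ℂ} (hz : D.CauchyPoint z) {F : D.Pt → ℂ}
    (hF : D.IsHolder F) : D.HasCauchyIntegral F z (D.cauchy z F) := by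
  have h := hz F hF
  rw [cauchy, dif_pos h]
  exact h.choose_spec

/-- A superposition of densities with a common Hölder bound. -/
theorem holderBound_tsum {r C : NNReal} {F : ℕ → D.Pt → ℂ} (hF : ∀ k, D.HolderBound r C (F k))
    {a : ℕ → ℂ} (ha : Summable fun k => ‖a k‖) :
    D.HolderBound r ((∑' k, ‖a k‖₊) * C) fun p => ∑' k, a k * F k p := by
  have hcoe : ((∑' k, ‖a k‖₊ : NNReal) : ℝ) = ∑' k, ‖a k‖ := by simp [NNReal.coe_tsum]
  have hsum : ∀ p, Summable fun k => ‖a k * F k p‖ := fun p => by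
    refine Summable.of_nonneg_of_le (fun _ => norm_nonneg _) (fun k => ?_) (ha.mul_right (C : ℝ))
    rw [norm_mul]
    exact mul_le_mul_of_nonneg_left ((hF k).1 p) (norm_nonneg _)
  rw [DressingSupport.holderBound_iff]
  push_cast
  rw [← hcoe, hcoe]
  refine ⟨fun p => ?_, fun p q δ h => ?_⟩
  · refine (norm_tsum_le_tsum_norm (hsum p)).trans ?_
    rw [← tsum_mul_right]
    refine (hsum p).tsum_le_tsum (fun k => ?_) (ha.mul_right _)
    rw [norm_mul]
    exact mul_le_mul_of_nonneg_left ((hF k).1 p) (norm_nonneg _)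
  · rw [← (hsum p).of_norm.tsum_sub (hsum q).of_norm]
    have hle : ∀ k, ‖a k * F k p - a k * F k q‖ ≤ ‖a k‖ * (C * δ ^ (r : ℝ)) := fun k => by
      rw [← mul_sub, norm_mul]
      exact mul_le_mul_of_nonneg_left ((DressingSupport.holderBound_iff.1 (hF k)).2 p q δ h)
        (norm_nonneg _)
    have hs : Summable fun k => ‖a k * F k p - a k * F k q‖ :=
      Summable.of_nonneg_of_le (fun _ => norm_nonneg _) hle (ha.mul_right _)
    refine (norm_tsum_le_tsum_norm hs).trans ?_
    rw [mul_assoc, ← tsum_mul_right]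
    exact hs.tsum_le_tsum hle (ha.mul_right _)

/-- Pairing with a bounded sequence, as a functional on `ℓ¹`. -/
def pairing (b : ℕ → ℂ) (B : ℝ) (hb : ∀ k, ‖b k‖ ≤ B) : lp (fun _ : ℕ => ℂ) 1 →L[ℂ] ℂ :=
  have hs : ∀ a : lp (fun _ : ℕ => ℂ) 1, Summable fun k => ‖a k‖ := fun a => by
    simpa using (memℓp_gen_iff (by simp)).1 (lp.memℓp a)
  have hle : ∀ (a : lp (fun _ : ℕ => ℂ) 1) k, ‖a k * b k‖ ≤ ‖a k‖ * B := fun a k => by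
    rw [norm_mul]; exact mul_le_mul_of_nonneg_left (hb k) (norm_nonneg _)
  have hsum : ∀ a : lp (fun _ : ℕ => ℂ) 1, Summable fun k => ‖a k * b k‖ := fun a =>
    Summable.of_nonneg_of_le (fun _ => norm_nonneg _) (hle a) ((hs a).mul_right B)
  LinearMap.mkContinuous
    { toFun := fun a => ∑' k, a k * b k
      map_add' := fun a a' => by
        rw [← (hsum a).of_norm.tsum_add (hsum a').of_norm]
        exact tsum_congr fun k => by simp [add_mul]
      map_smul' := fun c a => by
        rw [RingHom.id_apply, smul_eq_mul, ← tsum_mul_left]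
        exact tsum_congr fun k => by simp [mul_assoc] } B fun a => by
    have hn : ‖a‖ = ∑' k, ‖a k‖ := by
      rw [lp.norm_eq_tsum_rpow (by simp)]; simp
    refine (norm_tsum_le_tsum_norm (hsum a)).trans ?_
    rw [hn, mul_comm, ← tsum_mul_right]
    exact (hsum a).tsum_le_tsum (hle a) ((hs a).mul_right B)

theorem pairing_apply (b : ℕ → ℂ) (B : ℝ) (hb : ∀ k, ‖b k‖ ≤ B) (a : lp (fun _ : ℕ => ℂ) 1) :
    pairing b B hb a = ∑' k, a k * b k := rfl

/-- The principal value is bounded on each set with a uniform Hölder bound, by the uniform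
boundedness principle: for a sequence of densities `F k` with a common Hölder bound, every
superposition `∑ a k F k` with `a ∈ ℓ¹` lies in `𝒟`, so that the truncated integrals converge on all
of `ℓ¹`. -/
theorem CauchyPoint.exists_norm_cauchy_le {z : ℂ} (hz : D.CauchyPoint z) {r C : NNReal}
    (h0 : 0 < r) (h1 : r ≤ 1) : ∃ M, ∀ F, D.HolderBound r C F → ‖D.cauchy z F‖ ≤ M := by
  by_contra! hcon
  choose F hF hlarge using fun k : ℕ => hcon k
  let ε : ℕ → ℝ := fun n => 1 / ((n : ℝ) + 1)
  have hε : ∀ n, 0 < ε n := fun n => Nat.one_div_pos_of_nat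
  have hε0 : Tendsto ε atTop (𝓝[>] 0) :=
    tendsto_nhdsWithin_iff.2 ⟨tendsto_one_div_add_atTop_nhds_zero_nat,
      Eventually.of_forall fun n => hε n⟩
  have hbm : ∀ n k, D.BddMeas (D.trunc (F k) z (ε n)) := fun n k =>
    bddMeas_trunc ((hF k).bddMeas h0) z (hε n)
  let B : ℕ → ℝ := fun n => C / ε n * D.vol.real Set.univ
  have hB : ∀ n k, ‖D.int (D.trunc (F k) z (ε n))‖ ≤ B n := fun n k =>
    DressingSupport.norm_int_le (hbm n k) (norm_trunc_le (F k) z (hε n) (hF k).1)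
  let g : ℕ → lp (fun _ : ℕ => ℂ) 1 →L[ℂ] ℂ := fun n =>
    pairing (fun k => D.int (D.trunc (F k) z (ε n))) (B n) (hB n)
  have hs : ∀ a : lp (fun _ : ℕ => ℂ) 1, Summable fun k => ‖a k‖ := fun a => by
    simpa using (memℓp_gen_iff (by simp)).1 (lp.memℓp a)
  have hg : ∀ n (a : lp (fun _ : ℕ => ℂ) 1),
      g n a = D.int (D.trunc (fun p => ∑' k, a k * F k p) z (ε n)) := by
    intro n a
    have hbm' : ∀ k, D.BddMeas fun p => a k * D.trunc (F k) z (ε n) p := fun k =>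
      (DressingSupport.bddMeas_const _).mul (hbm n k)
    have hle : ∀ k p, ‖a k * D.trunc (F k) z (ε n) p‖ ≤ ‖a k‖ * (C / ε n) := fun k p => by
      rw [norm_mul]
      exact mul_le_mul_of_nonneg_left (norm_trunc_le (F k) z (hε n) (hF k).1 p) (norm_nonneg _)
    have key := hasSum_integral_of_summable_integral_norm (μ := D.vol)
      (F := fun k p => a k * D.trunc (F k) z (ε n) p) (fun k => (hbm' k).integrable _) (by
        refine Summable.of_nonneg_of_le (fun k => integral_nonneg fun _ => norm_nonneg _)
          (fun k => ?_) ((hs a).mul_right (C / ε n * D.vol.real Set.univ))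
        have := norm_integral_le_of_norm_le_const (μ := D.vol)
          (f := fun p => ‖a k * D.trunc (F k) z (ε n) p‖)
          (C := ‖a k‖ * (C / ε n)) (Eventually.of_forall fun p => by
            rw [norm_norm]; exact hle k p)
        rw [Real.norm_of_nonneg (integral_nonneg fun _ => norm_nonneg _)] at this
        linarith)
    have h2 : D.HolderBound r _ fun p => ∑' k, a k * F k p := holderBound_tsum hF (hs a)
    rw [DressingSupport.int_eq_integral (bddMeas_trunc (h2.bddMeas h0) z (hε n))]
    have h3 : ∀ p, D.trunc (fun p => ∑' k, a k * F k p) z (ε n) p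
        = ∑' k, a k * D.trunc (F k) z (ε n) p := by
      intro p
      simp only [trunc]
      split_ifs
      · rw [← tsum_div_const]
        exact tsum_congr fun k => by ring
      · simp
    simp only [h3]
    rw [← key.tsum_eq, pairing_apply]
    refine tsum_congr fun k => ?_
    rw [← DressingSupport.int_eq_integral (hbm' k), DressingSupport.int_const_mul _ (hbm n k)]
  obtain ⟨M, hM⟩ := banach_steinhaus (g := g) fun a => by
    have h2 : D.HolderBound r _ fun p => ∑' k, a k * F k p := holderBound_tsum hF (hs a)
    obtain ⟨c, hc⟩ := hz _ (h2.isHolder h0 h1)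
    have h3 : Tendsto (fun n => g n a) atTop (𝓝 c) := by
      simp only [hg]
      exact hc.2.comp hε0
    obtain ⟨A, hA⟩ := (Metric.isBounded_range_of_tendsto _ h3).exists_norm_le
    exact ⟨A, fun n => hA _ (Set.mem_range_self n)⟩
  have hle : ∀ k, ‖D.cauchy z (F k)‖ ≤ M := by
    intro k
    have h3 : Tendsto (fun n => D.int (D.trunc (F k) z (ε n))) atTop (𝓝 (D.cauchy z (F k))) :=
      (hz.hasCauchyIntegral ((hF k).isHolder h0 h1)).2.comp hε0
    refine le_of_tendsto h3.norm (Eventually.of_forall fun n => ?_)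
    have h4 : g n (lp.single 1 k (1 : ℂ)) = D.int (D.trunc (F k) z (ε n)) := by
      rw [pairing_apply, tsum_eq_single k fun j hj => by simp [hj]]
      simp
    rw [← h4]
    refine ((g n).le_opNorm _).trans ?_
    rw [lp.norm_single (by simp), norm_one, mul_one]
    exact hM n
  obtain ⟨k, hk⟩ := exists_nat_gt M
  exact absurd (hle k) (not_le.2 (hk.trans (hlarge k)))

theorem CauchyPoint.bddFunctional {z : ℂ} (hz : D.CauchyPoint z) :
    DressingSupport.BddFunctional (D.cauchy z) where
  map_add _ _ hF hG := (hz.hasCauchyIntegral (hF.add hG)).unique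
    ((hz.hasCauchyIntegral hF).add hF.bddMeas hG.bddMeas (hz.hasCauchyIntegral hG))
  map_const_mul c _ hF := (hz.hasCauchyIntegral (hF.const_mul c)).unique
    ((hz.hasCauchyIntegral hF).const_mul hF.bddMeas c)
  bound _ _ h0 h1 := hz.exists_norm_cauchy_le h0 h1

theorem CauchyPoint.cauchy_ζ_mul {z : ℂ} (hz : D.CauchyPoint z) {F : D.Pt → ℂ}
    (hF : D.IsHolder F) :
    D.cauchy z (fun q => D.ζ q * F q) = z * D.cauchy z F - D.int F := by
  have hζ : D.IsHolder D.ζ := by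
    obtain ⟨C, hC⟩ := D.ζ_embedded.exists_holderBound_zpow D.ζ_ne_zero 1
    simp only [zpow_one] at hC
    exact hC.isHolder one_pos le_rfl
  exact (hz.hasCauchyIntegral (hζ.mul hF)).unique
    ((hz.hasCauchyIntegral hF).ζ_mul hF.bddMeas)

end DressingData

/-! ### Formal wave functions and covariant derivatives -/

/-- The components of a wave function: its density on the parameter space `P`, and the coefficients
of `λ ^ j` of its formal expansions at `λ = ∞` and at `λ = 0`. -/
inductive Slot (P : Type*)
  | dens (p : P)
  | infty (j : ℤ)
  | zero (j : ℤ)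

/-- The value at `l` of the Laurent polynomial with the given coefficients. -/
def evalSymb (s : ℤ →₀ ℂ) (l : ℂ) : ℂ := s.sum fun i x => x * l ^ i

section Cov

variable {V I P : Type*} [AddCommGroup V] [Module ℂ V] (Y : FlowDomain V I) (ζ : P → ℂ)

/-- Wave functions whose components are holomorphic functions of the times. -/
abbrev Mod (Y : FlowDomain V I) (P : Type*) : Type _ := Slot P → Y.Fun

variable {Y}

/-- Multiplication of a wave function by `λ ^ i`. -/
def lam (i : ℤ) : Mod Y P →ₗ[Y.Fun] Mod Y P where
  toFun W
    | .dens p => (ζ p ^ i) • W (.dens p)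
    | .infty j => W (.infty (j - i))
    | .zero j => W (.zero (j - i))
  map_add' W W' := by
    funext s
    cases s <;> simp
  map_smul' a W := by
    funext s
    cases s with
    | dens p => exact (mul_smul_comm (ζ p ^ i) a (W (.dens p))).symm
    | infty j => rfl
    | zero j => rfl

@[simp] theorem lam_dens (i : ℤ) (W : Mod Y P) (p : P) :
    lam ζ i W (.dens p) = (ζ p ^ i) • W (.dens p) := rfl
@[simp] theorem lam_infty (i : ℤ) (W : Mod Y P) (j : ℤ) :
    lam ζ i W (.infty j) = W (.infty (j - i)) := rfl
@[simp] theorem lam_zero (i : ℤ) (W : Mod Y P) (j : ℤ) :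
    lam ζ i W (.zero j) = W (.zero (j - i)) := rfl

theorem lam_comm (i i' : ℤ) (W : Mod Y P) : lam ζ i (lam ζ i' W) = lam ζ i' (lam ζ i W) := by
  funext s
  cases s with
  | dens p => exact smul_comm (ζ p ^ i) (ζ p ^ i') (W (.dens p))
  | infty j => simp only [lam_infty, sub_right_comm]
  | zero j => simp only [lam_zero, sub_right_comm]

theorem lam_lam (hζ : ∀ p, ζ p ≠ 0) (i i' : ℤ) (W : Mod Y P) :
    lam ζ i (lam ζ i' W) = lam ζ (i + i') W := by
  funext s
  cases s with
  | dens p => simp only [lam_dens, smul_smul, zpow_add₀ (hζ p)]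
  | infty j => simp only [lam_infty, sub_sub]
  | zero j => simp only [lam_zero, sub_sub]

theorem lam_zero_apply (W : Mod Y P) : lam ζ 0 W = W := by
  funext s
  cases s <;> simp

/-- Multiplication of a wave function by a Laurent polynomial in `λ`. -/
def symb (s : ℤ →₀ ℂ) (W : Mod Y P) : Mod Y P := s.sum fun i x => x • lam ζ i W

theorem symb_single (i : ℤ) (x : ℂ) (W : Mod Y P) :
    symb ζ (Finsupp.single i x) W = x • lam ζ i W := by
  simp [symb]

theorem symb_add (s t : ℤ →₀ ℂ) (W : Mod Y P) : symb ζ (s + t) W = symb ζ s W + symb ζ t W := by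
  unfold symb
  exact Finsupp.sum_add_index' (fun _ => zero_smul _ _) fun _ _ _ => add_smul _ _ _

theorem symb_map_add (s : ℤ →₀ ℂ) (W W' : Mod Y P) :
    symb ζ s (W + W') = symb ζ s W + symb ζ s W' := by
  simp only [symb, map_add, smul_add, Finsupp.sum_add]

theorem symb_smul (s : ℤ →₀ ℂ) (a : Y.Fun) (W : Mod Y P) :
    symb ζ s (a • W) = a • symb ζ s W := by
  simp only [symb, map_smul, Finsupp.smul_sum]
  exact Finsupp.sum_congr fun i _ => smul_comm _ _ _

theorem symb_comm (s t : ℤ →₀ ℂ) (W : Mod Y P) :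
    symb ζ s (symb ζ t W) = symb ζ t (symb ζ s W) := by
  simp only [symb, Finsupp.sum, map_sum, Finset.smul_sum]
  rw [Finset.sum_comm]
  refine Finset.sum_congr rfl fun i _ => Finset.sum_congr rfl fun i' _ => ?_
  rw [LinearMap.map_smul_of_tower, LinearMap.map_smul_of_tower, lam_comm, smul_comm]

/-- The derivative of all components. -/
def dMod (n : I) (W : Mod Y P) : Mod Y P := fun s => Y.d n (W s)

theorem dMod_add (n : I) (W W' : Mod Y P) : dMod n (W + W') = dMod n W + dMod n W' := by
  funext s; simp [dMod]

theorem dMod_smul (n : I) (a : Y.Fun) (W : Mod Y P) :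
    dMod n (a • W) = Y.d n a • W + a • dMod n W := by
  funext s
  simp only [dMod, Pi.smul_apply, Pi.add_apply, smul_eq_mul, Derivation.leibniz]
  ring

theorem dMod_const_smul (n : I) (x : ℂ) (W : Mod Y P) : dMod n (x • W) = x • dMod n W := by
  funext s; simp [dMod]

theorem dMod_lam (n : I) (i : ℤ) (W : Mod Y P) : dMod n (lam ζ i W) = lam ζ i (dMod n W) := by
  funext s
  cases s <;> simp [dMod]

theorem dMod_sum (n : I) {ι : Type*} (s : Finset ι) (W : ι → Mod Y P) :
    dMod n (∑ i ∈ s, W i) = ∑ i ∈ s, dMod n (W i) := by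
  funext t
  simp [dMod, Finset.sum_apply]

theorem dMod_symb (n : I) (s : ℤ →₀ ℂ) (W : Mod Y P) :
    dMod n (symb ζ s W) = symb ζ s (dMod n W) := by
  simp only [symb, Finsupp.sum, dMod_sum, dMod_const_smul, dMod_lam]

theorem dMod_comm (m n : I) (W : Mod Y P) : dMod m (dMod n W) = dMod n (dMod m W) := by
  funext s
  exact FlowDomain.d_comm m n (W s)

variable (S : I → ℤ →₀ ℂ)

/-- The action of `∂/∂tₙ` on `exp(θ) ∑ⱼ Wⱼ λʲ`, where `∂θ/∂tₙ` is the Laurent polynomial `S n`. -/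
def cov (n : I) : Mod Y P →+ Mod Y P where
  toFun W := dMod n W + symb ζ (S n) W
  map_zero' := by funext s; simp [dMod, symb]
  map_add' W W' := by
    rw [dMod_add, symb_map_add]
    abel

theorem cov_apply (n : I) (W : Mod Y P) : cov ζ S n W = dMod n W + symb ζ (S n) W := rfl

theorem cov_smul (n : I) (a : Y.Fun) (W : Mod Y P) :
    cov ζ S n (a • W) = Y.d n a • W + a • cov ζ S n W := by
  rw [cov_apply, cov_apply, dMod_smul, symb_smul, smul_add, add_assoc]

theorem cov_comm (m n : I) (W : Mod Y P) :
    cov ζ S m (cov ζ S n W) = cov ζ S n (cov ζ S m W) := by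
  simp only [cov_apply, dMod_add, symb_map_add, dMod_symb]
  rw [dMod_comm m n, symb_comm ζ (S m) (S n)]
  abel

end Cov

/-! ### Wave functions of a dressing function -/

/-- A dressing function whose phase `θ` depends linearly on the times of a flow domain, with
well-defined and injective operators `ℒ`. The derivative of the phase with respect to the time with
index `n` is the Laurent polynomial `S n`. -/
structure DressedDomain (V I : Type*) [AddCommGroup V] [Module ℂ V] where
  D : DressingData
  Y : FlowDomain V I
  S : I → ℤ →₀ ℂ
  θ : V → ℂ → ℂ
  phase : ∀ T ∈ Y.carrier, ∀ (k : ℕ) (i : Fin k → I) (c : Fin k → ℂ) (l : ℂ), l ≠ 0 →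
    θ (Y.move T i c) l = θ T l + ∑ j, c j * evalSymb (S (i j)) l
  wellDefined : ∀ T ∈ Y.carrier, D.WellDefined (D.dress (θ T))
  trivialNullspace : ∀ T ∈ Y.carrier, D.TrivialNullspace (D.dress (θ T))

namespace DressedDomain

open DressingSupport

variable {V I : Type*} [AddCommGroup V] [Module ℂ V] (X : DressedDomain V I)

theorem cauchyPoint {T : V} (hT : T ∈ X.Y.carrier) {p : X.D.Pt} (hp : X.D.R p ≠ 0) :
    X.D.CauchyPoint (X.D.η p) := by
  intro F hF
  obtain ⟨G, -, hG⟩ := X.wellDefined T hT F hF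
  obtain ⟨c, hc, -⟩ := hG p
  exact ⟨c, hc (mul_ne_zero (Complex.exp_ne_zero _) hp)⟩

/-- The density of a wave function at `T`. -/
def density (W : Mod X.Y X.D.Pt) (T : V) : X.D.Pt → ℂ := fun p => X.Y.val (W (.dens p)) T

/-- The coefficients of the Laurent polynomial that a wave function is a Cauchy integral up to. -/
def polar (W : Mod X.Y X.D.Pt) (j : ℤ) : X.Y.Fun := if j < 0 then W (.zero j) else W (.infty j)

/-- The value of a wave function at `λ = z`. -/
def waveVal (W : Mod X.Y X.D.Pt) (T : V) (z : ℂ) : ℂ :=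
  (∑ᶠ j : ℤ, X.Y.val (X.polar W j) T * z ^ j)
    + 1 / (Real.pi : ℂ) * X.D.cauchy z (X.density W T)

/-- A family of Laurent polynomials plus Cauchy integrals of densities in `𝒟`, together with its
expansions at `λ = ∞` and `λ = 0`, which differ by the moments of the density. -/
structure IsCauchyFamily (W : Mod X.Y X.D.Pt) : Prop where
  locHolder : LocHolder X.Y fun p => W (.dens p)
  moment : ∀ T ∈ X.Y.carrier, ∀ j : ℤ, X.Y.val (W (.infty j)) T - X.Y.val (W (.zero j)) T
    = 1 / (Real.pi : ℂ) * X.D.int fun q => X.D.ζ q ^ (-1 - j) * X.density W T q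
  bounded : ∃ N : ℕ, (∀ j : ℤ, (N : ℤ) < j → W (.infty j) = 0) ∧
    ∀ j : ℤ, j < -(N : ℤ) → W (.zero j) = 0

variable {X}

theorem locHolder_zpow_mul (n : ℤ) {f : X.D.Pt → X.Y.Fun} (hf : LocHolder X.Y f) :
    LocHolder X.Y fun p => (X.D.ζ p ^ n) • f p := by
  obtain ⟨C, hC⟩ := X.D.ζ_embedded.exists_holderBound_zpow X.D.ζ_ne_zero n
  have := (locHolder_algebraMap (Y := X.Y) (hC.isHolder one_pos le_rfl)).mul hf
  simpa only [← Algebra.smul_def] using this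

theorem isHolder_ζ_zpow (n : ℤ) : X.D.IsHolder fun p => X.D.ζ p ^ n := by
  obtain ⟨C, hC⟩ := X.D.ζ_embedded.exists_holderBound_zpow X.D.ζ_ne_zero n
  exact hC.isHolder one_pos le_rfl

namespace IsCauchyFamily

variable {W W' : Mod X.Y X.D.Pt}

theorem isHolder (hW : X.IsCauchyFamily W) {T : V} (hT : T ∈ X.Y.carrier) :
    X.D.IsHolder (X.density W T) :=
  hW.locHolder.isHolder hT

theorem bddMeas_moment (hW : X.IsCauchyFamily W) {T : V} (hT : T ∈ X.Y.carrier) (n : ℤ) :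
    X.D.BddMeas fun q => X.D.ζ q ^ n * X.density W T q :=
  ((isHolder_ζ_zpow n).mul (hW.isHolder hT)).bddMeas

theorem exists_finset (hW : X.IsCauchyFamily W) : ∃ s : Finset ℤ, ∀ j ∉ s, X.polar W j = 0 := by
  obtain ⟨N, h1, h2⟩ := hW.bounded
  refine ⟨Finset.Icc (-N) N, fun j hj => ?_⟩
  unfold polar
  rw [Finset.mem_Icc] at hj
  split_ifs with h
  · exact h2 j (by omega)
  · exact h1 j (by omega)

theorem finite_support (hW : X.IsCauchyFamily W) (T : V) (z : ℂ) :
    (Function.support fun j : ℤ => X.Y.val (X.polar W j) T * z ^ j).Finite := by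
  obtain ⟨s, hs⟩ := hW.exists_finset
  refine s.finite_toSet.subset fun j hj => ?_
  by_contra hjs
  exact hj (by simp [hs j hjs, FlowDomain.val_zero])

theorem add (hW : X.IsCauchyFamily W) (hW' : X.IsCauchyFamily W') :
    X.IsCauchyFamily (W + W') where
  locHolder := hW.locHolder.add hW'.locHolder
  moment T hT j := by
    have h := congrArg₂ (· + ·) (hW.moment T hT j) (hW'.moment T hT j)
    simp only [← mul_add, ← int_add (hW.bddMeas_moment hT _) (hW'.bddMeas_moment hT _)] at h
    simp only [Pi.add_apply, FlowDomain.val_add, density] at h ⊢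
    rw [← h]
    ring
  bounded := by
    obtain ⟨N, h1, h2⟩ := hW.bounded
    obtain ⟨N', h1', h2'⟩ := hW'.bounded
    refine ⟨max N N', fun j hj => ?_, fun j hj => ?_⟩
    · rw [Pi.add_apply, h1 j (by omega), h1' j (by omega), add_zero]
    · rw [Pi.add_apply, h2 j (by omega), h2' j (by omega), add_zero]

theorem smul (hW : X.IsCauchyFamily W) (a : X.Y.Fun) : X.IsCauchyFamily (a • W) where
  locHolder := (locHolder_const a).mul hW.locHolder
  moment T hT j := by
    have h := int_const_mul (X.Y.val a T) (hW.bddMeas_moment hT (-1 - j))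
    simp only [Pi.smul_apply, smul_eq_mul, FlowDomain.val_mul, density] at h ⊢
    rw [← mul_sub, hW.moment T hT]
    simp only [mul_left_comm _ (X.Y.val a T)]
    rw [h]
    simp only [density]
    ring
  bounded := by
    obtain ⟨N, h1, h2⟩ := hW.bounded
    exact ⟨N, fun j hj => by simp [h1 j hj], fun j hj => by simp [h2 j hj]⟩

theorem zero : X.IsCauchyFamily 0 where
  locHolder := locHolder_const 0
  moment T _ j := by
    simp only [Pi.zero_apply, FlowDomain.val_zero, density, mul_zero, int_zero, sub_zero]
  bounded := ⟨0, by simp, by simp⟩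

theorem lam (hW : X.IsCauchyFamily W) (i : ℤ) : X.IsCauchyFamily (lam X.D.ζ i W) where
  locHolder := locHolder_zpow_mul i hW.locHolder
  moment T hT j := by
    rw [lam_infty, lam_zero, hW.moment T hT]
    congr 2
    funext q
    simp only [density, lam_dens, FlowDomain.val_smul]
    rw [← mul_assoc, ← zpow_add₀ (X.D.ζ_ne_zero q)]
    congr 2
    ring
  bounded := by
    obtain ⟨N, h1, h2⟩ := hW.bounded
    exact ⟨N + i.natAbs, fun j hj => h1 _ (by omega),
      fun j hj => h2 _ (by omega)⟩

theorem dMod (hW : X.IsCauchyFamily W) (n : I) : X.IsCauchyFamily (dMod n W) where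
  locHolder := hW.locHolder.d n
  moment T hT j := by
    have h1 := (locHolder_zpow_mul (-1 - j) hW.locHolder)
    have h2 := bddFunctional_int.pd h1 hT n
    have h3 : X.Y.Rep (fun T => X.D.int fun p => X.Y.val ((X.D.ζ p ^ (-1 - j)) • W (.dens p)) T)
        ((Real.pi : ℂ) • (W (.infty j) - W (.zero j))) := by
      intro T hT
      rw [FlowDomain.val_smul, FlowDomain.val_sub, hW.moment T hT j]
      have : (Real.pi : ℂ) ≠ 0 := by exact_mod_cast Real.pi_ne_zero
      simp only [FlowDomain.val_smul, density]
      field_simp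
    have h4 := h3.pd n T hT
    rw [h2, Derivation.map_smul, FlowDomain.val_smul, map_sub, FlowDomain.val_sub] at h4
    have : (Real.pi : ℂ) ≠ 0 := by exact_mod_cast Real.pi_ne_zero
    simp only [Derivation.map_smul, FlowDomain.val_smul] at h4
    simp only [KaupBroer.dMod, density]
    rw [h4]
    field_simp
  bounded := by
    obtain ⟨N, h1, h2⟩ := hW.bounded
    exact ⟨N, fun j hj => by simp [KaupBroer.dMod, h1 j hj],
      fun j hj => by simp [KaupBroer.dMod, h2 j hj]⟩

/-! The value of a wave function is compatible with the operations on wave functions. -/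

theorem waveVal_add (hW : X.IsCauchyFamily W) (hW' : X.IsCauchyFamily W') {T : V}
    (hT : T ∈ X.Y.carrier) {z : ℂ} (hz : X.D.CauchyPoint z) :
    X.waveVal (W + W') T z = X.waveVal W T z + X.waveVal W' T z := by
  have h1 : X.D.cauchy z (X.density (W + W') T)
      = X.D.cauchy z (X.density W T) + X.D.cauchy z (X.density W' T) := by
    rw [← hz.bddFunctional.map_add _ _ (hW.isHolder hT) (hW'.isHolder hT)]
    congr 1
    funext q
    simp only [density, Pi.add_apply, FlowDomain.val_add]
  have h2 : ∀ j, X.polar (W + W') j = X.polar W j + X.polar W' j := fun j => by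
    unfold polar; split_ifs <;> rfl
  simp only [waveVal, h1, h2, FlowDomain.val_add, add_mul]
  rw [finsum_add_distrib (hW.finite_support T z) (hW'.finite_support T z)]
  ring

theorem waveVal_smul (hW : X.IsCauchyFamily W) (a : X.Y.Fun) {T : V} (hT : T ∈ X.Y.carrier) {z : ℂ}
    (hz : X.D.CauchyPoint z) : X.waveVal (a • W) T z = X.Y.val a T * X.waveVal W T z := by
  have h1 : X.D.cauchy z (X.density (a • W) T) = X.Y.val a T * X.D.cauchy z (X.density W T) := by
    rw [← hz.bddFunctional.map_const_mul _ _ (hW.isHolder hT)]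
    congr 1
    funext q
    simp only [density, Pi.smul_apply, smul_eq_mul, FlowDomain.val_mul]
  have h2 : ∀ j, X.polar (a • W) j = a * X.polar W j := fun j => by
    unfold polar; split_ifs <;> rfl
  simp only [waveVal, h1, h2, FlowDomain.val_mul, mul_assoc]
  rw [← mul_finsum]
  ring

theorem waveVal_lam_one (hW : X.IsCauchyFamily W) {T : V} (hT : T ∈ X.Y.carrier) {z : ℂ}
    (hz : X.D.CauchyPoint z) (hz0 : z ≠ 0) :
    X.waveVal (KaupBroer.lam X.D.ζ 1 W) T z = z * X.waveVal W T z := by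
  have h1 : X.D.cauchy z (X.density (KaupBroer.lam X.D.ζ 1 W) T)
      = z * X.D.cauchy z (X.density W T) - X.D.int (X.density W T) := by
    rw [← hz.cauchy_ζ_mul (hW.isHolder hT)]
    congr 1
    funext q
    simp only [density, lam_dens, FlowDomain.val_smul, zpow_one]
  -- the expansions at `∞` and at `0` are joined at a different place after the shift
  have h2 : ∀ j, X.polar (KaupBroer.lam X.D.ζ 1 W) j
      = X.polar W (j - 1) + if j = 0 then W (.infty (-1)) - W (.zero (-1)) else 0 := fun j => by
    unfold polar
    rcases lt_trichotomy j 0 with h | h | h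
    · simp [h, h.ne, show j - 1 < 0 by omega]
    · simp [h]
    · simp [h.ne', show ¬ j < 0 by omega, show ¬ j - 1 < 0 by omega]
  have h3 := hW.moment T hT (-1)
  simp only [sub_self, zpow_zero, one_mul] at h3
  have h4 : ∑ᶠ j : ℤ, X.Y.val (X.polar W (j - 1)) T * z ^ j
      = z * ∑ᶠ j : ℤ, X.Y.val (X.polar W j) T * z ^ j := by
    rw [mul_finsum,
      ← finsum_comp_equiv (Equiv.subRight (1 : ℤ)) (f := fun j => z * (X.Y.val (X.polar W j) T * z ^ j))]
    refine finsum_congr fun j => ?_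
    simp only [Equiv.subRight_apply]
    rw [zpow_sub_one₀ hz0]
    field_simp
  have hfin : (Function.support fun j : ℤ => X.Y.val (X.polar W (j - 1)) T * z ^ j).Finite := by
    obtain ⟨s, hs⟩ := hW.exists_finset
    refine (s.finite_toSet.preimage (f := fun j : ℤ => j - 1)
      (fun a _ b _ h => by simpa using h)).subset fun j hj => ?_
    by_contra hjs
    exact hj (by simp [hs (j - 1) hjs, FlowDomain.val_zero])
  have h5 : ∑ᶠ j : ℤ, X.Y.val (if j = 0 then W (.infty (-1)) - W (.zero (-1)) else 0) T * z ^ j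
      = 1 / (Real.pi : ℂ) * X.D.int (X.density W T) := by
    rw [finsum_eq_single _ 0 fun j hj => by simp [hj, FlowDomain.val_zero]]
    simp only [if_true, zpow_zero, mul_one, FlowDomain.val_sub]
    exact h3
  simp only [waveVal, h1, h2, FlowDomain.val_add, add_mul]
  rw [finsum_add_distrib hfin
    ((Set.finite_singleton (0 : ℤ)).subset fun j hj => by
      by_contra hj0
      have hj0' : j ≠ 0 := hj0
      exact hj (by simp [hj0', FlowDomain.val_zero])), h4, h5]
  ring

theorem waveVal_lam (hW : X.IsCauchyFamily W) (i : ℤ) {T : V} (hT : T ∈ X.Y.carrier) {z : ℂ}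
    (hz : X.D.CauchyPoint z) (hz0 : z ≠ 0) :
    X.waveVal (KaupBroer.lam X.D.ζ i W) T z = z ^ i * X.waveVal W T z := by
  induction i with
  | zero => simp [lam_zero_apply]
  | succ i ih =>
    rw [add_comm, ← lam_lam X.D.ζ X.D.ζ_ne_zero, (hW.lam i).waveVal_lam_one hT hz hz0, ih,
      zpow_one_add₀ hz0]
    ring
  | pred i ih =>
    have h1 := (hW.lam (-i - 1)).waveVal_lam_one hT hz hz0
    rw [lam_lam X.D.ζ X.D.ζ_ne_zero, add_sub_cancel, ih] at h1
    rw [zpow_sub_one₀ hz0]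
    field_simp
    rw [h1]
    ring

theorem waveVal_dMod (hW : X.IsCauchyFamily W) (n : I) {T : V} (hT : T ∈ X.Y.carrier) {z : ℂ}
    (hz : X.D.CauchyPoint z) :
    HasDerivAt (fun s : ℂ => X.waveVal W (T + s • X.Y.dir n) z)
      (X.waveVal (KaupBroer.dMod n W) T z) 0 := by
  obtain ⟨s, hs⟩ := hW.exists_finset
  have h1 : ∀ T, ∑ᶠ j : ℤ, X.Y.val (X.polar W j) T * z ^ j
      = ∑ j ∈ s, X.Y.val (X.polar W j) T * z ^ j := fun T => by
    refine finsum_eq_sum_of_support_subset _ fun j hj => ?_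
    by_contra hjs
    exact hj (by simp [hs j hjs, FlowDomain.val_zero])
  have hp : ∀ j, X.polar (KaupBroer.dMod n W) j = X.Y.d n (X.polar W j) := fun j => by
    unfold polar KaupBroer.dMod; split_ifs <;> rfl
  have h2 : ∑ᶠ j : ℤ, X.Y.val (X.polar (KaupBroer.dMod n W) j) T * z ^ j
      = ∑ j ∈ s, X.Y.val (X.polar (KaupBroer.dMod n W) j) T * z ^ j := by
    refine finsum_eq_sum_of_support_subset _ fun j hj => ?_
    by_contra hjs
    exact hj (by simp [hp, hs j hjs, FlowDomain.val_zero])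
  have h3 := (hz.bddFunctional.hol hW.locHolder).hasDerivAt hT n
  rw [hz.bddFunctional.pd hW.locHolder hT n] at h3
  simp only [waveVal, h1, h2]
  refine HasDerivAt.add (HasDerivAt.fun_sum fun j _ => ?_) (h3.const_mul _)
  rw [hp, FlowDomain.val_d n _ hT]
  exact ((X.Y.hol_val (X.polar W j)).hasDerivAt hT n).mul_const _

end IsCauchyFamily

end DressedDomain

namespace DressedDomain

open DressingSupport

variable {V I : Type*} [AddCommGroup V] [Module ℂ V] (X : DressedDomain V I)

/-- The wave functions `χ` of a dressing function: Cauchy families with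
`f(ζ(p)) = R(ζ(p), η(p)) χ(η(p))`. -/
structure IsWave (W : Mod X.Y X.D.Pt) : Prop where
  cauchyFamily : X.IsCauchyFamily W
  density_eq : ∀ T ∈ X.Y.carrier, ∀ p,
    X.density W T p = X.D.dress (X.θ T) p * X.waveVal W T (X.D.η p)

/-- The action of `∂/∂tₙ` on the wave functions of `X`. -/
abbrev cov (n : I) : Mod X.Y X.D.Pt →+ Mod X.Y X.D.Pt := KaupBroer.cov X.D.ζ X.S n

variable {X}

theorem dress_eq_zero {T : V} {p : X.D.Pt} (hp : X.D.R p = 0) : X.D.dress (X.θ T) p = 0 := by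
  simp [DressingData.dress, hp]

theorem IsCauchyFamily.symb {W : Mod X.Y X.D.Pt} (hW : X.IsCauchyFamily W) (s : ℤ →₀ ℂ) :
    X.IsCauchyFamily (symb X.D.ζ s W) ∧ ∀ T ∈ X.Y.carrier, ∀ z, X.D.CauchyPoint z → z ≠ 0 →
      X.waveVal (KaupBroer.symb X.D.ζ s W) T z = evalSymb s z * X.waveVal W T z := by
  induction s using Finsupp.induction_linear with
  | zero =>
    have h0 : KaupBroer.symb X.D.ζ 0 W = 0 := by simp [KaupBroer.symb]
    rw [h0]
    refine ⟨.zero, fun T hT z hz _ => ?_⟩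
    have := IsCauchyFamily.zero.waveVal_smul (0 : X.Y.Fun) hT hz
    rw [smul_zero, FlowDomain.val_zero, zero_mul] at this
    simp [this, evalSymb]
  | add s t hs ht =>
    rw [symb_add]
    refine ⟨hs.1.add ht.1, fun T hT z hz hz0 => ?_⟩
    rw [hs.1.waveVal_add ht.1 hT hz, hs.2 T hT z hz hz0, ht.2 T hT z hz hz0]
    have : evalSymb (s + t) z = evalSymb s z + evalSymb t z :=
      Finsupp.sum_add_index' (fun _ => zero_mul _) fun _ _ _ => add_mul _ _ _
    rw [this]
    ring
  | single i x =>
    rw [symb_single, ← algebraMap_smul X.Y.Fun x]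
    refine ⟨(hW.lam i).smul _, fun T hT z hz hz0 => ?_⟩
    rw [(hW.lam i).waveVal_smul _ hT hz, FlowDomain.val_algebraMap _ hT,
      hW.waveVal_lam i hT hz hz0]
    simp [evalSymb, mul_assoc]

variable (X) in
/-- The logarithmic derivative of the dressing function with respect to the time with index `n`. -/
def rate (n : I) (p : X.D.Pt) : ℂ := evalSymb (X.S n) (X.D.η p) - evalSymb (X.S n) (X.D.ζ p)

theorem dress_move {T : V} (hT : T ∈ X.Y.carrier) {k : ℕ} (i : Fin k → I) (c : Fin k → ℂ)
    (p : X.D.Pt) : X.D.dress (X.θ (X.Y.move T i c)) p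
      = Complex.exp (∑ j, c j * X.rate (i j) p) * X.D.dress (X.θ T) p := by
  simp only [DressingData.dress]
  rw [X.phase T hT k i c _ (X.D.η_ne_zero p), X.phase T hT k i c _ (X.D.ζ_ne_zero p), ← mul_assoc,
    ← Complex.exp_add]
  congr 2
  simp only [rate, mul_sub, Finset.sum_sub_distrib]
  ring

theorem dress_add_smul {T : V} (hT : T ∈ X.Y.carrier) (n : I) (s : ℂ) (p : X.D.Pt) :
    X.D.dress (X.θ (T + s • X.Y.dir n)) p
      = Complex.exp (s * X.rate n p) * X.D.dress (X.θ T) p := by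
  simpa [FlowDomain.move] using dress_move hT (fun _ : Fin 1 => n) (fun _ => s) p

/-- Covariant derivatives of wave functions are wave functions. -/
theorem IsWave.cov {W : Mod X.Y X.D.Pt} (hW : X.IsWave W) (n : I) : X.IsWave (X.cov n W) := by
  have hc := hW.cauchyFamily
  obtain ⟨hs, hval⟩ := hc.symb (X.S n)
  refine ⟨(hc.dMod n).add hs, fun T hT p => ?_⟩
  have hd : X.density (X.cov n W) T p = pd ℂ (X.Y.dir n) (X.Y.val (W (.dens p))) T
      + evalSymb (X.S n) (X.D.ζ p) * X.density W T p := by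
    simp only [density, DressedDomain.cov, cov_apply, Pi.add_apply, FlowDomain.val_add]
    congr 1
    · exact FlowDomain.val_d n _ hT
    · have h1 : symb X.D.ζ (X.S n) W (.dens p)
          = evalSymb (X.S n) (X.D.ζ p) • W (.dens p) := by
        simp only [symb, evalSymb, Finsupp.sum, Finset.sum_apply, Pi.smul_apply, lam_dens,
          smul_smul, ← Finset.sum_smul]
      rw [h1, FlowDomain.val_smul]
  by_cases hp : X.D.R p = 0
  · have h0 : X.Y.val (W (.dens p)) = fun _ => 0 := by
      funext S
      by_cases hS : S ∈ X.Y.carrier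
      · have := hW.density_eq S hS p
        rw [dress_eq_zero hp, zero_mul] at this
        exact this
      · exact FlowDomain.val_of_notMem _ hS
    have h1 : X.density W T p = 0 := congrFun h0 T
    rw [hd, h0, h1, dress_eq_zero hp]
    simp [pd, lineDeriv]
  · have hz := X.cauchyPoint hT hp
    have h1 : HasDerivAt (fun s : ℂ => X.Y.val (W (.dens p)) (T + s • X.Y.dir n))
        (pd ℂ (X.Y.dir n) (X.Y.val (W (.dens p))) T) 0 := (X.Y.hol_val _).hasDerivAt hT n
    have h2 := hc.waveVal_dMod n hT hz
    set k := X.rate n p with hk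
    have h3 : HasDerivAt (fun s : ℂ => Complex.exp (s * k)) k 0 := by
      have := ((hasDerivAt_id (0 : ℂ)).mul_const k).cexp
      simpa using this
    have h4 := (h3.mul_const (X.D.dress (X.θ T) p)).mul h2
    have h5 := h1.unique (h4.congr_of_eventuallyEq (by
      filter_upwards [X.Y.eventually_mem hT n] with s hs
      have := hW.density_eq _ hs p
      rw [dress_add_smul hT] at this
      exact this))
    rw [hd, h5, hW.density_eq T hT p]
    have h6 : X.waveVal (X.cov n W) T (X.D.η p) = X.waveVal (dMod n W) T (X.D.η p)
        + evalSymb (X.S n) (X.D.η p) * X.waveVal W T (X.D.η p) := by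
      rw [DressedDomain.cov, cov_apply, (hc.dMod n).waveVal_add hs hT hz,
        hval T hT _ hz (X.D.η_ne_zero p)]
    rw [h6]
    simp only [zero_mul, Complex.exp_zero, zero_smul, add_zero, one_mul, hk, rate]
    ring

theorem IsWave.add {W W' : Mod X.Y X.D.Pt} (hW : X.IsWave W) (hW' : X.IsWave W') :
    X.IsWave (W + W') := by
  refine ⟨hW.cauchyFamily.add hW'.cauchyFamily, fun T hT p => ?_⟩
  have h : X.density (W + W') T p = X.density W T p + X.density W' T p := by
    simp only [density, Pi.add_apply, FlowDomain.val_add]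
  by_cases hp : X.D.R p = 0
  · rw [h, hW.density_eq T hT, hW'.density_eq T hT]
    simp [dress_eq_zero hp]
  · rw [h, hW.density_eq T hT, hW'.density_eq T hT,
      hW.cauchyFamily.waveVal_add hW'.cauchyFamily hT (X.cauchyPoint hT hp)]
    ring

theorem IsWave.smul {W : Mod X.Y X.D.Pt} (hW : X.IsWave W) (a : X.Y.Fun) : X.IsWave (a • W) := by
  refine ⟨hW.cauchyFamily.smul a, fun T hT p => ?_⟩
  have h : X.density (a • W) T p = X.Y.val a T * X.density W T p := by
    simp only [density, Pi.smul_apply, smul_eq_mul, FlowDomain.val_mul]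
  by_cases hp : X.D.R p = 0
  · rw [h, hW.density_eq T hT]
    simp [dress_eq_zero hp]
  · rw [h, hW.density_eq T hT, hW.cauchyFamily.waveVal_smul a hT (X.cauchyPoint hT hp)]
    ring

variable (X) in
/-- The module of wave functions. -/
def waves : Submodule X.Y.Fun (Mod X.Y X.D.Pt) where
  carrier := {W | X.IsWave W}
  add_mem' := IsWave.add
  smul_mem' a _ hW := IsWave.smul hW a
  zero_mem' := by
    refine ⟨.zero, fun T hT p => ?_⟩
    have hd : X.density 0 T = fun _ => 0 := by
      funext q; simp only [density, Pi.zero_apply, FlowDomain.val_zero]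
    by_cases hp : X.D.R p = 0
    · rw [hd, dress_eq_zero hp, zero_mul]
    · have := IsCauchyFamily.zero.waveVal_smul (0 : X.Y.Fun) hT (X.cauchyPoint hT hp)
      rw [smul_zero, FlowDomain.val_zero, zero_mul] at this
      rw [hd, this, mul_zero]

theorem cov_mem_waves {W : Mod X.Y X.D.Pt} (hW : W ∈ X.waves) (n : I) : X.cov n W ∈ X.waves :=
  IsWave.cov hW n

theorem cov_iterate_mem_waves {W : Mod X.Y X.D.Pt} (hW : W ∈ X.waves) (n : I) (k : ℕ) :
    (X.cov n)^[k] W ∈ X.waves := by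
  induction k with
  | zero => exact hW
  | succ k ih =>
    rw [Function.iterate_succ_apply']
    exact cov_mem_waves ih n

/-- A wave function without polynomial part vanishes, since its density lies in the nullspace
of `ℒ`. -/
theorem eq_zero_of_mem_waves {W : Mod X.Y X.D.Pt} (hW : W ∈ X.waves)
    (hinf : ∀ j : ℤ, 0 ≤ j → W (.infty j) = 0) (hzero : ∀ j : ℤ, j < 0 → W (.zero j) = 0) :
    W = 0 := by
  have hW' : X.IsWave W := hW
  have hpolar : ∀ j, X.polar W j = 0 := fun j => by
    unfold polar
    split_ifs with h
    · exact hzero j h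
    · exact hinf j (not_lt.1 h)
  have hdens : ∀ T ∈ X.Y.carrier, ∀ p, X.density W T p = 0 := by
    intro T hT
    refine X.trivialNullspace T hT _ (hW'.cauchyFamily.isHolder hT) fun p => ?_
    refine ⟨X.D.cauchy (X.D.η p) (X.density W T), fun hp => ?_, ?_⟩
    · exact (X.cauchyPoint hT (right_ne_zero_of_mul hp)).hasCauchyIntegral
        (hW'.cauchyFamily.isHolder hT)
    · rw [hW'.density_eq T hT p]
      simp only [waveVal, hpolar, FlowDomain.val_zero, zero_mul, finsum_zero, zero_add]
      ring
  have hmoment : ∀ j, W (.infty j) = W (.zero j) := fun j => FlowDomain.Fun.ext_val fun T hT => by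
    have := hW'.cauchyFamily.moment T hT j
    simp only [hdens T hT, mul_zero, int_zero] at this
    exact sub_eq_zero.1 this
  funext s
  cases s with
  | dens p =>
    refine FlowDomain.Fun.ext_val fun T hT => ?_
    rw [Pi.zero_apply, FlowDomain.val_zero]
    exact hdens T hT p
  | infty j =>
    rcases lt_or_ge j 0 with h | h
    · rw [hmoment]; exact hzero j h
    · exact hinf j h
  | zero j =>
    rcases lt_or_ge j 0 with h | h
    · exact hzero j h
    · rw [← hmoment]; exact hinf j h

end DressedDomain

/-- A dressed domain with a holomorphic solution of `ℒ f = g`. -/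
structure SolvedDomain (V I : Type*) [AddCommGroup V] [Module ℂ V] extends DressedDomain V I where
  f : D.Pt → Y.Fun
  locHolder_f : DressingSupport.LocHolder Y f
  solves : ∀ T ∈ Y.carrier, D.Solves (D.dress (θ T)) fun p => Y.val (f p) T

namespace SolvedDomain

open DressingSupport DressedDomain

variable {V I : Type*} [AddCommGroup V] [Module ℂ V] (X : SolvedDomain V I)

/-- `π⁻¹ ∬ ξᵏ f(ξ) d²ξ`. -/
def moment (k : ℤ) : X.Y.Fun :=
  (1 / (Real.pi : ℂ)) •
    bddFunctional_int.toFun (locHolder_zpow_mul (X := X.toDressedDomain) k X.locHolder_f)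

theorem val_moment (k : ℤ) {T : V} (hT : T ∈ X.Y.carrier) :
    X.Y.val (X.moment k) T
      = 1 / (Real.pi : ℂ) * X.D.int fun p => X.D.ζ p ^ k * X.Y.val (X.f p) T := by
  unfold moment
  rw [FlowDomain.val_smul, BddFunctional.toFun, FlowDomain.Hol.val_toFun _ hT]
  simp only [FlowDomain.val_smul]

/-- The wave function `χ(λ) = 1 + π⁻¹ ∬ f(ξ) / (λ - ξ) d²ξ` with its expansions at `λ = ∞` and
at `λ = 0`. -/
def wave : Mod X.Y X.D.Pt
  | .dens p => X.f p
  | .infty j => if j = 0 then 1 else if j < 0 then X.moment (-1 - j) else 0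
  | .zero j => if j = 0 then 1 - X.moment (-1) else if 0 < j then -X.moment (-1 - j) else 0

@[simp] theorem wave_dens (p : X.D.Pt) : X.wave (.dens p) = X.f p := rfl
theorem wave_infty_zero : X.wave (.infty 0) = 1 := rfl
theorem wave_infty_neg {j : ℤ} (hj : j < 0) : X.wave (.infty j) = X.moment (-1 - j) := by
  simp [wave, hj, hj.ne]
theorem wave_infty_pos {j : ℤ} (hj : 0 < j) : X.wave (.infty j) = 0 := by
  simp [wave, hj.le, hj.ne']
theorem wave_zero_zero : X.wave (.zero 0) = 1 - X.moment (-1) := rfl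
theorem wave_zero_pos {j : ℤ} (hj : 0 < j) : X.wave (.zero j) = -X.moment (-1 - j) := by
  simp [wave, hj, hj.ne']
theorem wave_zero_neg {j : ℤ} (hj : j < 0) : X.wave (.zero j) = 0 := by
  simp [wave, hj.le, hj.ne]

theorem wave_mem_waves : X.wave ∈ X.waves := by
  refine ⟨⟨X.locHolder_f, fun T hT j => ?_, 0, fun j hj => X.wave_infty_pos (by omega),
    fun j hj => X.wave_zero_neg (by omega)⟩, fun T hT p => ?_⟩
  · have h := X.val_moment (-1 - j) hT
    simp only [density, wave_dens]
    rw [← h, ← FlowDomain.val_sub]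
    congr 1
    rcases lt_trichotomy j 0 with hj | rfl | hj
    · rw [X.wave_infty_neg hj, X.wave_zero_neg hj, sub_zero]
    · rw [X.wave_infty_zero, X.wave_zero_zero]; simp
    · rw [X.wave_infty_pos hj, X.wave_zero_pos hj]; simp
  · have hpolar : ∑ᶠ j : ℤ, X.Y.val (X.polar X.wave j) T * X.D.η p ^ j = 1 := by
      rw [finsum_eq_single _ 0]
      · simp only [polar, lt_irrefl, if_false, X.wave_infty_zero, FlowDomain.val_one hT]; simp
      · intro j hj
        have : X.polar X.wave j = 0 := by
          unfold polar
          split_ifs with h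
          · exact X.wave_zero_neg h
          · exact X.wave_infty_pos (by omega)
        rw [this, FlowDomain.val_zero, zero_mul]
    obtain ⟨hf, hs⟩ := X.solves T hT
    obtain ⟨c, hc, hfc⟩ := hs p
    rw [waveVal, hpolar]
    by_cases hp : X.D.R p = 0
    · have h0 : X.D.dress (X.θ T) p = 0 := dress_eq_zero hp
      rw [h0] at hfc ⊢
      simp only [density, wave_dens]
      simpa [h0] using hfc
    · have hc' := hc (mul_ne_zero (Complex.exp_ne_zero _) hp)
      have : X.D.cauchy (X.D.η p) (X.density X.wave T) = c :=
        ((X.cauchyPoint hT hp).hasCauchyIntegral hf).unique hc'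
      rw [this]
      simp only [density, wave_dens]
      linear_combination hfc

end SolvedDomain

/-! ### Linear equations for the wave function -/

namespace DressedDomain

variable {V I : Type*} [AddCommGroup V] [Module ℂ V] (X : DressedDomain V I)

theorem cov_infty {n : I} {i : ℤ} {x : ℂ} (hn : X.S n = Finsupp.single i x)
    (W : Mod X.Y X.D.Pt) (j : ℤ) :
    X.cov n W (.infty j) = X.Y.d n (W (.infty j)) + x • W (.infty (j - i)) := by
  rw [cov, cov_apply, hn, symb_single]
  rfl

theorem cov_zero {n : I} {i : ℤ} {x : ℂ} (hn : X.S n = Finsupp.single i x)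
    (W : Mod X.Y X.D.Pt) (j : ℤ) :
    X.cov n W (.zero j) = X.Y.d n (W (.zero j)) + x • W (.zero (j - i)) := by
  rw [cov, cov_apply, hn, symb_single]
  rfl

end DressedDomain

namespace SolvedDomain

open DressedDomain

variable {V I : Type*} [AddCommGroup V] [Module ℂ V] (X : SolvedDomain V I)

theorem d_wave_infty {j : ℤ} (hj : 0 ≤ j) (n : I) : X.Y.d n (X.wave (.infty j)) = 0 := by
  rcases hj.eq_or_lt with rfl | hj
  · rw [X.wave_infty_zero]; exact Derivation.map_one_eq_zero _
  · rw [X.wave_infty_pos hj, map_zero]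

section U

variable {u : I} (hu : X.S u = Finsupp.single 1 1)

include hu

theorem cov_u_iterate_infty_of_gt (k : ℕ) {j : ℤ} (hj : (k : ℤ) < j) :
    (X.cov u)^[k] X.wave (.infty j) = 0 := by
  induction k generalizing j with
  | zero => exact X.wave_infty_pos (by simpa using hj)
  | succ k ih =>
    rw [Function.iterate_succ_apply', X.cov_infty hu, ih (by omega), ih (by omega)]
    simp

theorem cov_u_iterate_infty_self (k : ℕ) : (X.cov u)^[k] X.wave (.infty k) = 1 := by
  induction k with
  | zero => exact X.wave_infty_zero
  | succ k ih =>
    rw [Function.iterate_succ_apply', X.cov_infty hu,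
      X.cov_u_iterate_infty_of_gt hu k (by omega)]
    simp [ih]

theorem cov_u_iterate_infty_pred (k : ℕ) :
    (X.cov u)^[k] X.wave (.infty (k - 1)) = X.moment 0 := by
  induction k with
  | zero => simpa using X.wave_infty_neg (j := -1) (by norm_num)
  | succ k ih =>
    rw [Function.iterate_succ_apply', X.cov_infty hu]
    simp [ih, X.cov_u_iterate_infty_self hu]

theorem cov_u_iterate_zero_neg (k : ℕ) {j : ℤ} (hj : j < 0) :
    (X.cov u)^[k] X.wave (.zero j) = 0 := by
  induction k generalizing j with
  | zero => exact X.wave_zero_neg hj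
  | succ k ih =>
    rw [Function.iterate_succ_apply', X.cov_zero hu, ih hj, ih (by omega)]
    simp

/-- A wave function that is regular at `λ = 0` and has a pole of order less than `N` at `λ = ∞` is
a differential operator in `u` of order less than `N`, applied to the basic one. -/
theorem exists_eq_sum_cov_u (N : ℕ) {W : Mod X.Y X.D.Pt} (hW : W ∈ X.waves)
    (hinf : ∀ j : ℤ, (N : ℤ) ≤ j → W (.infty j) = 0) (hzero : ∀ j : ℤ, j < 0 → W (.zero j) = 0) :
    ∃ c : ℕ → X.Y.Fun, W = ∑ k ∈ Finset.range N, c k • (X.cov u)^[k] X.wave := by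
  induction N generalizing W with
  | zero => exact ⟨0, by simpa using eq_zero_of_mem_waves hW (by simpa using hinf) hzero⟩
  | succ N ih =>
    have hN := cov_iterate_mem_waves X.wave_mem_waves u N
    have hinf' : ∀ j : ℤ, (N : ℤ) ≤ j →
        (W - W (.infty N) • (X.cov u)^[N] X.wave) (.infty j) = 0 := fun j hj => by
      rcases hj.eq_or_lt with rfl | hj
      · simp [X.cov_u_iterate_infty_self hu]
      · simp [X.cov_u_iterate_infty_of_gt hu N hj, hinf j (by omega)]
    have hzero' : ∀ j : ℤ, j < 0 →
        (W - W (.infty N) • (X.cov u)^[N] X.wave) (.zero j) = 0 := fun j hj => by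
      simp [X.cov_u_iterate_zero_neg hu N hj, hzero j hj]
    obtain ⟨c, hc⟩ := ih (sub_mem hW (X.waves.smul_mem _ hN)) hinf' hzero'
    refine ⟨Function.update c N (W (.infty N)), ?_⟩
    rw [Finset.sum_range_succ, Function.update_self, ← sub_eq_iff_eq_add, hc]
    refine Finset.sum_congr rfl fun k hk => ?_
    rw [Function.update_of_ne (Finset.mem_range.1 hk).ne]

/-- The time whose symbol is `λ ^ n` acts on the wave function as a differential operator of
order `n` in `u`. -/
theorem exists_flow_u {n : I} {N : ℕ} (hN : 0 < N) (hn : X.S n = Finsupp.single (N : ℤ) 1) :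
    ∃ c : ℕ → X.Y.Fun, X.cov n X.wave - (X.cov u)^[N] X.wave
      = ∑ k ∈ Finset.range (N - 1), c k • (X.cov u)^[k] X.wave := by
  refine X.exists_eq_sum_cov_u hu _
    (sub_mem (cov_mem_waves X.wave_mem_waves n) (cov_iterate_mem_waves X.wave_mem_waves u N))
    (fun j hj => ?_) (fun j hj => ?_)
  · rw [Pi.sub_apply, X.cov_infty hn, X.d_wave_infty (by omega), one_smul, zero_add]
    rcases lt_trichotomy j N with h | rfl | h
    · obtain rfl : j = N - 1 := by omega
      rw [X.cov_u_iterate_infty_pred hu, X.wave_infty_neg (by omega)]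
      simp
    · rw [X.cov_u_iterate_infty_self hu, sub_self, X.wave_infty_zero, sub_self]
    · rw [X.cov_u_iterate_infty_of_gt hu N h, X.wave_infty_pos (by omega), sub_self]
  · rw [Pi.sub_apply, X.cov_zero hn, X.wave_zero_neg hj, X.wave_zero_neg (by omega),
      X.cov_u_iterate_zero_neg hu N hj]
    simp

end U

section V

variable {v : I} {b : ℂ} (hv : X.S v = Finsupp.single (-1) b)

include hv

theorem cov_v_iterate_zero_of_lt (k : ℕ) {j : ℤ} (hj : j < -(k : ℤ)) :
    (X.cov v)^[k] X.wave (.zero j) = 0 := by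
  induction k generalizing j with
  | zero => exact X.wave_zero_neg (by simpa using hj)
  | succ k ih =>
    rw [Function.iterate_succ_apply', X.cov_zero hv, ih (by omega), ih (by omega)]
    simp

theorem cov_v_iterate_zero_self (k : ℕ) :
    (X.cov v)^[k] X.wave (.zero (-k)) = b ^ k • X.wave (.zero 0) := by
  induction k with
  | zero => simp
  | succ k ih =>
    rw [Function.iterate_succ_apply', X.cov_zero hv,
      X.cov_v_iterate_zero_of_lt hv k (by omega),
      show (-((k + 1 : ℕ) : ℤ) - -1) = -(k : ℤ) by push_cast; ring, ih, smul_smul, pow_succ']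
    simp

theorem cov_v_iterate_infty_nonneg {k : ℕ} (hk : k ≠ 0) {j : ℤ} (hj : 0 ≤ j) :
    (X.cov v)^[k] X.wave (.infty j) = 0 := by
  obtain ⟨k, rfl⟩ := Nat.exists_eq_succ_of_ne_zero hk
  clear hk
  induction k generalizing j with
  | zero =>
    rw [Function.iterate_one, X.cov_infty hv, X.d_wave_infty hj, X.wave_infty_pos (by omega)]
    simp
  | succ k ih =>
    rw [Function.iterate_succ_apply', X.cov_infty hv, ih hj, ih (by omega)]
    simp

/-- A wave function that vanishes at `λ = ∞` and has a pole of order at most `N` at `λ = 0` is a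
differential operator in `v` of order at most `N` without a term of order zero, applied to the
basic one. -/
theorem exists_eq_sum_cov_v (hb : b ≠ 0) (hunit : IsUnit (X.wave (.zero 0))) (N : ℕ)
    {W : Mod X.Y X.D.Pt} (hW : W ∈ X.waves) (hinf : ∀ j : ℤ, 0 ≤ j → W (.infty j) = 0)
    (hzero : ∀ j : ℤ, j < -(N : ℤ) → W (.zero j) = 0) :
    ∃ c : ℕ → X.Y.Fun, W = ∑ k ∈ Finset.range N, c k • (X.cov v)^[k + 1] X.wave := by
  induction N generalizing W with
  | zero => exact ⟨0, by simpa using eq_zero_of_mem_waves hW hinf (by simpa using hzero)⟩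
  | succ N ih =>
    obtain ⟨e, he⟩ := hunit.exists_left_inv
    have hN := cov_iterate_mem_waves X.wave_mem_waves v (N + 1)
    set x : X.Y.Fun := (b ^ (N + 1))⁻¹ • (W (.zero (-((N + 1 : ℕ) : ℤ))) * e) with hx
    have hxW : x * (b ^ (N + 1) • X.wave (.zero 0)) = W (.zero (-((N + 1 : ℕ) : ℤ))) := by
      rw [hx, smul_mul_smul_comm, inv_mul_cancel₀ (pow_ne_zero _ hb), mul_assoc, he, mul_one,
        one_smul]
    have hinf' : ∀ j : ℤ, 0 ≤ j → (W - x • (X.cov v)^[N + 1] X.wave) (.infty j) = 0 :=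
      fun j hj => by
        rw [Pi.sub_apply, Pi.smul_apply, X.cov_v_iterate_infty_nonneg hv (by omega) hj, hinf j hj]
        simp
    have hzero' : ∀ j : ℤ, j < -(N : ℤ) → (W - x • (X.cov v)^[N + 1] X.wave) (.zero j) = 0 :=
      fun j hj => by
        rw [Pi.sub_apply, Pi.smul_apply]
        rcases (show j ≤ -((N + 1 : ℕ) : ℤ) by omega).eq_or_lt with rfl | hj
        · rw [X.cov_v_iterate_zero_self hv, smul_eq_mul, hxW, sub_self]
        · rw [X.cov_v_iterate_zero_of_lt hv _ hj, hzero j hj]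
          simp
    obtain ⟨c, hc⟩ := ih (sub_mem hW (X.waves.smul_mem _ hN)) hinf' hzero'
    refine ⟨Function.update c N x, ?_⟩
    rw [Finset.sum_range_succ, Function.update_self, ← sub_eq_iff_eq_add, hc]
    refine Finset.sum_congr rfl fun k hk => ?_
    rw [Function.update_of_ne (Finset.mem_range.1 hk).ne]

end V

section Potential

/-- `φ` is the potential: `χ(0) = exp(-φ)`. -/
def IsPotential (φ : X.Y.Fun) : Prop :=
  ∀ T ∈ X.Y.carrier, X.Y.val (X.wave (.zero 0)) T = Complex.exp (-X.Y.val φ T)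

variable {X} {φ : X.Y.Fun} (hφ : X.IsPotential φ)

include hφ

theorem IsPotential.d_zero (n : I) :
    X.Y.d n (X.wave (.zero 0)) = -(X.Y.d n φ * X.wave (.zero 0)) := by
  refine FlowDomain.Fun.ext_val fun T hT => ?_
  rw [FlowDomain.val_d n _ hT, FlowDomain.pd_congr (fun S hS => hφ S hS) hT, FlowDomain.val_neg,
    FlowDomain.val_mul, FlowDomain.val_d n _ hT, hφ T hT]
  have h := ((X.Y.hol_val φ).hasDerivAt hT n).fun_neg.cexp
  rw [zero_smul, add_zero] at h
  refine h.deriv.trans ?_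
  ring

theorem IsPotential.isUnit : IsUnit (X.wave (.zero 0)) := by
  have h : X.Y.Hol fun T => Complex.exp (X.Y.val φ T) := fun T k i =>
    (X.Y.hol_val φ T k i).cexp
  refine IsUnit.of_mul_eq_one h.toFun (FlowDomain.Fun.ext_val fun T hT => ?_)
  rw [FlowDomain.val_mul, FlowDomain.Hol.val_toFun _ hT, hφ T hT, ← Complex.exp_add,
    FlowDomain.val_one hT, neg_add_cancel, Complex.exp_zero]

variable {u v : I} {b : ℂ} (hu : X.S u = Finsupp.single 1 1)
  (hv : X.S v = Finsupp.single (-1) b)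

include hv

theorem IsPotential.cov_v_iterate_zero_succ (hb : b = 1) (k : ℕ) :
    (X.cov v)^[k] X.wave (.zero (-k + 1))
      = X.wave (.zero 1) - (k : X.Y.Fun) * (X.Y.d v φ * X.wave (.zero 0)) := by
  subst hb
  induction k with
  | zero => simp
  | succ k ih =>
    rw [Function.iterate_succ_apply', X.cov_zero hv,
      show (-((k + 1 : ℕ) : ℤ) + 1) = -(k : ℤ) by push_cast; ring, X.cov_v_iterate_zero_self hv,
      sub_neg_eq_add, ih, one_pow, one_smul, one_smul, hφ.d_zero]
    push_cast
    ring

/-- The time whose symbol is `λ ^ (-N)` acts on the wave function as a differential operator of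
order `N` in `v` without a term of order zero. -/
theorem IsPotential.exists_flow_v (hb : b = 1) {n : I} {N : ℕ} (hN : 2 ≤ N)
    (hn : X.S n = Finsupp.single (-(N : ℤ)) 1) :
    ∃ c : ℕ → X.Y.Fun, X.cov n X.wave - (X.cov v)^[N] X.wave
        - ((N : X.Y.Fun) * X.Y.d v φ) • (X.cov v)^[N - 1] X.wave
      = ∑ k ∈ Finset.range (N - 2), c k • (X.cov v)^[k + 1] X.wave := by
  have hb1 := hb
  subst hb
  refine X.exists_eq_sum_cov_v hv one_ne_zero hφ.isUnit _
    (sub_mem (sub_mem (cov_mem_waves X.wave_mem_waves n)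
      (cov_iterate_mem_waves X.wave_mem_waves v N))
      (X.waves.smul_mem _ (cov_iterate_mem_waves X.wave_mem_waves v (N - 1))))
    (fun j hj => ?_) (fun j hj => ?_)
  · rw [Pi.sub_apply, Pi.sub_apply, Pi.smul_apply, X.cov_infty hn, X.d_wave_infty hj,
      X.wave_infty_pos (by omega), X.cov_v_iterate_infty_nonneg hv (by omega) hj,
      X.cov_v_iterate_infty_nonneg hv (by omega) hj]
    simp
  · rw [Pi.sub_apply, Pi.sub_apply, Pi.smul_apply, X.cov_zero hn, X.wave_zero_neg (by omega),
      map_zero, zero_add, one_smul, sub_neg_eq_add]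
    obtain ⟨N, rfl⟩ := Nat.exists_eq_add_of_le' hN
    rcases (show j ≤ -((N + 1 : ℕ) : ℤ) by omega).eq_or_lt with rfl | hj
    · have h1 := hφ.cov_v_iterate_zero_succ hv hb1 (N + 2)
      rw [show (-((N + 2 : ℕ) : ℤ) + 1) = -((N + 1 : ℕ) : ℤ) by push_cast; ring] at h1
      rw [h1, show N + 2 - 1 = N + 1 from rfl, X.cov_v_iterate_zero_self hv, one_pow, one_smul,
        show (-((N + 1 : ℕ) : ℤ) + ((N + 2 : ℕ) : ℤ)) = 1 by push_cast; ring, smul_eq_mul]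
      ring
    · rw [show N + 2 - 1 = N + 1 from rfl, X.cov_v_iterate_zero_of_lt hv (N + 1) hj]
      rcases (show j ≤ -((N + 2 : ℕ) : ℤ) by omega).eq_or_lt with rfl | hj
      · rw [X.cov_v_iterate_zero_self hv]
        simp
      · rw [X.cov_v_iterate_zero_of_lt hv (N + 2) hj, X.wave_zero_neg (by omega)]
        simp

include hu

/-- The equation `L ψ = 0`: its left-hand side is a wave function without polynomial part. -/
theorem IsPotential.schr_eq :
    X.cov v (X.cov u X.wave) + X.Y.d u φ • X.cov v X.wave
      - (X.Y.d v (X.moment 0) + algebraMap ℂ X.Y.Fun b) • X.wave = 0 := by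
  refine eq_zero_of_mem_waves (X := X.toDressedDomain)
    (sub_mem (add_mem (cov_mem_waves (cov_mem_waves X.wave_mem_waves u) v)
      (X.waves.smul_mem _ (cov_mem_waves X.wave_mem_waves v)))
      (X.waves.smul_mem _ X.wave_mem_waves)) (fun j hj => ?_) (fun j hj => ?_)
  · simp only [Pi.sub_apply, Pi.add_apply, Pi.smul_apply, X.cov_infty hu, X.cov_infty hv,
      sub_neg_eq_add, X.d_wave_infty hj, X.wave_infty_pos (show 0 < j + 1 by omega), map_zero,
      add_sub_cancel_right]
    rcases hj.eq_or_lt with rfl | hj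
    · rw [X.wave_infty_zero, X.wave_infty_neg (j := 0 - 1) (by norm_num)]
      simp [Algebra.algebraMap_eq_smul_one]
    · rcases (show 1 ≤ j by omega).eq_or_lt with rfl | hj1
      · simp [X.wave_infty_zero, X.wave_infty_pos (show (0 : ℤ) < 1 by omega)]
      · simp [X.wave_infty_pos hj, X.wave_infty_pos (show 0 < j - 1 by omega)]
  · simp only [Pi.sub_apply, Pi.add_apply, Pi.smul_apply, X.cov_zero hu, X.cov_zero hv,
      sub_neg_eq_add, X.wave_zero_neg hj, add_sub_cancel_right, map_zero,
      X.wave_zero_neg (show j - 1 < 0 by omega)]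
    rcases (show j ≤ -1 by omega).eq_or_lt with rfl | hj1
    · simp only [neg_add_cancel, hφ.d_zero]
      simp
    · simp [X.wave_zero_neg (show j + 1 < 0 by omega)]

end Potential

end SolvedDomain

/-! ### The (2+1)D Kaup-Broer system -/

/-- The (2+1)D Kaup-Broer equations in a ring with three commuting derivations. The hypotheses on the
coefficients `m`, `n` of `λ⁻¹`, `λ⁻²` at `λ = ∞` and on the coefficient `w` of `λ` at `λ = 0` are the
two linear equations for the wave function in the lowest orders. -/
theorem kb21_of_coefficients {A : Type*} [CommRing A] [Algebra ℂ A] (u v t : Derivation ℂ A A)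
    (huv : ∀ x, u (v x) = v (u x)) (hut : ∀ x, u (t x) = t (u x)) (hvt : ∀ x, v (t x) = t (v x))
    (a α β : ℂ) (φ η P m n w : A)
    (hη : η + η = -(v m + v m) - v (u φ))
    (hP : P = -t φ - α • (u φ * u φ) + β • (v φ * v φ))
    (hPw : P = -(α • u (u φ)) - β • v (v φ) + (2 * a * β) • v w - (2 * α) • u m)
    (hw : a • u w = v m + v (u φ))
    (hn : v (u m) + v n + u φ * (v m + algebraMap ℂ A a) - m * v m = 0)
    (hm : t m = α • (u (u m) + (2 : ℂ) • u n - (2 : ℂ) • (m * u m)) + β • v (v m)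
      + (2 * β) • (v φ * (v m + algebraMap ℂ A a))) :
    v (u P) = (2 * α) • u (u η) - (2 * β) • v (v η) ∧
    t η + t η + (4 * α) • u (u φ * η) - (4 * β) • v (v φ * η) - (4 * a * α) • u (u φ)
      + (4 * a * β) • v (v φ) + α • v (u (u (u φ))) - β • v (v (v (u φ))) = 0 := by
  have huu := congrArg (fun x => u (u x)) hη
  have hvv := congrArg (fun x => v (v x)) hη
  have hu := congrArg u hη
  have hv := congrArg v hη
  have ht := congrArg t hη
  have hPw' := congrArg (fun x => v (u x)) hPw
  have hP' := congrArg (fun x => v (u x)) hP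
  have hw' := congrArg (fun x => v (v x)) hw
  have hn' := congrArg u hn
  have hm' := congrArg v hm
  simp only [map_add, map_sub, map_neg, Derivation.map_smul, Derivation.leibniz, smul_eq_mul,
    Derivation.map_algebraMap, huv, hut, hvt, map_zero, add_zero]
    at huu hvv hu hv ht hPw' hP' hw' hn' hm'
  have h3 : v (u P) = (2 * α) • u (u η) - (2 * β) • v (v η) := by
    simp only [Algebra.smul_def, map_mul, map_ofNat] at *
    linear_combination hPw' + 2 * algebraMap ℂ A β * hw' - algebraMap ℂ A α * huu
      + algebraMap ℂ A β * hvv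
  refine ⟨h3, ?_⟩
  simp only [Derivation.leibniz, smul_eq_mul]
  simp only [Algebra.smul_def, map_mul, map_ofNat, huv] at *
  linear_combination ht - 2 * hm' - 4 * algebraMap ℂ A α * hn' - hP' + h3
    + algebraMap ℂ A α * (2 * u φ * hu + 2 * u (u φ) * hη + huu)
    - algebraMap ℂ A β * (2 * v φ * hv + 2 * v (v φ) * hη + hvv)

namespace SolvedDomain

open DressedDomain

variable {V I : Type*} [AddCommGroup V] [Module ℂ V] {X : SolvedDomain V I} {φ : X.Y.Fun}
  (hφ : X.IsPotential φ) {u v t : I} {a α β : ℂ} (hu : X.S u = Finsupp.single 1 1)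
  (hv : X.S v = Finsupp.single (-1) a)
  (ht : X.S t = Finsupp.single 2 α + Finsupp.single (-2) (a ^ 2 * β))

theorem cov_infty_of_add {s : I} {i i' : ℤ} {x x' : ℂ}
    (hs : X.S s = Finsupp.single i x + Finsupp.single i' x') (W : Mod X.Y X.D.Pt) (j : ℤ) :
    X.cov s W (.infty j)
      = X.Y.d s (W (.infty j)) + (x • W (.infty (j - i)) + x' • W (.infty (j - i'))) := by
  rw [DressedDomain.cov, cov_apply, hs, symb_add, symb_single, symb_single]
  rfl

theorem cov_zero_of_add {s : I} {i i' : ℤ} {x x' : ℂ}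
    (hs : X.S s = Finsupp.single i x + Finsupp.single i' x') (W : Mod X.Y X.D.Pt) (j : ℤ) :
    X.cov s W (.zero j)
      = X.Y.d s (W (.zero j)) + (x • W (.zero (j - i)) + x' • W (.zero (j - i'))) := by
  rw [DressedDomain.cov, cov_apply, hs, symb_add, symb_single, symb_single]
  rfl

include hφ hu hv ht

/-- The evolution in `t` of the wave function. The other terms cancel the polynomial part
of the derivative in `t`. -/
theorem IsPotential.evolution_eq :
    X.cov t X.wave - α • X.cov u (X.cov u X.wave) - β • X.cov v (X.cov v X.wave)
      - ((2 * β) • X.Y.d v φ) • X.cov v X.wave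
      + ((2 * α) • X.Y.d u (X.moment 0)) • X.wave = 0 := by
  have hw := X.wave_mem_waves
  have hsmul : ∀ (c : ℂ) {W : Mod X.Y X.D.Pt}, W ∈ X.waves → c • W ∈ X.waves := fun c W hW => by
    rw [← algebraMap_smul X.Y.Fun c W]
    exact X.waves.smul_mem _ hW
  refine eq_zero_of_mem_waves (X := X.toDressedDomain)
    (add_mem (sub_mem (sub_mem (sub_mem (cov_mem_waves hw t)
      (hsmul α (cov_mem_waves (cov_mem_waves hw u) u)))
      (hsmul β (cov_mem_waves (cov_mem_waves hw v) v)))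
      (X.waves.smul_mem _ (cov_mem_waves hw v))) (X.waves.smul_mem _ hw))
    (fun j hj => ?_) (fun j hj => ?_)
  · simp only [Pi.sub_apply, Pi.add_apply, Pi.smul_apply, X.cov_infty hu, X.cov_infty hv,
      cov_infty_of_add ht, sub_neg_eq_add, X.d_wave_infty hj,
      X.wave_infty_pos (show 0 < j + 1 by omega),
      X.wave_infty_pos (show 0 < j + 1 + 1 by omega), X.wave_infty_pos (show 0 < j + 2 by omega),
      map_zero, smul_zero, map_add, one_smul, sub_sub, one_add_one_eq_two]
    rcases hj.eq_or_lt with rfl | hj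
    · rw [X.wave_infty_zero, X.wave_infty_neg (j := 0 - 1) (by norm_num)]
      simp [mul_smul, two_smul, smul_add]
      abel
    · rw [X.d_wave_infty (show 0 ≤ j - 1 by omega), X.wave_infty_pos hj]
      simp
  · simp only [Pi.sub_apply, Pi.add_apply, Pi.smul_apply, X.cov_zero hu, X.cov_zero hv,
      cov_zero_of_add ht, sub_neg_eq_add, X.wave_zero_neg hj,
      X.wave_zero_neg (show j - 1 < 0 by omega), X.wave_zero_neg (show j - 2 < 0 by omega),
      X.wave_zero_neg (show j - 1 - 1 < 0 by omega), map_zero, smul_zero, add_zero, zero_add]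
    rcases (show j ≤ -1 by omega).eq_or_lt with rfl | hj1
    · norm_num
      rw [hφ.d_zero]
      simp only [Algebra.smul_def, map_mul, map_pow, map_ofNat]
      ring
    · rcases (show j ≤ -2 by omega).eq_or_lt with rfl | hj2
      · norm_num
        simp only [X.wave_zero_neg (show (-1 : ℤ) < 0 by omega), map_zero, smul_zero, mul_zero]
        simp only [Algebra.smul_def, map_mul, map_pow]
        ring
      · simp [X.wave_zero_neg (show j + 1 < 0 by omega), X.wave_zero_neg (show j + 2 < 0 by omega),
          X.wave_zero_neg (show j + 1 + 1 < 0 by omega)]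

/-- The (2+1)D Kaup-Broer system for a holomorphic dressed family. -/
theorem IsPotential.kb21 {η : X.Y.Fun}
    (hη : η + η = -(X.Y.d v (X.moment 0) + X.Y.d v (X.moment 0)) - X.Y.d v (X.Y.d u φ)) {P : X.Y.Fun}
    (hP : P = -X.Y.d t φ - α • (X.Y.d u φ * X.Y.d u φ) + β • (X.Y.d v φ * X.Y.d v φ)) :
    X.Y.d v (X.Y.d u P) = (2 * α) • X.Y.d u (X.Y.d u η) - (2 * β) • X.Y.d v (X.Y.d v η) ∧
    X.Y.d t η + X.Y.d t η + (4 * α) • X.Y.d u (X.Y.d u φ * η) - (4 * β) • X.Y.d v (X.Y.d v φ * η)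
      - (4 * a * α) • X.Y.d u (X.Y.d u φ) + (4 * a * β) • X.Y.d v (X.Y.d v φ)
      + α • X.Y.d v (X.Y.d u (X.Y.d u (X.Y.d u φ)))
      - β • X.Y.d v (X.Y.d v (X.Y.d v (X.Y.d u φ))) = 0 := by
  obtain ⟨e, he⟩ := hφ.isUnit.exists_left_inv
  obtain ⟨w, hw⟩ : ∃ w, X.wave (.zero 1) = X.wave (.zero 0) * w :=
    ⟨e * X.wave (.zero 1), by rw [← mul_assoc, mul_comm (X.wave (.zero 0)), he, one_mul]⟩
  have hS := hφ.schr_eq hu hv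
  have hE := hφ.evolution_eq hu hv ht
  have hSz := congrArg (fun x => e * x) (congrFun hS (.zero 0))
  have hEz := congrArg (fun x => e * x) (congrFun hE (.zero 0))
  have hSi := congrFun hS (.infty (-1))
  have hEi := congrFun hE (.infty (-1))
  simp only [Pi.sub_apply, Pi.add_apply, Pi.smul_apply, Pi.zero_apply, X.cov_zero hu,
    X.cov_zero hv, cov_zero_of_add ht] at hSz hEz
  simp only [Pi.sub_apply, Pi.add_apply, Pi.smul_apply, Pi.zero_apply, X.cov_infty hu,
    X.cov_infty hv, cov_infty_of_add ht] at hSi hEi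
  have hi1 : X.wave (.infty (-1)) = X.moment 0 := X.wave_infty_neg (by norm_num)
  have hi2 : X.wave (.infty (-2)) = X.moment 1 := X.wave_infty_neg (by norm_num)
  norm_num [X.wave_zero_neg, X.wave_infty_zero, X.wave_infty_pos, hφ.d_zero, hw, hi1, hi2, -map_mul]
    at hSz hEz hSi hEi
  simp only [Algebra.smul_def, map_mul, map_pow, map_ofNat] at hSz hEz hSi hEi
  refine kb21_of_coefficients (X.Y.d u) (X.Y.d v) (X.Y.d t) (FlowDomain.d_comm _ _)
    (FlowDomain.d_comm _ _) (FlowDomain.d_comm _ _) a α β φ η P (X.moment 0) (X.moment 1)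
    w hη hP ?_ ?_ ?_ ?_
  · simp only [Algebra.smul_def, map_mul, map_ofNat] at hP ⊢
    linear_combination hP + hEz - (-X.Y.d t φ
      + algebraMap ℂ X.Y.Fun α * (X.Y.d u (X.Y.d u φ) - X.Y.d u φ ^ 2 + 2 * X.Y.d u (X.moment 0))
      + algebraMap ℂ X.Y.Fun β * (X.Y.d v (X.Y.d v φ) + X.Y.d v φ ^ 2
        - 2 * algebraMap ℂ X.Y.Fun a * X.Y.d v w)) * he
  · simp only [Algebra.smul_def]
    linear_combination hSz - (algebraMap ℂ X.Y.Fun a * X.Y.d u w - X.Y.d v (X.moment 0)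
      - X.Y.d v (X.Y.d u φ)) * he
  · linear_combination hSi
  · simp only [Algebra.smul_def, map_mul, map_ofNat]
    linear_combination hEi

end SolvedDomain

/-! ### Operators that annihilate the kernel of `L` -/

section DifferentialModule

variable {A N : Type*} [CommRing A] [AddCommGroup N] [Module A N] {u v : A → A} {U V : N →+ N}
  (hU : ∀ (x : A) (y : N), U (x • y) = u x • y + x • U y)
  (hV : ∀ (x : A) (y : N), V (x • y) = v x • y + x • V y)

/-- The iterates of `U` (nonnegative indices) and of `V` (negative indices) on an element. -/
def derivs (U V : N →+ N) (y : N) (k : ℤ) : N :=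
  if 0 ≤ k then U^[k.toNat] y else V^[(-k).toNat] y

theorem derivs_natCast (U V : N →+ N) (y : N) (k : ℕ) : derivs U V y k = U^[k] y := by
  simp [derivs]

theorem derivs_neg_natCast (U V : N →+ N) (y : N) (k : ℕ) : derivs U V y (-k) = V^[k] y := by
  rcases Nat.eq_zero_or_pos k with rfl | hk
  · simp [derivs]
  · rw [derivs, if_neg (by omega)]
    simp

include hU in
theorem mem_span_of_leibniz {s : Set N} {S : Submodule A N} (hs : ∀ y ∈ s, y ∈ S ∧ U y ∈ S) {y : N}
    (hy : y ∈ Submodule.span A s) : U y ∈ S := by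
  have hsS : Submodule.span A s ≤ S := Submodule.span_le.2 fun y hy => (hs y hy).1
  induction hy using Submodule.span_induction with
  | mem y hy => exact (hs y hy).2
  | zero => rw [map_zero]; exact S.zero_mem
  | add y z _ _ h h' => rw [map_add]; exact S.add_mem h h'
  | smul x y hy h =>
    rw [hU]
    exact S.add_mem (S.smul_mem _ (hsS hy)) (S.smul_mem _ h)

variable {y : N}

theorem iterate_mem_span_left (k : ℕ) :
    U^[k] y ∈ Submodule.span A (Set.range (derivs U V y)) :=
  Submodule.subset_span ⟨k, derivs_natCast U V y k⟩

theorem iterate_mem_span_right (k : ℕ) :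
    V^[k] y ∈ Submodule.span A (Set.range (derivs U V y)) :=
  Submodule.subset_span ⟨-k, derivs_neg_natCast U V y k⟩

variable (hUV : ∀ z, U (V z) = V (U z)) {p q : A} (hy : V (U y) = p • V y + q • y)

include hU hV hUV hy

/-- If `V U y` is a combination of `V y` and `y`, then so are all mixed derivatives of `y` of its
pure derivatives. -/
theorem span_derivs_closed {z : N} (hz : z ∈ Submodule.span A (Set.range (derivs U V y))) :
    U z ∈ Submodule.span A (Set.range (derivs U V y)) ∧
      V z ∈ Submodule.span A (Set.range (derivs U V y)) := by
  have hcommU : ∀ k, U (V^[k] y) = V^[k] (U y) := fun k =>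
    Function.Commute.iterate_right (f := U) (g := V) hUV k y
  -- the powers of one operator span a module that is closed under it
  have key : ∀ {B : N →+ N} {b : A → A} (hB : ∀ (x : A) (y : N), B (x • y) = b x • y + x • B y)
      {z : N}, z ∈ Submodule.span A (Set.range fun k : ℕ => B^[k] y) → ∀ k : ℕ,
      B^[k] z ∈ Submodule.span A (Set.range fun k : ℕ => B^[k] y) := by
    intro B b hB z hz k
    induction k with
    | zero => exact hz
    | succ k ih =>
      rw [Function.iterate_succ_apply']
      refine mem_span_of_leibniz hB ?_ ih
      rintro _ ⟨j, rfl⟩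
      refine ⟨Submodule.subset_span ⟨j, rfl⟩, Submodule.subset_span ⟨j + 1, ?_⟩⟩
      exact Function.iterate_succ_apply' _ _ _
  have hleU : Submodule.span A (Set.range fun k : ℕ => U^[k] y)
      ≤ Submodule.span A (Set.range (derivs U V y)) := by
    rw [Submodule.span_le]
    rintro _ ⟨k, rfl⟩
    exact iterate_mem_span_left k
  have hleV : Submodule.span A (Set.range fun k : ℕ => V^[k] y)
      ≤ Submodule.span A (Set.range (derivs U V y)) := by
    rw [Submodule.span_le]
    rintro _ ⟨k, rfl⟩
    exact iterate_mem_span_right k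
  have hVU : V (U y) ∈ Submodule.span A (Set.range fun k : ℕ => V^[k] y) := by
    rw [hy]
    exact add_mem (Submodule.smul_mem _ _ (Submodule.subset_span ⟨1, rfl⟩))
      (Submodule.smul_mem _ _ (Submodule.subset_span ⟨0, rfl⟩))
  have hUVk : ∀ k, U (V^[k] y) ∈ Submodule.span A (Set.range (derivs U V y)) := by
    intro k
    rcases k with _ | k
    · exact iterate_mem_span_left 1
    · rw [hcommU, Function.iterate_succ_apply]
      exact hleV (key hV hVU k)
  have hclosedU : ∀ z ∈ Submodule.span A (Set.range (derivs U V y)),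
      U z ∈ Submodule.span A (Set.range (derivs U V y)) := fun z hz => by
    refine mem_span_of_leibniz hU ?_ hz
    rintro _ ⟨k, rfl⟩
    refine ⟨Submodule.subset_span ⟨k, rfl⟩, ?_⟩
    unfold derivs
    split_ifs
    · rw [← Function.iterate_succ_apply' U]
      exact iterate_mem_span_left _
    · exact hUVk _
  have hVUk : ∀ k, V (U^[k] y) ∈ Submodule.span A (Set.range (derivs U V y)) := by
    intro k
    induction k with
    | zero => exact iterate_mem_span_right 1
    | succ k ih =>
      rw [Function.iterate_succ_apply', ← hUV]
      exact hclosedU _ ih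
  refine ⟨hclosedU z hz, mem_span_of_leibniz hV ?_ hz⟩
  rintro _ ⟨k, rfl⟩
  refine ⟨Submodule.subset_span ⟨k, rfl⟩, ?_⟩
  unfold derivs
  split_ifs
  · exact hVUk _
  · rw [← Function.iterate_succ_apply' V]
    exact iterate_mem_span_right _

omit hU hV hUV hy in
/-- The kernel of a projection on the span of the pure derivatives is trivial if their images are
linearly independent. -/
theorem eq_zero_of_mem_span_derivs {N' : Type*} [AddCommGroup N'] [Module A N'] (f : N →ₗ[A] N')
    (hf : LinearIndependent A fun k => f (derivs U V y k)) {z : N}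
    (hz : z ∈ Submodule.span A (Set.range (derivs U V y))) (h0 : f z = 0) : z = 0 := by
  obtain ⟨c, rfl⟩ := Finsupp.mem_span_range_iff_exists_finsupp.1 hz
  have hc : c = 0 := by
    refine linearIndependent_iff.1 hf c ?_
    rw [Finsupp.linearCombination_apply, ← h0, map_finsuppSum]
    simp only [map_smul]
  rw [hc, Finsupp.sum_zero_index]

end DifferentialModule

/-- Differential operators that annihilate an element `y₁` annihilate each element `y₂` that satisfies
the same relation, if the pure derivatives of `y₁` are linearly independent: there is a module of
pairs, closed under the derivations, in which the first component determines the second. -/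
theorem exists_submodule_pairs {A N₁ N₂ : Type*} [CommRing A] [AddCommGroup N₁] [Module A N₁]
    [AddCommGroup N₂] [Module A N₂] {u v : A → A} {U₁ V₁ : N₁ →+ N₁} {U₂ V₂ : N₂ →+ N₂}
    (hU₁ : ∀ (x : A) (y : N₁), U₁ (x • y) = u x • y + x • U₁ y)
    (hV₁ : ∀ (x : A) (y : N₁), V₁ (x • y) = v x • y + x • V₁ y)
    (hU₂ : ∀ (x : A) (y : N₂), U₂ (x • y) = u x • y + x • U₂ y)
    (hV₂ : ∀ (x : A) (y : N₂), V₂ (x • y) = v x • y + x • V₂ y)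
    (h₁ : ∀ z, U₁ (V₁ z) = V₁ (U₁ z)) (h₂ : ∀ z, U₂ (V₂ z) = V₂ (U₂ z)) {p q : A} {y₁ : N₁} {y₂ : N₂}
    (hy₁ : V₁ (U₁ y₁) = p • V₁ y₁ + q • y₁) (hy₂ : V₂ (U₂ y₂) = p • V₂ y₂ + q • y₂)
    (hli : LinearIndependent A (derivs U₁ V₁ y₁)) :
    ∃ S : Submodule A (N₁ × N₂), (y₁, y₂) ∈ S ∧ (∀ z ∈ S, (U₁ z.1, U₂ z.2) ∈ S) ∧
      (∀ z ∈ S, (V₁ z.1, V₂ z.2) ∈ S) ∧ ∀ z ∈ S, z.1 = 0 → z.2 = 0 := by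
  let U := U₁.prodMap U₂
  let V := V₁.prodMap V₂
  have hU : ∀ (x : A) (y : N₁ × N₂), U (x • y) = u x • y + x • U y := fun x y =>
    Prod.ext (hU₁ x y.1) (hU₂ x y.2)
  have hV : ∀ (x : A) (y : N₁ × N₂), V (x • y) = v x • y + x • V y := fun x y =>
    Prod.ext (hV₁ x y.1) (hV₂ x y.2)
  have hUV : ∀ z, U (V z) = V (U z) := fun z => Prod.ext (h₁ z.1) (h₂ z.2)
  have hy : V (U (y₁, y₂)) = p • V (y₁, y₂) + q • (y₁, y₂) := Prod.ext hy₁ hy₂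
  have hfst : ∀ k, (derivs U V (y₁, y₂) k).1 = derivs U₁ V₁ y₁ k := by
    have h1 : ∀ k : ℕ, (U^[k] (y₁, y₂)).1 = U₁^[k] y₁ := fun k => by
      induction k with
      | zero => rfl
      | succ k ih => rw [Function.iterate_succ_apply', Function.iterate_succ_apply', ← ih]; rfl
    have h2 : ∀ k : ℕ, (V^[k] (y₁, y₂)).1 = V₁^[k] y₁ := fun k => by
      induction k with
      | zero => rfl
      | succ k ih => rw [Function.iterate_succ_apply', Function.iterate_succ_apply', ← ih]; rfl
    intro k
    unfold derivs
    split_ifs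
    · exact h1 _
    · exact h2 _
  have hli' : LinearIndependent A fun k => LinearMap.fst A N₁ N₂ (derivs U V (y₁, y₂) k) := by
    simpa only [LinearMap.fst_apply, hfst] using hli
  refine ⟨Submodule.span A (Set.range (derivs U V (y₁, y₂))), iterate_mem_span_left 0,
    fun z hz => (span_derivs_closed hU hV hUV hy hz).1,
    fun z hz => (span_derivs_closed hU hV hUV hy hz).2, fun z hz h0 => ?_⟩
  rw [eq_zero_of_mem_span_derivs (LinearMap.fst A N₁ N₂) hli' hz h0]
  rfl

namespace SolvedDomain

open DressedDomain

variable {V I : Type*} [AddCommGroup V] [Module ℂ V] {X : SolvedDomain V I} {φ : X.Y.Fun}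
  (hφ : X.IsPotential φ) {u v : I} {b : ℂ} (hb : b ≠ 0) (hu : X.S u = Finsupp.single 1 1)
  (hv : X.S v = Finsupp.single (-1) b)

include hφ hb hu hv

/-- The pure derivatives of the wave function are linearly independent, as they have poles of
different orders at `λ = ∞` or at `λ = 0`. -/
theorem IsPotential.linearIndependent_derivs :
    LinearIndependent X.Y.Fun (derivs (X.cov u) (X.cov v) X.wave) := by
  rw [linearIndependent_iff]
  intro c hc
  rw [Finsupp.linearCombination_apply, Finsupp.sum] at hc
  by_contra hc0
  have hne : c.support.Nonempty := Finsupp.support_nonempty_iff.2 hc0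
  obtain ⟨K, hK, hmax⟩ := c.support.exists_max_image id hne
  obtain ⟨L, hL, hmin⟩ := c.support.exists_min_image id hne
  rcases le_or_gt 0 K with h0 | h0
  · -- the pole of the highest order at `λ = ∞`
    obtain ⟨k, rfl⟩ := Int.eq_ofNat_of_zero_le h0
    have h := congrFun hc (.infty k)
    rw [Finset.sum_apply, Finset.sum_eq_single (k : ℤ)] at h
    · rw [Pi.smul_apply, derivs_natCast, X.cov_u_iterate_infty_self hu, smul_eq_mul, mul_one] at h
      exact Finsupp.mem_support_iff.1 hK h
    · intro j hj hjk
      have hjk' : j < k := lt_of_le_of_ne (hmax j hj) hjk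
      rw [Pi.smul_apply]
      obtain ⟨n, rfl | rfl⟩ := j.eq_nat_or_neg
      · rw [derivs_natCast, X.cov_u_iterate_infty_of_gt hu n hjk', smul_zero]
      · rcases Nat.eq_zero_or_pos n with rfl | hn
        · rw [show -((0 : ℕ) : ℤ) = (0 : ℕ) by simp, derivs_natCast,
            X.cov_u_iterate_infty_of_gt hu 0 (by simpa using hjk'), smul_zero]
        · rw [derivs_neg_natCast, X.cov_v_iterate_infty_nonneg hv hn.ne' (by omega), smul_zero]
    · exact fun h' => absurd hK h'
  · -- the pole of the highest order at `λ = 0`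
    have hL0 : L < 0 := (hmin K hK).trans_lt h0
    obtain ⟨k, rfl⟩ : ∃ k : ℕ, L = -k := ⟨L.natAbs, by omega⟩
    have h := congrFun hc (.zero (-k))
    rw [Finset.sum_apply, Finset.sum_eq_single (-k : ℤ)] at h
    · rw [Pi.smul_apply, derivs_neg_natCast, X.cov_v_iterate_zero_self hv, smul_eq_mul,
        mul_smul_comm] at h
      have h' := (smul_eq_zero_iff_right (pow_ne_zero k hb)).1 h
      exact Finsupp.mem_support_iff.1 hL ((hφ.isUnit.mul_left_eq_zero).1 h')
    · intro j hj hjk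
      have hjk' : -(k : ℤ) < j := lt_of_le_of_ne (hmin j hj) (Ne.symm hjk)
      have hj0 : j < 0 := (hmax j hj).trans_lt h0
      obtain ⟨n, rfl⟩ : ∃ n : ℕ, j = -n := ⟨j.natAbs, by omega⟩
      rw [Pi.smul_apply, derivs_neg_natCast, X.cov_v_iterate_zero_of_lt hv n (by omega), smul_zero]
    · exact fun h' => absurd hL h'

end SolvedDomain

namespace FlowDomain

variable {V I J : Type*} [AddCommGroup V] [Module ℂ V]

/-- A part of a flow domain, with some of its directions. -/
structure Part (Y : FlowDomain V I) (J : Type*) where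
  σ : J → I
  set : Set V
  subset : set ⊆ Y.carrier
  isOpen_slice : ∀ (T : V) (k : ℕ) (i : Fin k → J),
    IsOpen {c : Fin k → ℂ | T + ∑ j, c j • Y.dir (σ (i j)) ∈ set}

/-- A part of a flow domain as a flow domain. -/
def Part.toDomain {Y : FlowDomain V I} (Z : Y.Part J) : FlowDomain V J where
  dir j := Y.dir (Z.σ j)
  carrier := Z.set
  isOpen_slice := Z.isOpen_slice

variable {Y : FlowDomain V I} (Z : Y.Part J)

theorem Hol.part {F : V → ℂ} (hF : Y.Hol F) : Z.toDomain.Hol F :=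
  fun T _ i => (hF T _ (Z.σ ∘ i)).mono fun _ hc => Z.subset hc

/-- Restriction of holomorphic functions to a part of a domain. -/
def Part.res : Y.Fun →+* Z.toDomain.Fun where
  toFun x := ((Y.hol_val x).part Z).toFun
  map_one' := Fun.ext_val fun T hT => by
    rw [Hol.val_toFun _ hT, val_one hT, val_one (Z.subset hT)]
  map_zero' := Fun.ext_val fun T hT => by
    rw [Hol.val_toFun _ hT, val_zero, val_zero]
  map_mul' x y := Fun.ext_val fun T hT => by
    rw [Hol.val_toFun _ hT, val_mul, val_mul, Hol.val_toFun _ hT, Hol.val_toFun _ hT]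
  map_add' x y := Fun.ext_val fun T hT => by
    rw [Hol.val_toFun _ hT, val_add, val_add, Hol.val_toFun _ hT, Hol.val_toFun _ hT]

instance : Module Y.Fun Z.toDomain.Fun := Module.compHom _ Z.res

theorem Part.smul_def (x : Y.Fun) (y : Z.toDomain.Fun) : x • y = Z.res x * y := rfl

theorem Rep.res {F : V → ℂ} {x : Y.Fun} (h : Y.Rep F x) : Z.toDomain.Rep F (Z.res x) :=
  fun T hT => (h T (Z.subset hT)).trans (Hol.val_toFun ((Y.hol_val x).part Z) hT).symm

theorem Rep.part_smul {F G : V → ℂ} {x : Y.Fun} {y : Z.toDomain.Fun} (hF : Y.Rep F x)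
    (hG : Z.toDomain.Rep G y) : Z.toDomain.Rep (fun T => F T * G T) (x • y) :=
  (hF.res Z).mul hG

theorem Part.d_res (j : J) (x : Y.Fun) :
    Z.toDomain.d j (Z.res x) = Z.res (Y.d (Z.σ j) x) :=
  (((Y.rep_val x).res Z).pd j).unique (((Y.rep_val x).pd (Z.σ j)).res Z)

theorem Part.d_smul (j : J) (x : Y.Fun) (y : Z.toDomain.Fun) :
    Z.toDomain.d j (x • y) = Y.d (Z.σ j) x • y + x • Z.toDomain.d j y := by
  rw [Z.smul_def, Z.smul_def, Z.smul_def, Derivation.leibniz, Z.d_res, smul_eq_mul, smul_eq_mul]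
  ring

/-- A derivation of holomorphic functions as an additive map. -/
def dAdd (Y : FlowDomain V I) (n : I) : Y.Fun →+ Y.Fun :=
  ((Y.d n : Y.Fun →ₗ[ℂ] Y.Fun) : Y.Fun →+ Y.Fun)

end FlowDomain

/-! ### The Kaup-Broer hierarchy -/

namespace SolvedDomain

open DressedDomain

variable {V I : Type*} [AddCommGroup V] [Module ℂ V] {X : SolvedDomain V I} {φ : X.Y.Fun}
  (hφ : X.IsPotential φ) (Z : X.Y.Part Bool) {b : ℂ} (hb : b ≠ 0)
  (hu : X.S (Z.σ true) = Finsupp.single 1 1) (hv : X.S (Z.σ false) = Finsupp.single (-1) b)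

include hφ hb hu hv

/-- Differential operators in `∂_u`, `∂_v` that annihilate the wave function annihilate all
solutions `g` of `L g = 0`. -/
theorem IsPotential.exists_submodule_pairs {g : Z.toDomain.Fun}
    (hg : Z.toDomain.dAdd false (Z.toDomain.dAdd true g)
      + X.Y.d (Z.σ true) φ • Z.toDomain.dAdd false g
      - (X.Y.d (Z.σ false) (X.moment 0) + algebraMap ℂ X.Y.Fun b) • g = 0) :
    ∃ S : Submodule X.Y.Fun (Mod X.Y X.D.Pt × Z.toDomain.Fun), (X.wave, g) ∈ S ∧
      (∀ z ∈ S, (X.cov (Z.σ true) z.1, Z.toDomain.dAdd true z.2) ∈ S) ∧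
      (∀ z ∈ S, (X.cov (Z.σ false) z.1, Z.toDomain.dAdd false z.2) ∈ S) ∧
      ∀ z ∈ S, z.1 = 0 → z.2 = 0 := by
  refine KaupBroer.exists_submodule_pairs (u := X.Y.d (Z.σ true)) (v := X.Y.d (Z.σ false))
    (p := -X.Y.d (Z.σ true) φ)
    (q := X.Y.d (Z.σ false) (X.moment 0) + algebraMap ℂ X.Y.Fun b)
    (fun x y => cov_smul _ _ _ _ _) (fun x y => cov_smul _ _ _ _ _)
    (fun x y => Z.d_smul true x y) (fun x y => Z.d_smul false x y)
    (fun z => cov_comm _ _ _ _ _) (fun z => FlowDomain.d_comm _ _ _) ?_ ?_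
    (hφ.linearIndependent_derivs hb hu hv)
  · have := hφ.schr_eq hu hv
    rw [neg_smul, ← sub_eq_zero, ← this]
    abel
  · rw [neg_smul, ← sub_eq_zero, ← hg]
    abel

end SolvedDomain

section Operators

variable {A N : Type*} [CommRing A] [AddCommGroup N] [Module A N]

/-- The operator `a (V U + p V) + q`. -/
def schrOp (U V : N →+ N) (a p q : A) (y : N) : N := a • (V (U y) + p • V y) + q • y

/-- The operator `∑ cₖ Bᵏ`. -/
def sumOp (B : N →+ N) (c : ℕ → A) (K : ℕ) (y : N) : N := ∑ k ∈ Finset.range K, c k • B^[k] y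

variable {U V D : N →+ N} {d : A → A}

theorem apply_schrOp (hD : ∀ (x : A) (y : N), D (x • y) = d x • y + x • D y)
    (hU : ∀ z, D (U z) = U (D z)) (hV : ∀ z, D (V z) = V (D z)) {a : A} (ha : d a = 0) (p q : A)
    (y : N) : D (schrOp U V a p q y)
      = (a • (d p • V y) + d q • y) + schrOp U V a p q (D y) := by
  simp only [schrOp, map_add, hD, hU, hV, ha, zero_smul, zero_add, smul_add]
  abel

theorem apply_sumOp (hD : ∀ (x : A) (y : N), D (x • y) = d x • y + x • D y)
    {B : N →+ N} (hB : ∀ z, D (B z) = B (D z)) (c : ℕ → A) (K : ℕ) (y : N) :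
    D (sumOp B c K y) = sumOp B (fun k => d (c k)) K y + sumOp B c K (D y) := by
  simp only [sumOp, map_sum, hD, Finset.sum_add_distrib]
  congr 1
  refine Finset.sum_congr rfl fun k _ => ?_
  rw [show D (B^[k] y) = B^[k] (D y) from Function.Commute.iterate_right (f := D) (g := B) hB k y]

variable {N' : Type*} [AddCommGroup N'] [Module A N'] {U' V' B' : N' →+ N'} {S : Submodule A (N × N')}

theorem sumOp_mem {B : N →+ N} (hB : ∀ z ∈ S, (B z.1, B' z.2) ∈ S) (c : ℕ → A) (K : ℕ) {z : N × N'}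
    (hz : z ∈ S) : (sumOp B c K z.1, sumOp B' c K z.2) ∈ S := by
  have h : ∀ k : ℕ, (B^[k] z.1, B'^[k] z.2) ∈ S := fun k => by
    induction k with
    | zero => exact hz
    | succ k ih =>
      rw [Function.iterate_succ_apply', Function.iterate_succ_apply']
      exact hB _ ih
  have := S.sum_mem fun k (_ : k ∈ Finset.range K) => S.smul_mem (c k) (h k)
  convert this using 1
  refine Prod.ext ?_ ?_
  · simp [sumOp, Prod.fst_sum]
  · simp [sumOp, Prod.snd_sum]

theorem schrOp_mem (hU : ∀ z ∈ S, (U z.1, U' z.2) ∈ S) (hV : ∀ z ∈ S, (V z.1, V' z.2) ∈ S) (a p q : A)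
    {z : N × N'} (hz : z ∈ S) : (schrOp U V a p q z.1, schrOp U' V' a p q z.2) ∈ S :=
  S.add_mem (S.smul_mem a (S.add_mem (hV _ (hU _ hz)) (S.smul_mem p (hV _ hz)))) (S.smul_mem q hz)

end Operators

namespace SolvedDomain

open DressedDomain

variable {X : SolvedDomain Times FlowIdx} {φ' : X.Y.Fun} (hφ : X.IsPotential φ')
  (hS : ∀ n : FlowIdx, X.S n = Finsupp.single n.1 1)

include hφ hS

/-- The linear equation for each time, in terms of the operator that generates it. -/
theorem IsPotential.exists_flow (n : FlowIdx) : ∃ c : ℕ → X.Y.Fun, c n.1.natAbs = 1 ∧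
    (0 < n.1 → c (n.1.natAbs - 1) = 0) ∧ (n.1 < 0 → c 0 = 0) ∧
    (n.1 < -1 → c (n.1.natAbs - 1) = (n.1.natAbs : X.Y.Fun) * X.Y.d v₁ φ') ∧
    X.cov n X.wave = sumOp (X.cov (base n)) c (n.1.natAbs + 1) X.wave := by
  have hu : X.S u₁ = Finsupp.single 1 1 := hS u₁
  have hv : X.S v₁ = Finsupp.single (-1) 1 := hS v₁
  rcases lt_trichotomy n.1 0 with hn | hn | hn
  · have hbase : base n = v₁ := by simp [base, hn.le]
    rcases (show n.1 ≤ -1 by omega).eq_or_lt with h1 | h1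
    · obtain rfl : n = v₁ := Subtype.ext h1
      refine ⟨fun k => if k = 1 then 1 else 0, by simp [v₁], by simp [v₁], by simp, by simp [v₁], ?_⟩
      rw [hbase]
      simp [sumOp, v₁]
    · obtain ⟨M, hM⟩ : ∃ M : ℕ, n.1.natAbs = M + 2 := ⟨n.1.natAbs - 2, by omega⟩
      have hSn : X.S n = Finsupp.single (-((M + 2 : ℕ) : ℤ)) 1 := by
        rw [hS n]; congr 1; omega
      obtain ⟨c, hc⟩ := hφ.exists_flow_v hv rfl (by omega) hSn
      rw [hM, hbase]
      refine ⟨fun k => if k = M + 2 then 1 else if k = M + 1 then ((M + 2 : ℕ) : X.Y.Fun) * X.Y.d v₁ φ'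
        else if k = 0 then 0 else c (k - 1), by simp, fun h => by omega, by simp, by simp, ?_⟩
      have h : X.cov n X.wave = (∑ k ∈ Finset.range M, c k • (X.cov v₁)^[k + 1] X.wave)
          + (((M + 2 : ℕ) : X.Y.Fun) * X.Y.d v₁ φ') • (X.cov v₁)^[M + 1] X.wave
          + (X.cov v₁)^[M + 2] X.wave := by
        rw [show M + 2 - 2 = M from rfl, show M + 2 - 1 = M + 1 from rfl] at hc
        rw [← hc]
        abel
      rw [h, sumOp, Finset.sum_range_succ, Finset.sum_range_succ, Finset.sum_range_succ']
      congr 1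
      · congr 1
        · simp only [Nat.add_eq_zero_iff, one_ne_zero, and_false, if_false, if_true,
            Nat.add_sub_cancel]
          rw [if_neg (by omega), if_neg (by omega), zero_smul, add_zero]
          refine Finset.sum_congr rfl fun k hk => ?_
          have := Finset.mem_range.1 hk
          rw [if_neg (by omega), if_neg (by omega)]
        · simp
      · simp
  · exact absurd hn n.2
  · have hbase : base n = u₁ := by simp [base, hn]
    obtain ⟨M, hM⟩ : ∃ M : ℕ, n.1.natAbs = M + 1 := ⟨n.1.natAbs - 1, by omega⟩
    have hSn : X.S n = Finsupp.single ((M + 1 : ℕ) : ℤ) 1 := by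
      rw [hS n]; congr 1; omega
    obtain ⟨c, hc⟩ := X.exists_flow_u hu (by omega) hSn
    rw [hM, hbase]
    refine ⟨fun k => if k = M + 1 then 1 else if k = M then 0 else c k, by simp, by simp,
      fun h => by omega, fun h => by omega, ?_⟩
    have h : X.cov n X.wave = (∑ k ∈ Finset.range M, c k • (X.cov u₁)^[k] X.wave)
        + (X.cov u₁)^[M + 1] X.wave := by
      rw [show M + 1 - 1 = M from rfl] at hc
      rw [← hc]
      abel
    rw [h, sumOp, Finset.sum_range_succ, Finset.sum_range_succ]
    congr 1
    · rw [if_neg (by omega), if_pos rfl, zero_smul, add_zero]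
      refine Finset.sum_congr rfl fun k hk => ?_
      have := Finset.mem_range.1 hk
      rw [if_neg (by omega), if_neg (by omega)]
    · simp

end SolvedDomain

/-- The indices of the times `u₁` and `v₁`. -/
def baseIdx (j : Bool) : FlowIdx := cond j u₁ v₁

theorem base_eq (n : FlowIdx) : base n = baseIdx (decide (0 < n.1)) := by
  by_cases h : 0 < n.1 <;> simp [base, baseIdx, h]

/-- A slice through `T'` along `u₁` and `v₁` that meets the plane through `T` lies in this plane, with
coordinates that are holomorphic functions of the displacement. -/
theorem exists_plane_coordinates (T T' : Times) {k : ℕ} (i : Fin k → Bool) {c₀ : Fin k → ℂ}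
    {x₀ : ℂ × ℂ}
    (h : T' + ∑ j, c₀ j • flow (baseIdx (i j)) = T + x₀.1 • flow u₁ + x₀.2 • flow v₁) :
    ∃ x : (Fin k → ℂ) → ℂ × ℂ, Differentiable ℂ x ∧ x c₀ = x₀ ∧ ∀ c,
      T' + ∑ j, c j • flow (baseIdx (i j)) = T + (x c).1 • flow u₁ + (x c).2 • flow v₁ := by
  have hsum : ∀ d : Fin k → ℂ, ∑ j, d j • flow (baseIdx (i j))
      = (∑ j, cond (i j) (d j) 0) • flow u₁ + (∑ j, cond (i j) 0 (d j)) • flow v₁ := fun d => by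
    rw [Finset.sum_smul, Finset.sum_smul, ← Finset.sum_add_distrib]
    refine Finset.sum_congr rfl fun j _ => ?_
    cases h : i j <;> simp [baseIdx]
  refine ⟨fun c => (x₀.1 + ∑ j, cond (i j) (c j - c₀ j) 0, x₀.2 + ∑ j, cond (i j) 0 (c j - c₀ j)),
    ?_, ?_, fun c => ?_⟩
  · refine Differentiable.prodMk (Differentiable.const_add _ (Differentiable.fun_sum fun j _ => ?_))
      (Differentiable.const_add _ (Differentiable.fun_sum fun j _ => ?_))
    all_goals
      cases i j
      all_goals
        simp only [cond_true, cond_false]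
        fun_prop
  · simp
  · have h1 := hsum fun j => c j - c₀ j
    simp only [sub_smul, Finset.sum_sub_distrib] at h1
    simp only [add_smul]
    rw [sub_eq_iff_eq_add] at h1
    rw [h1, add_left_comm, h]
    simp only [sub_eq_add_neg]
    abel

namespace SolvedDomain

open DressedDomain

variable {X : SolvedDomain Times FlowIdx} (hdir : X.Y.dir = flow)

include hdir

theorem rep_dTime {F : Times → ℂ} {x : X.Y.Fun} (h : X.Y.Rep F x) (n : FlowIdx) :
    X.Y.Rep (dTime n F) (X.Y.d n x) := by
  have := h.pd n
  rwa [hdir] at this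

/-- A solution of `L g = 0` near a point of the plane of the times `u₁`, `v₁` lives on a part of the
domain. -/
theorem exists_part {a : ℂ} {φ η : Times → ℂ} {T : Times} {g : Times → ℂ} (hT : T ∈ X.Y.carrier)
    (hg : IsLocalKernel a φ η T g) : ∃ Z : X.Y.Part Bool, Z.σ = baseIdx ∧ T ∈ Z.set ∧
      Z.toDomain.Hol g ∧ ∀ S ∈ Z.set, schr a φ η g S = 0 := by
  obtain ⟨han, hker⟩ := hg
  have hmem : ∀ᶠ x : ℂ × ℂ in 𝓝 0, T + x.1 • flow u₁ + x.2 • flow v₁ ∈ X.Y.carrier := by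
    have hc : Continuous fun x : ℂ × ℂ => ![x.1, x.2] := by fun_prop
    have h := (X.Y.isOpen_sliceAt T ![u₁, v₁]).preimage hc
    have h0 : (0 : ℂ × ℂ) ∈ (fun x : ℂ × ℂ => ![x.1, x.2]) ⁻¹' X.Y.sliceAt T ![u₁, v₁] := by
      simp [FlowDomain.mem_sliceAt, FlowDomain.move, hT]
    filter_upwards [h.mem_nhds h0] with x hx
    simpa [FlowDomain.mem_sliceAt, FlowDomain.move, hdir, ← add_assoc] using hx
  obtain ⟨W, hW, hWo, h0⟩ := eventually_nhds_iff.1 (hmem.and (han.eventually_analyticAt.and hker))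
  refine ⟨⟨baseIdx, (fun x : ℂ × ℂ => T + x.1 • flow u₁ + x.2 • flow v₁) '' W, ?_, ?_⟩, rfl,
    ⟨0, h0, by simp⟩, ?_, ?_⟩
  · rintro _ ⟨x, hx, rfl⟩
    exact (hW x hx).1
  · intro T' k i
    rw [isOpen_iff_mem_nhds]
    rintro c₀ ⟨x₀, hx₀, h⟩
    rw [hdir] at h
    obtain ⟨x, hx, hxc, hT'⟩ := exists_plane_coordinates T T' i h.symm
    have := (hWo.preimage hx.continuous).mem_nhds (show c₀ ∈ x ⁻¹' W by rwa [Set.mem_preimage, hxc])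
    filter_upwards [this] with c hc
    refine ⟨x c, hc, ?_⟩
    rw [hdir]
    exact (hT' c).symm
  · rintro T' k i c₀ ⟨x₀, hx₀, h⟩
    simp only [FlowDomain.move, FlowDomain.Part.toDomain, hdir] at h
    obtain ⟨x, hx, hxc, hT'⟩ := exists_plane_coordinates T T' i h.symm
    simp only [FlowDomain.move, FlowDomain.Part.toDomain, hdir, hT']
    have h1 := (hW x₀ hx₀).2.1.differentiableAt
    rw [← hxc] at h1
    exact (h1.comp c₀ hx.differentiableAt).differentiableWithinAt
  · rintro _ ⟨x, hx, rfl⟩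
    exact (hW x hx).2.2

variable {φ' η' : X.Y.Fun} {a : ℂ} {φ η : Times → ℂ} (hφr : X.Y.Rep φ φ') (hηr : X.Y.Rep η η')

section Part

variable {Z : X.Y.Part Bool} (hσ : Z.σ = baseIdx) {G : Times → ℂ} {y : Z.toDomain.Fun}
  (hG : Z.toDomain.Rep G y)

include hσ

omit hdir in
theorem part_dir : Z.toDomain.dir = fun j => X.Y.dir (baseIdx j) := by
  rw [← hσ]; rfl

include hG

theorem rep_dTime_part (j : Bool) :
    Z.toDomain.Rep (dTime (baseIdx j) G) (Z.toDomain.dAdd j y) := by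
  have := hG.pd j
  rwa [part_dir hσ, hdir] at this

theorem rep_dTime_iterate_part (j : Bool) (k : ℕ) :
    Z.toDomain.Rep ((dTime (baseIdx j))^[k] G) ((Z.toDomain.dAdd j)^[k] y) := by
  induction k with
  | zero => exact hG
  | succ k ih =>
    rw [Function.iterate_succ_apply', Function.iterate_succ_apply']
    exact rep_dTime_part hdir hσ ih j

theorem rep_flowOp_part {c : FlowIdx → ℕ → Times → ℂ} {c' : FlowIdx → ℕ → X.Y.Fun}
    (hc : ∀ n k, X.Y.Rep (c n k) (c' n k)) (n : FlowIdx) :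
    Z.toDomain.Rep (flowOp c n G)
      (sumOp (Z.toDomain.dAdd (decide (0 < n.1))) (c' n) (n.1.natAbs + 1) y) := by
  intro T hT
  rw [flowOp, sumOp, FlowDomain.val_sum, base_eq]
  refine Finset.sum_congr rfl fun k _ => ?_
  exact (hc n k).part_smul Z (rep_dTime_iterate_part hdir hσ hG _ k) T hT

include hφr hηr

theorem rep_schr_part : Z.toDomain.Rep (schr a φ η G)
    (schrOp (Z.toDomain.dAdd true) (Z.toDomain.dAdd false) (algebraMap ℂ X.Y.Fun a) (X.Y.d u₁ φ')
      (η' + (a / 2) • X.Y.d v₁ (X.Y.d u₁ φ') - algebraMap ℂ X.Y.Fun a) y) := by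
  have ha : X.Y.Rep (fun _ => a) (algebraMap ℂ X.Y.Fun a) := fun T hT =>
    (FlowDomain.val_algebraMap a hT).symm
  have h1 := rep_dTime_part hdir hσ hG false
  have h2 := rep_dTime_part hdir hσ (rep_dTime_part hdir hσ hG true) false
  have h3 := rep_dTime hdir hφr u₁
  have h4 := ((hηr.add ((rep_dTime hdir h3 v₁).const_mul (a / 2))).sub ha)
  exact (ha.part_smul Z (h2.add (h3.part_smul Z h1))).add (h4.part_smul Z hG)

theorem rep_schrDot_part (n : FlowIdx) : Z.toDomain.Rep (schrDot a φ η n G)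
    (algebraMap ℂ X.Y.Fun a • (X.Y.d n (X.Y.d u₁ φ') • Z.toDomain.dAdd false y)
      + X.Y.d n (η' + (a / 2) • X.Y.d v₁ (X.Y.d u₁ φ') - algebraMap ℂ X.Y.Fun a) • y) := by
  have ha : X.Y.Rep (fun _ => a) (algebraMap ℂ X.Y.Fun a) := fun T hT =>
    (FlowDomain.val_algebraMap a hT).symm
  have h1 := rep_dTime_part hdir hσ hG false
  have h3 := rep_dTime hdir hφr u₁
  have h4 := (rep_dTime hdir hηr n).add ((rep_dTime hdir (rep_dTime hdir h3 v₁) n).const_mul (a / 2))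
  rw [map_sub, Derivation.map_algebraMap, sub_zero, map_add, Derivation.map_smul]
  exact (ha.part_smul Z ((rep_dTime hdir h3 n).part_smul Z h1)).add (h4.part_smul Z hG)

end Part

variable (hφ : X.IsPotential φ') (hS : ∀ n : FlowIdx, X.S n = Finsupp.single n.1 1)
  (hη' : η' = -(a • X.Y.d v₁ (X.moment 0)) - (a / 2) • X.Y.d v₁ (X.Y.d u₁ φ'))

omit hdir in
include hφ hS hη' in
/-- `L` annihilates the wave function. -/
theorem schrOp_wave : schrOp (X.cov u₁) (X.cov v₁) (algebraMap ℂ X.Y.Fun a) (X.Y.d u₁ φ')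
    (η' + (a / 2) • X.Y.d v₁ (X.Y.d u₁ φ') - algebraMap ℂ X.Y.Fun a) X.wave = 0 := by
  have h := hφ.schr_eq (hS u₁) (hS v₁)
  have h2 : η' + (a / 2) • X.Y.d v₁ (X.Y.d u₁ φ') - algebraMap ℂ X.Y.Fun a
      = algebraMap ℂ X.Y.Fun a * -(X.Y.d v₁ (X.moment 0) + algebraMap ℂ X.Y.Fun 1) := by
    rw [hη', map_one, Algebra.smul_def]
    ring
  rw [schrOp, h2, mul_smul, ← smul_add, neg_smul, ← sub_eq_add_neg, h, smul_zero]

end SolvedDomain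

namespace SolvedDomain

open DressedDomain

variable {X : SolvedDomain Times FlowIdx} (hdir : X.Y.dir = flow) {φ' η' : X.Y.Fun} {a : ℂ}
  {φ η : Times → ℂ} (hφr : X.Y.Rep φ φ') (hηr : X.Y.Rep η η') (hφ : X.IsPotential φ')
  (hS : ∀ n : FlowIdx, X.S n = Finsupp.single n.1 1)
  (hη' : η' = -(a • X.Y.d v₁ (X.moment 0)) - (a / 2) • X.Y.d v₁ (X.Y.d u₁ φ'))
  {c' : FlowIdx → ℕ → X.Y.Fun}
  (hc : ∀ n, X.cov n X.wave = sumOp (X.cov (base n)) (c' n) (n.1.natAbs + 1) X.wave)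

include hdir hφr hηr hφ hS hη' hc

/-- The expansions of the wave function at `λ = ∞` and at `λ = 0` are formal wave functions. -/
theorem isFormalWave {sl : ℤ → Slot X.D.Pt}
    (hsl : ∀ (n : FlowIdx) (M : Mod X.Y X.D.Pt) (j : ℤ),
      X.cov n M (sl j) = X.Y.d n (M (sl j)) + M (sl (j - n.1))) :
    IsFormalWave a X.Y.carrier φ η (fun n k => X.Y.val (c' n k))
      fun j => X.Y.val (X.wave (sl j)) := by
  have hcov : ∀ (n : FlowIdx) (W : ℤ → Times → ℂ) (M : Mod X.Y X.D.Pt),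
      (∀ j, X.Y.Rep (W j) (M (sl j))) → ∀ j, X.Y.Rep (covD n W j) (X.cov n M (sl j)) := by
    intro n W M h j
    rw [hsl]
    exact (rep_dTime hdir (h j) n).add (h (j - n.1))
  have hit : ∀ (n : FlowIdx) (k : ℕ) (j : ℤ),
      X.Y.Rep ((covD n)^[k] (fun j => X.Y.val (X.wave (sl j))) j) ((X.cov n)^[k] X.wave (sl j)) := by
    intro n k
    induction k with
    | zero => exact fun j => X.Y.rep_val _
    | succ k ih =>
      rw [Function.iterate_succ_apply', Function.iterate_succ_apply']
      exact hcov n _ _ ih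
  refine ⟨fun j T k i => ?_, fun T hT j => ?_, fun T hT n j => ?_⟩
  · have h := X.Y.hol_val (X.wave (sl j)) T k i
    simp only [FlowDomain.move, FlowDomain.sliceAt, hdir] at h
    exact h
  · have h0 := congrFun (schrOp_wave hφ hS hη') (sl j)
    have ha : X.Y.Rep (fun _ => a) (algebraMap ℂ X.Y.Fun a) := fun T hT =>
      (FlowDomain.val_algebraMap a hT).symm
    have h1 := hcov v₁ _ _ (hit u₁ 1) j
    have h2 := hit v₁ 1 j
    have h3 := rep_dTime hdir hφr u₁
    have h4 := ((hηr.add ((rep_dTime hdir h3 v₁).const_mul (a / 2))).sub ha)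
    have h := (ha.mul (h1.add (h3.mul h2))).add (h4.mul (X.Y.rep_val (X.wave (sl j))))
    refine (h T hT).trans ?_
    have h5 := congrArg (fun x => X.Y.val x T) h0
    simp only [schrOp, Pi.add_apply, Pi.smul_apply, Pi.zero_apply, FlowDomain.val_zero,
      smul_eq_mul] at h5
    exact h5
  · have h0 := congrArg (fun x => X.Y.val x T) (congrFun (hc n) (sl j))
    simp only [sumOp, Finset.sum_apply, Pi.smul_apply, FlowDomain.val_sum, smul_eq_mul,
      FlowDomain.val_mul] at h0
    refine (hit n 1 j T hT).trans (h0.trans (Finset.sum_congr rfl fun k _ => ?_))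
    rw [hit (base n) k j T hT]

/-- The algebraic form of the hierarchy: `(φ, η)` satisfies it on the local solutions of
`L g = 0`. -/
theorem local_equations (ha : a ≠ 0) {T : Times} (hT : T ∈ X.Y.carrier) {g : Times → ℂ}
    (hg : IsLocalKernel a φ η T g) :
    (∀ n, schrDot a φ η n g T
      + schr a φ η (flowOp (fun n k => X.Y.val (c' n k)) n g) T = 0) ∧
    ∀ m n, flowOp (fun i k => dTime m (X.Y.val (c' i k))) n g T
        + flowOp (fun n k => X.Y.val (c' n k)) n (flowOp (fun n k => X.Y.val (c' n k)) m g) T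
      = flowOp (fun i k => dTime n (X.Y.val (c' i k))) m g T
        + flowOp (fun n k => X.Y.val (c' n k)) m (flowOp (fun n k => X.Y.val (c' n k)) n g) T := by
  obtain ⟨Z, hσ, hTZ, hol, hker⟩ := exists_part hdir hT hg
  have hu : X.S (Z.σ true) = Finsupp.single 1 1 := by rw [hσ]; exact hS u₁
  have hv : X.S (Z.σ false) = Finsupp.single (-1) 1 := by rw [hσ]; exact hS v₁
  have hG := hol.rep
  set y := hol.toFun
  set κ := η' + (a / 2) • X.Y.d v₁ (X.Y.d u₁ φ') - algebraMap ℂ X.Y.Fun a with hκ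
  have hκ' : κ = algebraMap ℂ X.Y.Fun a * -(X.Y.d v₁ (X.moment 0) + algebraMap ℂ X.Y.Fun 1) := by
    rw [hκ, hη', map_one, Algebra.smul_def]
    ring
  have hLy : schrOp (Z.toDomain.dAdd true) (Z.toDomain.dAdd false) (algebraMap ℂ X.Y.Fun a)
      (X.Y.d u₁ φ') κ y = 0 := by
    refine FlowDomain.Fun.ext_val fun S hS' => ?_
    rw [← rep_schr_part hdir hφr hηr hσ hG S hS', hker S hS', FlowDomain.val_zero]
  have hgy : Z.toDomain.dAdd false (Z.toDomain.dAdd true y)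
      + X.Y.d (Z.σ true) φ' • Z.toDomain.dAdd false y
      - (X.Y.d (Z.σ false) (X.moment 0) + algebraMap ℂ X.Y.Fun 1) • y = 0 := by
    have h1 := congrArg (fun z => algebraMap ℂ X.Y.Fun a⁻¹ • z) hLy
    simp only [schrOp, hκ', mul_smul, ← smul_add, smul_zero] at h1
    rw [smul_smul, ← map_mul, inv_mul_cancel₀ ha, map_one, one_smul, neg_smul,
      ← sub_eq_add_neg] at h1
    rw [hσ]
    rw [← map_one (algebraMap ℂ X.Y.Fun)] at h1
    exact h1
  obtain ⟨Sp, hmem, hU, hV, hker'⟩ := hφ.exists_submodule_pairs Z one_ne_zero hu hv hgy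
  rw [hσ] at hU hV
  change ∀ z ∈ Sp, (X.cov u₁ z.1, _) ∈ Sp at hU
  change ∀ z ∈ Sp, (X.cov v₁ z.1, _) ∈ Sp at hV
  have hB : ∀ n : FlowIdx, ∀ z ∈ Sp,
      (X.cov (base n) z.1, Z.toDomain.dAdd (decide (0 < n.1)) z.2) ∈ Sp := fun n => by
    rw [base_eq]
    cases decide (0 < n.1)
    · exact hV
    · exact hU
  have hflow : ∀ (c : FlowIdx → ℕ → X.Y.Fun) (n : FlowIdx) (z : _), z ∈ Sp →
      (sumOp (X.cov (base n)) (c n) (n.1.natAbs + 1) z.1,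
        sumOp (Z.toDomain.dAdd (decide (0 < n.1))) (c n) (n.1.natAbs + 1) z.2) ∈ Sp :=
    fun c n z hz => sumOp_mem (hB n) _ _ hz
  have hcr : ∀ n k, X.Y.Rep (X.Y.val (c' n k)) (c' n k) := fun n k => X.Y.rep_val _
  have hcd : ∀ m n k, X.Y.Rep (dTime m (X.Y.val (c' n k))) (X.Y.d m (c' n k)) := fun m n k =>
    rep_dTime hdir (hcr n k) m
  have hyn := fun n => rep_flowOp_part hdir hσ hG hcr n
  refine ⟨fun n => ?_, fun m n => ?_⟩
  · have h1 := rep_schrDot_part (a := a) hdir hφr hηr hσ hG n T hTZ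
    have h2 := rep_schr_part (a := a) hdir hφr hηr hσ (hyn n) T hTZ
    rw [h1, h2, ← FlowDomain.val_add, ← hκ]
    have h3 := Sp.add_mem
      (Sp.add_mem (Sp.smul_mem (algebraMap ℂ X.Y.Fun a)
        (Sp.smul_mem (X.Y.d n (X.Y.d u₁ φ')) (hV _ hmem))) (Sp.smul_mem (X.Y.d n κ) hmem))
      (schrOp_mem hU hV (algebraMap ℂ X.Y.Fun a) (X.Y.d u₁ φ') κ (hflow c' n _ hmem))
    have h4 := hker' _ h3 ?_
    · exact (congrArg (fun z => Z.toDomain.val z T) h4).trans (FlowDomain.val_zero T)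
    · have h5 := apply_schrOp (D := X.cov n) (U := X.cov u₁) (V := X.cov v₁) (d := X.Y.d n)
        (fun x y => cov_smul _ _ _ x y) (fun z => cov_comm _ _ _ _ z) (fun z => cov_comm _ _ _ _ z)
        (Derivation.map_algebraMap _ a) (X.Y.d u₁ φ') κ X.wave
      rw [hκ, schrOp_wave hφ hS hη', map_zero, ← hκ, hc n] at h5
      exact h5.symm
  · have h1 := rep_flowOp_part hdir hσ hG (hcd m) n T hTZ
    have h2 := rep_flowOp_part hdir hσ (hyn m) hcr n T hTZ
    have h3 := rep_flowOp_part hdir hσ hG (hcd n) m T hTZ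
    have h4 := rep_flowOp_part hdir hσ (hyn n) hcr m T hTZ
    rw [h1, h2, h3, h4, ← FlowDomain.val_add, ← FlowDomain.val_add, ← sub_eq_zero,
      ← FlowDomain.val_sub]
    have h5 := Sp.sub_mem
      (Sp.add_mem (hflow (fun i k => X.Y.d m (c' i k)) n _ hmem)
        (hflow c' n _ (hflow c' m _ hmem)))
      (Sp.add_mem (hflow (fun i k => X.Y.d n (c' i k)) m _ hmem)
        (hflow c' m _ (hflow c' n _ hmem)))
    have h6 := hker' _ h5 ?_
    · exact (congrArg (fun z => Z.toDomain.val z T) h6).trans (FlowDomain.val_zero T)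
    · have h7 : ∀ m n, X.cov m (X.cov n X.wave)
          = sumOp (X.cov (base n)) (fun k => X.Y.d m (c' n k)) (n.1.natAbs + 1) X.wave
            + sumOp (X.cov (base n)) (c' n) (n.1.natAbs + 1)
              (sumOp (X.cov (base m)) (c' m) (m.1.natAbs + 1) X.wave) := fun m n => by
        rw [← hc m, ← apply_sumOp (D := X.cov m) (d := X.Y.d m) (fun x y => cov_smul _ _ _ x y)
          (fun z => cov_comm _ _ _ _ z), ← hc n]
      have h8 := cov_comm X.D.ζ X.S m n X.wave
      change X.cov m (X.cov n X.wave) = X.cov n (X.cov m X.wave) at h8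
      rw [h7, h7, ← sub_eq_zero] at h8
      exact h8

omit hc in
/-- The Kaup-Broer hierarchy for a holomorphic dressed family. -/
theorem isKBHierarchySolution (ha : a ≠ 0) : IsKBHierarchySolution a X.Y.carrier φ η := by
  have hol : ∀ {F : Times → ℂ}, X.Y.Hol F → SliceHol X.Y.carrier F := fun {F} h T k i => by
    have h := h T k i
    simp only [FlowDomain.move, FlowDomain.sliceAt, hdir] at h
    exact h
  choose c' h1 h2 h3 h4 hc using hφ.exists_flow hS
  refine ⟨hol hφr.hol, hol hηr.hol, fun n k => X.Y.val (c' n k), fun n k => hol (X.Y.hol_val _),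
    fun T hT n => ?_, fun T hT n hn => ?_, fun T hT n hn => ?_, fun T hT n hn => ?_,
    fun T hT g hg => (local_equations hdir hφr hηr hφ hS hη' hc ha hT hg).1,
    fun T hT g hg => (local_equations hdir hφr hηr hφ hS hη' hc ha hT hg).2,
    ⟨_, isFormalWave hdir hφr hηr hφ hS hη' hc (sl := .infty) fun n M j => ?_, fun T hT => ?_,
      fun T hT j hj => ?_⟩,
    ⟨_, isFormalWave hdir hφr hηr hφ hS hη' hc (sl := .zero) fun n M j => ?_, fun T hT => ?_,
      fun T hT j hj => ?_⟩⟩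
  · beta_reduce
    rw [h1, FlowDomain.val_one hT]
  · beta_reduce
    rw [h2 n hn, FlowDomain.val_zero]
  · beta_reduce
    rw [h3 n hn, FlowDomain.val_zero]
  · beta_reduce
    rw [h4 n hn, FlowDomain.val_mul, rep_dTime hdir hφr v₁ T hT, ← map_natCast (algebraMap ℂ X.Y.Fun),
      FlowDomain.val_algebraMap _ hT]
  · rw [X.cov_infty (hS n), one_smul]
  · rw [X.wave_infty_zero, FlowDomain.val_one hT]
  · rw [X.wave_infty_pos hj, FlowDomain.val_zero]
  · rw [X.cov_zero (hS n), one_smul]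
  · rw [hφ T hT, hφr T hT]
  · rw [X.wave_zero_neg hj, FlowDomain.val_zero]

end SolvedDomain

/-! ### The Cauchy integral for disjoint supports -/

namespace DressingSupport

variable {X : DressingSupport}

theorem HolderBound.continuous {r C : NNReal} {F : X.Pt → ℂ} (hF : X.HolderBound r C F) (hr : 0 < r) :
    Continuous F :=
  continuous_of_pieces (fun m => (hF.2.1 m).continuous hr) fun l => (hF.2.2 l).continuous hr

/-- Arzelà-Ascoli: a bound on the norm and on the Lipschitz constants gives relative compactness in the
uniform norm. -/
theorem isCompact_closure_holderBound (C : NNReal) :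
    IsCompact (closure {F : BoundedContinuousFunction X.Pt ℂ | X.HolderBound 1 C F}) := by
  refine BoundedContinuousFunction.arzela_ascoli (Metric.closedBall 0 C)
    (isCompact_closedBall _ _) _ (fun F p hF => by simpa using hF.1 p) ?_
  have hpiece : ∀ {Y : Type} [PseudoMetricSpace Y] (z : Y → X.Pt),
      (∀ y y', X.Linked (z y) (z y') (dist y y')) →
      Equicontinuous fun (F : {F : BoundedContinuousFunction X.Pt ℂ | X.HolderBound 1 C F}) y =>
        (F : BoundedContinuousFunction X.Pt ℂ) (z y) := by
    intro Y _ z hz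
    refine Metric.equicontinuous_of_continuity_modulus (fun x => C * x) ?_ _ fun y y' F => ?_
    · exact Continuous.tendsto' (by fun_prop) _ _ (by simp)
    · have := (holderBound_iff.1 F.2).2 _ _ _ (hz y y')
      rw [dist_eq_norm]
      simpa using this
  rw [equicontinuous_iff_continuous]
  refine continuous_of_pieces (fun m => ?_) fun l => ?_
  · exact equicontinuous_iff_continuous.1 (hpiece (X.curve m) fun s s' => .curve m s s')
  · exact equicontinuous_iff_continuous.1 (hpiece (X.patch l) fun s s' => .patch l s s')

theorem HolderBound.cexp {r C : NNReal} {w : X.Pt → ℂ} (hw : X.HolderBound r C w) :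
    X.HolderBound r (Real.toNNReal (Real.exp C) * (1 + C)) fun p => Complex.exp (w p) := by
  rw [holderBound_iff] at hw ⊢
  have hexp : ∀ z : ℂ, ‖z‖ ≤ C → ‖Complex.exp z‖ ≤ Real.exp C := fun z hz => by
    rw [Complex.norm_exp]
    exact Real.exp_le_exp.2 ((Complex.re_le_norm z).trans hz)
  have h0 := (Real.exp_pos (C : ℝ)).le
  rw [NNReal.coe_mul, Real.coe_toNNReal _ h0]
  push_cast
  refine ⟨fun p => (hexp _ (hw.1 p)).trans (le_mul_of_one_le_right h0 (by simp)),
    fun p q δ h => ?_⟩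
  have h1 := (convex_closedBall (0 : ℂ) C).norm_image_sub_le_of_norm_deriv_le
    (f := Complex.exp) (C := Real.exp C) (fun z _ => Complex.differentiable_exp z)
    (fun z hz => by rw [Complex.deriv_exp]; exact hexp z (by simpa using hz))
    (show w q ∈ Metric.closedBall 0 (C : ℝ) by simpa using hw.1 q)
    (show w p ∈ Metric.closedBall 0 (C : ℝ) by simpa using hw.1 p)
  have h2 : 0 ≤ δ ^ (r : ℝ) := Real.rpow_nonneg h.nonneg _
  calc _ ≤ Real.exp C * (C * δ ^ (r : ℝ)) :=
        h1.trans (mul_le_mul_of_nonneg_left (hw.2 p q δ h) h0)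
    _ ≤ _ := by nlinarith [mul_nonneg h0 h2]

end DressingSupport

namespace DressingData

open DressingSupport

variable {D : DressingData}

theorem NoOverlap.exists_gap (h : D.NoOverlap) : ∃ δ : ℝ, 0 < δ ∧ ∀ p q, δ ≤ ‖D.η p - D.ζ q‖ := by
  rcases isEmpty_or_nonempty D.Pt with h0 | h0
  · exact ⟨1, one_pos, fun p => (h0.false p).elim⟩
  have hc : Continuous fun x : D.Pt × D.Pt => ‖D.η x.1 - D.ζ x.2‖ :=
    ((D.η_embedded.continuous.comp continuous_fst).sub
      (D.ζ_embedded.continuous.comp continuous_snd)).norm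
  obtain ⟨x, -, hx⟩ := isCompact_univ.exists_isMinOn Set.univ_nonempty hc.continuousOn
  refine ⟨‖D.η x.1 - D.ζ x.2‖, norm_pos_iff.2 (sub_ne_zero.2 (h x.2 x.1).symm), fun p q => ?_⟩
  exact hx (Set.mem_univ (p, q))

theorem hasCauchyIntegral_of_gap {δ : ℝ} (hδ : 0 < δ) {z : ℂ} (hz : ∀ q, δ ≤ ‖z - D.ζ q‖)
    (F : D.Pt → ℂ) : D.HasCauchyIntegral F z (D.int fun q => F q / (z - D.ζ q)) := by
  rw [hasCauchyIntegral_iff]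
  refine ⟨fun n hn => ?_, tendsto_const_nhds.congr' ?_⟩
  · have := hz (D.atom n)
    rw [hn, sub_self, norm_zero] at this
    linarith
  · filter_upwards [Ioo_mem_nhdsGT hδ] with ε hε
    congr 1
    funext q
    rw [trunc, if_pos (hε.2.trans_le (hz q))]

/-- The Cauchy integrals over a support at a positive distance are Lipschitz. -/
theorem exists_holderBound_cauchy {δ : ℝ} (hδ : 0 < δ) (hgap : ∀ p q, δ ≤ ‖D.η p - D.ζ q‖) :
    ∃ K : NNReal, ∀ (F : D.Pt → ℂ) (B : NNReal), D.BddMeas F → (∀ q, ‖F q‖ ≤ B) →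
      D.HolderBound 1 (K * B) fun p => 1 / (Real.pi : ℂ) * D.int fun q => F q / (D.η p - D.ζ q) := by
  obtain ⟨L, hL⟩ := D.η_embedded.exists_holderBound_zpow D.η_ne_zero 1
  simp only [zpow_one, holderBound_iff] at hL
  set v := D.vol.real Set.univ with hv
  have hv0 : 0 ≤ v := measureReal_nonneg
  have hπ : ‖1 / (Real.pi : ℂ)‖ ≤ 1 := by
    rw [norm_div, norm_one, Complex.norm_real, Real.norm_of_nonneg Real.pi_pos.le,
      div_le_one Real.pi_pos]
    linarith [Real.pi_gt_three]
  have hpos : ∀ p q, 0 < ‖D.η p - D.ζ q‖ := fun p q => hδ.trans_le (hgap p q)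
  refine ⟨Real.toNNReal (v / δ + L * v / δ ^ 2), fun F B hF hB => ?_⟩
  have hB0 := B.coe_nonneg
  have hle : ∀ p q, ‖F q / (D.η p - D.ζ q)‖ ≤ B / δ := fun p q => by
    rw [norm_div]
    exact div_le_div₀ hB0 (hB q) hδ (hgap p q)
  have hmeas : ∀ p, D.BddMeas fun q => F q / (D.η p - D.ζ q) := fun p =>
    ⟨hF.measurable.div (measurable_const.sub measurable_ζ), B / δ, hle p⟩
  rw [holderBound_iff, NNReal.coe_mul, Real.coe_toNNReal _ (by positivity)]
  refine ⟨fun p => ?_, fun p p' d h => ?_⟩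
  · rw [norm_mul]
    have h1 := norm_int_le (hmeas p) (hle p)
    calc _ ≤ 1 * (B / δ * v) := mul_le_mul hπ h1 (norm_nonneg _) zero_le_one
      _ = v / δ * B := by ring
      _ ≤ _ := mul_le_mul_of_nonneg_right (by simp only [le_add_iff_nonneg_right]; positivity) hB0
  · have hd := h.nonneg
    have hLd := hL.2 p p' d h
    rw [NNReal.coe_one, Real.rpow_one] at hLd ⊢
    have h2 : ∀ q, ‖F q / (D.η p - D.ζ q) + -1 * (F q / (D.η p' - D.ζ q))‖ ≤ B * (L * d) / δ ^ 2 := by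
      intro q
      have e : F q / (D.η p - D.ζ q) + -1 * (F q / (D.η p' - D.ζ q))
          = F q * (D.η p' - D.η p) / ((D.η p - D.ζ q) * (D.η p' - D.ζ q)) := by
        have h1 := norm_pos_iff.1 (hpos p q)
        have h2 := norm_pos_iff.1 (hpos p' q)
        field_simp
        ring
      rw [e, norm_div, norm_mul, norm_mul, norm_sub_rev, sq]
      exact div_le_div₀ (by positivity)
        (mul_le_mul (hB q) hLd (norm_nonneg _) hB0) (by positivity)
        (mul_le_mul (hgap p q) (hgap p' q) hδ.le (norm_nonneg _))
    have h3 := norm_int_le ((hmeas p).add ((bddMeas_const (-1)).mul (hmeas p'))) h2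
    rw [int_add (hmeas p) ((bddMeas_const (-1)).mul (hmeas p')), int_const_mul _ (hmeas p')] at h3
    rw [← mul_sub, norm_mul]
    calc _ ≤ 1 * (B * (L * d) / δ ^ 2 * v) := by
          refine mul_le_mul hπ ?_ (norm_nonneg _) zero_le_one
          rwa [neg_one_mul, ← sub_eq_add_neg] at h3
      _ = L * v / δ ^ 2 * B * d := by ring
      _ ≤ _ := mul_le_mul_of_nonneg_right (mul_le_mul_of_nonneg_right
          (by simp only [le_add_iff_nonneg_left]; positivity) hB0) hd

/-- The Cauchy integral as a compact operator on the continuous functions. -/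
theorem NoOverlap.exists_cauchyOp (h : D.NoOverlap) :
    ∃ (S : BoundedContinuousFunction D.Pt ℂ →L[ℂ] BoundedContinuousFunction D.Pt ℂ) (K : NNReal),
      IsCompactOperator S ∧ (∀ F, D.HolderBound 1 (K * ‖F‖₊) (S F)) ∧
      ∀ (F : BoundedContinuousFunction D.Pt ℂ) p, D.HasCauchyIntegral F (D.η p) (Real.pi * S F p) := by
  obtain ⟨δ, hδ, hgap⟩ := h.exists_gap
  obtain ⟨K, hK⟩ := exists_holderBound_cauchy hδ hgap
  have hF : ∀ F : BoundedContinuousFunction D.Pt ℂ, D.BddMeas F := fun F =>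
    bddMeas_of_continuous F.continuous
  have hb : ∀ F : BoundedContinuousFunction D.Pt ℂ, D.HolderBound 1 (K * ‖F‖₊)
      fun p => 1 / (Real.pi : ℂ) * D.int fun q => F q / (D.η p - D.ζ q) := fun F =>
    hK F ‖F‖₊ (hF F) F.norm_coe_le_norm
  have hdiv : ∀ (F : BoundedContinuousFunction D.Pt ℂ) (p : D.Pt),
      D.BddMeas fun q => F q / (D.η p - D.ζ q) := fun F p => by
    refine bddMeas_of_continuous (F.continuous.div₀ (continuous_const.sub D.ζ_embedded.continuous)
      fun q => sub_ne_zero.2 (h q p).symm)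
  let S₀ : BoundedContinuousFunction D.Pt ℂ →ₗ[ℂ] BoundedContinuousFunction D.Pt ℂ :=
    { toFun := fun F => BoundedContinuousFunction.mkOfCompact ⟨_, (hb F).continuous one_pos⟩
      map_add' := fun F G => by
        ext p
        change 1 / (Real.pi : ℂ) * D.int (fun q => (F q + G q) / (D.η p - D.ζ q))
          = 1 / (Real.pi : ℂ) * D.int (fun q => F q / (D.η p - D.ζ q))
            + 1 / (Real.pi : ℂ) * D.int fun q => G q / (D.η p - D.ζ q)
        rw [← mul_add, ← int_add (hdiv F p) (hdiv G p)]
        simp only [add_div]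
      map_smul' := fun c F => by
        ext p
        change 1 / (Real.pi : ℂ) * D.int (fun q => c * F q / (D.η p - D.ζ q))
          = c * (1 / (Real.pi : ℂ) * D.int (fun q => F q / (D.η p - D.ζ q)))
        rw [mul_left_comm, ← int_const_mul c (hdiv F p)]
        simp only [mul_div_assoc] }
  let S := S₀.mkContinuous K fun F => by
    rw [BoundedContinuousFunction.norm_le (by positivity)]
    exact fun p => (hb F).1 p
  refine ⟨S, K, ?_, hb, fun F p => ?_⟩
  · refine (isCompactOperator_iff_exists_mem_nhds_image_subset_compact _).2
      ⟨Metric.ball 0 1, Metric.ball_mem_nhds _ one_pos, _,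
        isCompact_closure_holderBound (X := D.toDressingSupport) K, ?_⟩
    rintro _ ⟨F, hF1, rfl⟩
    refine subset_closure ((hb F).mono (mul_le_of_le_one_right' ?_))
    have : ‖F‖ < 1 := by simpa using hF1
    exact this.le
  · have h1 := hasCauchyIntegral_of_gap hδ (hgap p) F
    convert h1 using 1
    change (Real.pi : ℂ) * (1 / (Real.pi : ℂ) * D.int fun q => F q / (D.η p - D.ζ q)) = _
    rw [← mul_assoc, mul_one_div_cancel (by exact_mod_cast Real.pi_ne_zero), one_mul]

end DressingData

/-- The solution of a linear equation depends holomorphically on the operator and on the right-hand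
side. -/
theorem differentiableAt_inverse_apply {P E : Type*} [NormedAddCommGroup P] [NormedSpace ℂ P]
    [NormedAddCommGroup E] [NormedSpace ℂ E] [CompleteSpace E] {T : P → E →L[ℂ] E} {R : P → E} {c : P}
    (hT : DifferentiableAt ℂ T c) (hR : DifferentiableAt ℂ R c) (hu : IsUnit (1 - T c)) :
    DifferentiableAt ℂ (fun c => Ring.inverse (1 - T c) (R c)) c ∧
      ∀ᶠ c' in 𝓝 c, IsUnit (1 - T c') := by
  have h1 : DifferentiableAt ℂ (fun c => 1 - T c) c := hT.const_sub 1
  have h2 : DifferentiableAt ℂ (Ring.inverse : (E →L[ℂ] E) → E →L[ℂ] E) (1 - T c) :=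
    differentiableAt_inverse hu
  exact ⟨(h2.comp c h1).clm_apply hR,
    h1.continuousAt.eventually (Units.isOpen.mem_nhds hu)⟩

theorem differentiableAt_clm_apply {P E F : Type*} [NormedAddCommGroup P] [NormedSpace ℂ P]
    [NormedAddCommGroup E] [NormedSpace ℂ E] [NormedAddCommGroup F] [NormedSpace ℂ F]
    (L : E →L[ℂ] F) {Φ : P → E} {c : P} (hΦ : DifferentiableAt ℂ Φ c) :
    DifferentiableAt ℂ (fun c => L (Φ c)) c :=
  L.differentiableAt.comp c hΦ

namespace DressingData

open DressingSupport

variable {D : DressingData}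

theorem exp_apply_boundedContinuous (x : BoundedContinuousFunction D.Pt ℂ) (p : D.Pt) :
    NormedSpace.exp x p = Complex.exp (x p) := by
  let ev : BoundedContinuousFunction D.Pt ℂ →+* ℂ :=
    { toFun := fun F => F p
      map_one' := rfl
      map_zero' := rfl
      map_add' := fun _ _ => rfl
      map_mul' := fun _ _ => rfl }
  rw [Complex.exp_eq_exp_ℂ]
  exact NormedSpace.map_exp ev (BoundedContinuousFunction.evalCLM ℂ p).continuous x

theorem apply_eq_of_isKernelImage
    {S : BoundedContinuousFunction D.Pt ℂ →L[ℂ] BoundedContinuousFunction D.Pt ℂ}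
    (hS : ∀ (F : BoundedContinuousFunction D.Pt ℂ) p,
      D.HasCauchyIntegral F (D.η p) (Real.pi * S F p))
    {R : D.Pt → ℂ} {F : BoundedContinuousFunction D.Pt ℂ} {G : D.Pt → ℂ}
    (h : D.IsKernelImage R F G) (p : D.Pt) : G p = R p * S F p := by
  have hπ : (Real.pi : ℂ) ≠ 0 := by exact_mod_cast Real.pi_ne_zero
  obtain ⟨c, hc, hG⟩ := h p
  by_cases hp : R p = 0
  · rw [hG, hp]; simp
  · rw [hG, (hc hp).unique (hS F p)]
    field_simp

/-- For disjoint supports the solution of `ℒ f = g` depends holomorphically on parameters that enter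
the dressing function through exponentials, by the Fredholm alternative on the space of continuous
functions. -/
theorem NoOverlap.holomorphic_solution (h : D.NoOverlap) {R₀ : D.Pt → ℂ} (hR : D.IsHolder R₀)
    (hnull : D.TrivialNullspace R₀) {k : ℕ} {A : Fin k → D.Pt → ℂ} {CA : Fin k → NNReal}
    (hA : ∀ j, D.HolderBound 1 (CA j) (A j)) (c₀ : Fin k → ℂ) {f : (Fin k → ℂ) → D.Pt → ℂ}
    (hf : ∀ᶠ c in 𝓝 c₀, D.Solves
      (fun p => Complex.exp (∑ j, (c j - c₀ j) * A j p) * R₀ p) (f c)) :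
    (∀ p, DifferentiableAt ℂ (fun c => f c p) c₀) ∧
      ∃ r C : NNReal, 0 < r ∧ r ≤ 1 ∧ ∀ᶠ c in 𝓝 c₀, D.HolderBound r C (f c) := by
  obtain ⟨S, K, hcomp, hSb, hS⟩ := h.exists_cauchyOp
  obtain ⟨r, C₀, hr0, hr1, hRb⟩ := hR
  -- the data as continuous functions
  let A' : Fin k → BoundedContinuousFunction D.Pt ℂ := fun j =>
    BoundedContinuousFunction.mkOfCompact ⟨A j, (hA j).continuous one_pos⟩
  let R₀' : BoundedContinuousFunction D.Pt ℂ :=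
    BoundedContinuousFunction.mkOfCompact ⟨R₀, hRb.continuous hr0⟩
  let R : (Fin k → ℂ) → BoundedContinuousFunction D.Pt ℂ := fun c =>
    NormedSpace.exp (∑ j, (c j - c₀ j) • A' j) * R₀'
  have hRp : ∀ c p, R c p = Complex.exp (∑ j, (c j - c₀ j) * A j p) * R₀ p := fun c p => by
    change NormedSpace.exp (∑ j, (c j - c₀ j) • A' j) p * R₀ p = _
    rw [exp_apply_boundedContinuous]
    congr 2
    simp [A']
  have hR0 : R c₀ = R₀' := by
    ext p
    rw [hRp]
    simp [R₀']
  have hRd : Differentiable ℂ R := by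
    have h1 : Differentiable ℂ fun c : Fin k → ℂ => ∑ j, (c j - c₀ j) • A' j :=
      Differentiable.fun_sum fun j _ => by fun_prop
    exact fun c => (((hasFDerivAt_exp (𝕂 := ℂ)).differentiableAt.comp c (h1 c))).mul_const R₀'
  let T : (Fin k → ℂ) → BoundedContinuousFunction D.Pt ℂ →L[ℂ] BoundedContinuousFunction D.Pt ℂ :=
    fun c => (ContinuousLinearMap.mul ℂ _ (R c)).comp S
  have hT : ∀ c F p, T c F p = R c p * S F p := fun _ _ _ => rfl
  have hTd : Differentiable ℂ T := fun c =>
    (((ContinuousLinearMap.mul ℂ (BoundedContinuousFunction D.Pt ℂ)).differentiableAt.comp c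
      (hRd c)).clm_comp (differentiableAt_const S))
  have hcont : ∀ {F : D.Pt → ℂ}, D.IsHolder F → Continuous F := fun {F} hF => by
    obtain ⟨r, C, h0, -, h⟩ := hF
    exact h.continuous h0
  -- the Fredholm alternative: an eigenvector with eigenvalue `1` is in the nullspace of `ℒ`
  have hunit : IsUnit (1 - T c₀) := by
    have hTc : IsCompactOperator (T c₀) := hcomp.clm_comp (ContinuousLinearMap.mul ℂ _ (R c₀))
    rcases hTc.hasEigenvalue_or_mem_resolventSet (one_ne_zero (α := ℂ)) with h1 | h1
    · obtain ⟨F, hF⟩ := h1.exists_hasEigenvector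
      have h2 : T c₀ F = F := by simpa using hF.apply_eq_smul
      refine absurd ?_ hF.2
      have h3 : ∀ p, F p = R₀ p * S F p := fun p => by
        conv_lhs => rw [← h2]
        rw [hT, hR0]
        rfl
      have hFH : D.IsHolder F := by
        have := hRb.isHolder hr0 hr1 |>.mul ((hSb F).isHolder one_pos le_rfl)
        convert this using 1
        exact funext h3
      ext p
      refine hnull F hFH (fun p => ⟨Real.pi * S F p, fun _ => hS F p, ?_⟩) p
      rw [h3]
      have hπ : (Real.pi : ℂ) ≠ 0 := by exact_mod_cast Real.pi_ne_zero
      field_simp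
    · rwa [spectrum.mem_resolventSet_iff, map_one] at h1
  let Φ : (Fin k → ℂ) → BoundedContinuousFunction D.Pt ℂ := fun c => Ring.inverse (1 - T c) (R c)
  obtain ⟨hΦ, hunits⟩ := differentiableAt_inverse_apply (hTd c₀) (hRd c₀) hunit
  have heq : ∀ᶠ c in 𝓝 c₀, ∀ p, f c p = Φ c p ∧ f c p = R c p * (1 + S (Φ c) p) := by
    filter_upwards [hunits, hf] with c hc hfc
    let F : BoundedContinuousFunction D.Pt ℂ :=
      BoundedContinuousFunction.mkOfCompact ⟨f c, hcont hfc.1⟩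
    have h1 : ∀ p, f c p - R c p = R c p * S F p := fun p => by
      have h0 := apply_eq_of_isKernelImage hS (F := F) hfc.2 p
      beta_reduce at h0
      rwa [← hRp] at h0
    have h2 : (1 - T c) F = R c := by
      ext p
      change f c p - R c p * S F p = R c p
      linear_combination h1 p
    have h3 : Φ c = F := by
      change Ring.inverse (1 - T c) (R c) = F
      rw [← h2, ← mul_apply_eq_comp, Ring.inverse_mul_cancel _ hc]
      rfl
    intro p
    rw [h3]
    exact ⟨rfl, by linear_combination h1 p⟩
  refine ⟨fun p => ?_, r, ?_⟩
  · have h1 : DifferentiableAt ℂ (fun c => Φ c p) c₀ :=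
      differentiableAt_clm_apply (BoundedContinuousFunction.evalCLM ℂ p) hΦ
    exact h1.congr_of_eventuallyEq (heq.mono fun c hc => (hc p).1)
  -- the Hölder bound follows from `f = R (1 + S f)`, as `S` maps into Lipschitz functions
  · have hbd : ∀ᶠ c in 𝓝 c₀, ‖Φ c‖₊ ≤ ‖Φ c₀‖₊ + 1 := by
      filter_upwards [hΦ.continuousAt.nnnorm.eventually_lt_const
        (show ‖Φ c₀‖₊ < ‖Φ c₀‖₊ + 1 from lt_add_one _)] with c hc using hc.le
    have hsum : ∀ c : Fin k → ℂ, (∀ j, ‖c j - c₀ j‖ ≤ (1 : NNReal)) → ∀ s : Finset (Fin k),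
        D.HolderBound 1 (∑ j ∈ s, 1 * CA j) fun p => ∑ j ∈ s, (c j - c₀ j) * A j p := by
      intro c hc s
      induction s using Finset.induction_on with
      | empty => simp [holderBound_iff]
      | insert j s hj ih =>
        simp only [Finset.sum_insert hj]
        exact ((hA j).const_mul _ (hc j)).add ih
    have hnear : ∀ᶠ c in 𝓝 c₀, ∀ j, ‖c j - c₀ j‖ ≤ (1 : NNReal) := by
      filter_upwards [Metric.closedBall_mem_nhds c₀ one_pos] with c hc j
      rw [← dist_eq_norm]
      exact (dist_le_pi_dist c c₀ j).trans hc
    have hone : D.HolderBound 1 1 fun _ => 1 := 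
      holderBound_iff.2 ⟨fun _ => by simp, fun _ _ _ h => by simpa using h.nonneg⟩
    have hcongr : ∀ C, (∀ᶠ c in 𝓝 c₀, D.HolderBound r C fun p =>
        Complex.exp (∑ j, (c j - c₀ j) * A j p) * R₀ p * (1 + S (Φ c) p)) →
        ∀ᶠ c in 𝓝 c₀, D.HolderBound r C (f c) := fun C hC => by
      filter_upwards [heq, hC] with c h1 h2
      convert h2 using 1
      funext p
      rw [(h1 p).2, hRp]
    exact ⟨_, hr0, hr1, hcongr _ ((hbd.and hnear).mono fun c hc =>
      (((hsum c hc.2 Finset.univ).cexp.lower hr1).mul hRb).mul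
        ((hone.add ((hSb (Φ c)).mono (mul_le_mul_right hc.1 K))).lower hr1))⟩

end DressingData

/-! ### Holomorphic dependence of the solution on the times -/

namespace DressingSupport

theorem IsEmbedded.exists_holderBound_evalSymb
    {D : DressingSupport} {z : D.Pt → ℂ} (hz : D.IsEmbedded z) (h0 : ∀ p, z p ≠ 0) (s : ℤ →₀ ℂ) :
    ∃ C, D.HolderBound 1 C fun p => evalSymb s (z p) := by
  induction s using Finsupp.induction_linear with
  | zero => exact ⟨0, by simp [holderBound_iff, evalSymb]⟩
  | add s t hs ht =>
    obtain ⟨C, hC⟩ := hs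
    obtain ⟨C', hC'⟩ := ht
    refine ⟨C + C', ?_⟩
    have : ∀ w, evalSymb (s + t) w = evalSymb s w + evalSymb t w := fun w =>
      Finsupp.sum_add_index' (fun _ => zero_mul _) fun _ _ _ => add_mul _ _ _
    simpa only [this] using hC.add hC'
  | single i x =>
    obtain ⟨C, hC⟩ := hz.exists_holderBound_zpow h0 i
    exact ⟨_, by simpa [evalSymb] using hC.const_mul x (K := ‖x‖₊) le_rfl⟩

end DressingSupport

namespace DressingData

open DressingSupport

/-- The density of the dressing function is the difference of the solution of `ℒ f = g` and its
image under the kernel, hence an element of `𝒟`. -/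
theorem Solves.isHolder_density {D : DressingData} {R f : D.Pt → ℂ}
    (hR : D.WellDefined R) (h : D.Solves R f) : D.IsHolder R := by
  obtain ⟨G, hG, hGk⟩ := hR f h.1
  have h1 := h.1.add (hG.const_mul (-1))
  convert h1 using 1
  funext p
  obtain ⟨c, hc, h2⟩ := h.2 p
  obtain ⟨c', hc', h3⟩ := hGk p
  by_cases hp : R p = 0
  · rw [hp, mul_zero, zero_mul] at h2 h3
    linear_combination h3 - h2
  · rw [(hc hp).unique (hc' hp)] at h2
    linear_combination h3 - h2

end DressingData

namespace DressedDomain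

open DressingSupport

variable {V I : Type*} [AddCommGroup V] [Module ℂ V] {X : DressedDomain V I}

theorem exists_holderBound_rate (n : I) : ∃ C, X.D.HolderBound 1 C (X.rate n) := by
  obtain ⟨C, hC⟩ := X.D.η_embedded.exists_holderBound_evalSymb X.D.η_ne_zero (X.S n)
  obtain ⟨C', hC'⟩ := X.D.ζ_embedded.exists_holderBound_evalSymb X.D.ζ_ne_zero (X.S n)
  refine ⟨C + 1 * C', ?_⟩
  have := hC.add (hC'.const_mul (-1) (K := 1) (by simp))
  simp only [neg_one_mul, ← sub_eq_add_neg] at this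
  exact this

variable (X) in
/-- For disjoint supports holomorphy of the solution is automatic. -/
theorem holFamily_of_noOverlap {f : V → X.D.Pt → ℂ} (hno : X.D.NoOverlap)
    (hf : ∀ T ∈ X.Y.carrier, X.D.Solves (X.D.dress (X.θ T)) (f T)) (T : V) (k : ℕ)
    (i : Fin k → I) : X.D.HolFamily (X.Y.sliceAt T i) fun c => f (X.Y.move T i c) := by
  choose CA hCA using fun n => X.exists_holderBound_rate n
  have key : ∀ c₀ ∈ X.Y.sliceAt T i, (∀ p, DifferentiableAt ℂ (fun c => f (X.Y.move T i c) p) c₀) ∧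
      ∃ r C : NNReal, 0 < r ∧ r ≤ 1 ∧ ∀ᶠ c in 𝓝 c₀, X.D.HolderBound r C (f (X.Y.move T i c)) := by
    intro c₀ hc₀
    refine hno.holomorphic_solution (R₀ := X.D.dress (X.θ (X.Y.move T i c₀)))
      (A := fun j => X.rate (i j))
      ((hf _ hc₀).isHolder_density (X.wellDefined _ hc₀)) (X.trivialNullspace _ hc₀)
      (fun j => hCA (i j)) c₀ ?_
    filter_upwards [(X.Y.isOpen_sliceAt T i).mem_nhds hc₀] with c hc
    convert hf _ hc using 1
    funext p
    have h1 : X.Y.move T i c = X.Y.move (X.Y.move T i c₀) i (c - c₀) := by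
      simp only [FlowDomain.move, Pi.sub_apply, sub_smul, Finset.sum_sub_distrib]
      abel
    rw [h1, dress_move hc₀]
    rfl
  exact ⟨fun p c hc => ((key c hc).1 p).differentiableWithinAt, fun c hc => (key c hc).2⟩

variable (X) in
/-- A dressed domain with a family of solutions of `ℒ f = g` that is holomorphic, or has disjoint
supports. -/
def toSolved (f : V → X.D.Pt → ℂ)
    (hf : ∀ T ∈ X.Y.carrier, X.D.Solves (X.D.dress (X.θ T)) (f T))
    (h : X.D.NoOverlap ∨ ∀ (T : V) (k : ℕ) (i : Fin k → I),
      X.D.HolFamily (X.Y.sliceAt T i) fun c => f (X.Y.move T i c)) : SolvedDomain V I :=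
  have h' : ∀ (T : V) (k : ℕ) (i : Fin k → I),
      X.D.HolFamily (X.Y.sliceAt T i) fun c => f (X.Y.move T i c) :=
    h.elim (fun h => X.holFamily_of_noOverlap h hf) id
  have hhol : ∀ p, X.Y.Hol fun T => f T p := fun p T k i => (h' T k i).1 p
  { X with
    f := fun p => (hhol p).toFun
    locHolder_f := fun T k i c hc => by
      obtain ⟨r, C, h0, h1, h2⟩ := (h' T k i).2 c hc
      refine ⟨r, C, h0, h1, ?_⟩
      filter_upwards [h2, (X.Y.isOpen_sliceAt T i).mem_nhds hc] with b hb hbs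
      convert hb using 1
      funext p
      exact (hhol p).val_toFun hbs
    solves := fun T hT => by
      convert hf T hT using 1
      funext p
      exact (hhol p).val_toFun hT }

theorem val_toSolved_f {f : V → X.D.Pt → ℂ} {hf h} {T : V} (hT : T ∈ X.Y.carrier) (p : X.D.Pt) :
    (X.toSolved f hf h).Y.val ((X.toSolved f hf h).f p) T = f T p :=
  FlowDomain.Hol.val_toFun _ hT

end DressedDomain

/-- Increments of the phase along several times are determined by those along one time. -/
theorem FlowDomain.phase_move {V I : Type*} [AddCommGroup V] [Module ℂ V] (Y : FlowDomain V I)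
    {A : Set V} {θ : V → ℂ} {σ : I → ℂ} (hA : ∀ T ∈ A, ∀ n (s : ℂ), T + s • Y.dir n ∈ A)
    (hθ : ∀ T ∈ A, ∀ n (s : ℂ), θ (T + s • Y.dir n) = θ T + s * σ n) {T : V} (hT : T ∈ A) {k : ℕ}
    (i : Fin k → I) (c : Fin k → ℂ) : θ (Y.move T i c) = θ T + ∑ j, c j * σ (i j) := by
  suffices h : Y.move T i c ∈ A ∧ θ (Y.move T i c) = θ T + ∑ j, c j * σ (i j) from h.2
  induction k with
  | zero => simpa [FlowDomain.move] using hT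
  | succ k ih =>
    have h1 : Y.move T i c = Y.move T (fun j => i j.castSucc) (fun j => c j.castSucc)
        + c (Fin.last k) • Y.dir (i (Fin.last k)) := by
      simp only [FlowDomain.move, Fin.sum_univ_castSucc, add_assoc]
    obtain ⟨h2, h3⟩ := ih (fun j => i j.castSucc) (fun j => c j.castSucc)
    rw [h1, hθ _ h2, h3, Fin.sum_univ_castSucc, add_assoc]
    exact ⟨hA _ h2 _ _, rfl⟩

/-! ### The potential and the mass of a dressed family -/

namespace SolvedDomain

open DressingSupport DressedDomain

variable {V I : Type*} [AddCommGroup V] [Module ℂ V] {X : SolvedDomain V I} {f : V → X.D.Pt → ℂ}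
  (hf : ∀ T ∈ X.Y.carrier, ∀ p, X.Y.val (X.f p) T = f T p)

include hf

theorem rep_mass : X.Y.Rep (fun T => X.D.mass (f T)) ((Real.pi : ℂ) • X.moment 0) := by
  intro T hT
  have hπ : (Real.pi : ℂ) ≠ 0 := by exact_mod_cast Real.pi_ne_zero
  rw [FlowDomain.val_smul, X.val_moment 0 hT, ← mul_assoc, mul_one_div_cancel hπ, one_mul]
  simp only [zpow_zero, one_mul, hf T hT]
  rfl

theorem val_wave_zero_zero {T : V} (hT : T ∈ X.Y.carrier) :
    X.Y.val (X.wave (.zero 0)) T = 1 - 1 / (Real.pi : ℂ) * X.D.massInv (f T) := by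
  rw [X.wave_zero_zero, FlowDomain.val_sub, FlowDomain.val_one hT, X.val_moment (-1) hT,
    DressingData.massInv]
  simp only [hf T hT, zpow_neg_one, div_eq_inv_mul]

/-- A continuous branch of the logarithm of `χ(0)` is holomorphic. -/
theorem exists_isPotential {φ : V → ℂ}
    (hc : ∀ (T : V) (k : ℕ) (i : Fin k → I),
      ContinuousOn (fun c => φ (X.Y.move T i c)) (X.Y.sliceAt T i))
    (hφ : ∀ T ∈ X.Y.carrier,
      Complex.exp (-φ T) = 1 - 1 / (Real.pi : ℂ) * X.D.massInv (f T)) :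
    ∃ φ', X.Y.Rep φ φ' ∧ X.IsPotential φ' := by
  have hexp : ∀ T ∈ X.Y.carrier, Complex.exp (-φ T) = X.Y.val (X.wave (.zero 0)) T := fun T hT => by
    rw [hφ T hT, val_wave_zero_zero hf hT]
  have hhol := FlowDomain.hol_of_exp_neg hc (X.Y.hol_val _) hexp
  exact ⟨hhol.toFun, hhol.rep, fun T hT => by rw [← hexp T hT, hhol.val_toFun hT]⟩

end SolvedDomain

/-! ### Dressing with the three times `u`, `v`, `t` -/

open DressingSupport

/-- An open set of `ℂ³` with the coordinate directions of `u`, `v`, `t`. -/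
def kbDomain {Ω : Set (ℂ × ℂ × ℂ)} (hΩ : IsOpen Ω) : FlowDomain (ℂ × ℂ × ℂ) (Fin 3) where
  dir := ![(1, 0, 0), (0, 1, 0), (0, 0, 1)]
  carrier := Ω
  isOpen_slice T k i := hΩ.preimage (by fun_prop)

/-- The symbols of the times `u`, `v`, `t`. -/
def kbSymb (a α β : ℂ) : Fin 3 → ℤ →₀ ℂ :=
  ![Finsupp.single 1 1, Finsupp.single (-1) a, Finsupp.single 2 α + Finsupp.single (-2) (a ^ 2 * β)]

section KB21

variable {Ω : Set (ℂ × ℂ × ℂ)} (hΩ : IsOpen Ω)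

theorem kbDomain_move_coordinates (w : ℂ × ℂ × ℂ) :
    (kbDomain hΩ).move 0 id ![w.1, w.2.1, w.2.2] = w := by
  simp [FlowDomain.move, kbDomain, Fin.sum_univ_three]

theorem differentiable_kbDomain_move (T : ℂ × ℂ × ℂ) {k : ℕ} (i : Fin k → Fin 3) :
    Differentiable ℂ fun c : Fin k → ℂ => (kbDomain hΩ).move T i c := by
  unfold FlowDomain.move
  exact (differentiable_const T).add
    (Differentiable.fun_sum fun j _ => (differentiable_apply j).smul_const _)

theorem kbDomain_hol_iff {F : ℂ × ℂ × ℂ → ℂ} :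
    (kbDomain hΩ).Hol F ↔ DifferentiableOn ℂ F Ω := by
  refine ⟨fun h w hw => ?_, fun h T k i =>
    h.comp (differentiable_kbDomain_move hΩ T i).differentiableOn fun c hc => hc⟩
  have hmem : ![w.1, w.2.1, w.2.2] ∈ (kbDomain hΩ).sliceAt 0 id := by
    rw [FlowDomain.mem_sliceAt, kbDomain_move_coordinates]
    exact hw
  have h1 := h.differentiableAt 0 id hmem
  have h2 : DifferentiableAt ℂ (fun w : ℂ × ℂ × ℂ => ![w.1, w.2.1, w.2.2]) w := by
    rw [differentiableAt_pi]
    intro j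
    fin_cases j
    · exact differentiableAt_fst
    · exact differentiableAt_snd.fst
    · exact differentiableAt_snd.snd
  have h3 := DifferentiableAt.comp (f := fun w : ℂ × ℂ × ℂ => ![w.1, w.2.1, w.2.2]) w h1 h2
  simp only [Function.comp_def, kbDomain_move_coordinates] at h3
  exact h3.differentiableWithinAt

theorem kbPhase_move (a α β : ℂ) (T : ℂ × ℂ × ℂ) {k : ℕ} (i : Fin k → Fin 3) (c : Fin k → ℂ) (l : ℂ) :
    kbPhase a α β ((kbDomain hΩ).move T i c) l
      = kbPhase a α β T l + ∑ j, c j * evalSymb (kbSymb a α β (i j)) l := by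
  refine (kbDomain hΩ).phase_move (A := Set.univ) (θ := fun T => kbPhase a α β T l)
    (σ := fun n => evalSymb (kbSymb a α β n) l) (fun _ _ _ _ => Set.mem_univ _)
    (fun T _ n s => ?_) (Set.mem_univ T) i c
  have h : ∀ x y : ℂ, evalSymb (Finsupp.single 2 x + Finsupp.single (-2) y) l
      = x * l ^ 2 + y * (l ^ 2)⁻¹ := fun x y => by
    rw [evalSymb, Finsupp.sum_add_index' (fun _ => zero_mul _) fun _ _ _ => add_mul _ _ _]
    simp
  fin_cases n
  · simp [kbDomain, kbSymb, kbPhase, evalSymb]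
    ring
  · simp [kbDomain, kbSymb, kbPhase, evalSymb]
    ring
  · change kbPhase a α β (T + s • (0, 0, 1)) l = kbPhase a α β T l
      + s * evalSymb (Finsupp.single 2 α + Finsupp.single (-2) (a ^ 2 * β)) l
    rw [h]
    simp [kbPhase]
    ring

variable {D : DressingData} {a α β : ℂ} {f : ℂ × ℂ × ℂ → D.Pt → ℂ}

/-- A dressed family with the phase of the (2+1)D system. -/
def kbDressed (hD : D.IsDressedFamily (kbPhase a α β) Ω f) : DressedDomain (ℂ × ℂ × ℂ) (Fin 3) where
  D := D
  Y := kbDomain hΩ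
  S := kbSymb a α β
  θ := kbPhase a α β
  phase T _ _ i c l _ := kbPhase_move hΩ a α β T i c l
  wellDefined := hD.wellDefined
  trivialNullspace := hD.trivialNullspace

include hΩ in
/-- Dressing produces solutions of the (2+1)D Kaup-Broer system. -/
theorem exists_isKB21Solution (hD : D.IsDressedFamily (kbPhase a α β) Ω f)
    (hreg : D.NoOverlap ∨ D.HolFamily Ω f) {φ η : ℂ × ℂ × ℂ → ℂ} (hc : ContinuousOn φ Ω)
    (hφ : ∀ w ∈ Ω, Complex.exp (-φ w) = 1 - 1 / (Real.pi : ℂ) * D.massInv (f w))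
    (hη : ∀ w ∈ Ω, η w = -(1 / (Real.pi : ℂ)) * dV (fun z => D.mass (f z)) w
      - 1 / 2 * dV (dU φ) w) : ∃ P, IsKB21Solution a α β Ω φ η P := by
  have hreg' : (kbDressed hΩ hD).D.NoOverlap ∨ ∀ (T : ℂ × ℂ × ℂ) (k : ℕ) (i : Fin k → Fin 3),
      (kbDressed hΩ hD).D.HolFamily ((kbDressed hΩ hD).Y.sliceAt T i)
        fun c => f ((kbDressed hΩ hD).Y.move T i c) := by
    refine hreg.imp id fun h T k i => ⟨fun p => (h.1 p).comp
      (differentiable_kbDomain_move hΩ T i).differentiableOn fun c hc => hc, fun c hc => ?_⟩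
    obtain ⟨r, C, h0, h1, h2⟩ := h.2 _ hc
    exact ⟨r, C, h0, h1,
      (differentiable_kbDomain_move hΩ T i).continuous.continuousAt.eventually h2⟩
  let X := (kbDressed hΩ hD).toSolved f hD.solves hreg'
  have hf : ∀ T ∈ X.Y.carrier, ∀ p, X.Y.val (X.f p) T = f T p := fun T hT p =>
    DressedDomain.val_toSolved_f hT p
  obtain ⟨φ', hφr, hpot⟩ := SolvedDomain.exists_isPotential hf
    (fun T k i => hc.comp (differentiable_kbDomain_move hΩ T i).continuous.continuousOn
      fun c hc => hc) hφ
  have hU : ∀ {F x}, X.Y.Rep F x → X.Y.Rep (dU F) (X.Y.d 0 x) := fun h => h.pd (0 : Fin 3)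
  have hV : ∀ {F x}, X.Y.Rep F x → X.Y.Rep (dV F) (X.Y.d 1 x) := fun h => h.pd (1 : Fin 3)
  have hT : ∀ {F x}, X.Y.Rep F x → X.Y.Rep (dT F) (X.Y.d 2 x) := fun h => h.pd (2 : Fin 3)
  have hhol : ∀ {F x}, X.Y.Rep F x → DifferentiableOn ℂ F Ω := fun h =>
    (kbDomain_hol_iff hΩ).1 h.hol
  obtain ⟨η', hη'⟩ : ∃ η', η' = -X.Y.d 1 (X.moment 0) - (1 / 2 : ℂ) • X.Y.d 1 (X.Y.d 0 φ') :=
    ⟨_, rfl⟩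
  have hηr : X.Y.Rep η η' := fun w hw => by
    have hπ : (Real.pi : ℂ) ≠ 0 := by exact_mod_cast Real.pi_ne_zero
    have hm : dV (fun z => D.mass (f z)) w = _ := hV (SolvedDomain.rep_mass hf) w hw
    rw [hη w hw, hm, hV (hU hφr) w hw, hη', FlowDomain.val_sub,
      FlowDomain.val_neg, FlowDomain.val_smul, Derivation.map_smul, FlowDomain.val_smul]
    field_simp
  obtain ⟨P', hP'⟩ : ∃ P', P' = -X.Y.d 2 φ' - α • (X.Y.d 0 φ' * X.Y.d 0 φ')
    + β • (X.Y.d 1 φ' * X.Y.d 1 φ') := ⟨_, rfl⟩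
  have hPr := FlowDomain.rep_val P'
  obtain ⟨h3, h2⟩ := hpot.kb21 (X := X) (u := (0 : Fin 3)) (v := (1 : Fin 3)) (t := (2 : Fin 3))
    (a := a) (α := α) (β := β) rfl rfl rfl (η := η') (by rw [hη']; module) hP'
  refine ⟨X.Y.val P', hhol hφr, hhol hηr, hhol hPr, fun w hw => ⟨?_, ?_, ?_⟩⟩
  · rw [hT hφr w hw, hU hφr w hw, hV hφr w hw, hP']
    simp only [FlowDomain.val_add, FlowDomain.val_sub, FlowDomain.val_neg, FlowDomain.val_smul,
      FlowDomain.val_mul]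
    ring
  · have h := congrArg (fun x => X.Y.val x w) h2
    simp only [FlowDomain.val_add, FlowDomain.val_sub, FlowDomain.val_smul,
      FlowDomain.val_zero] at h
    rw [hT hηr w hw, hU ((hU hφr).mul hηr) w hw, hV ((hV hφr).mul hηr) w hw, hU (hU hφr) w hw,
      hV (hV hφr) w hw, hV (hU (hU (hU hφr))) w hw, hV (hV (hV (hU hφr))) w hw]
    linear_combination h / 2
  · have h := congrArg (fun x => X.Y.val x w) h3
    simp only [FlowDomain.val_sub, FlowDomain.val_smul] at h
    rw [hV (hU hPr) w hw, hU (hU hηr) w hw, hV (hV hηr) w hw]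
    exact h

end KB21

/-! ### Dressing with the times of the hierarchy -/

section Hierarchy

variable {Ω : Set Times}

/-- A set of sequences of times that is open in every finite set of times. -/
def hierDomain (hΩ : SliceOpen Ω) : FlowDomain Times FlowIdx := ⟨flow, Ω, hΩ⟩

theorem hasSum_flow (n : FlowIdx) (s l : ℂ) :
    HasSum (fun m : FlowIdx => (s • flow n) m * l ^ (m : ℤ)) (s * l ^ (n : ℤ)) := by
  convert hasSum_single (f := fun m : FlowIdx => (s • flow n) m * l ^ (m : ℤ)) n ?_ using 1
  · simp [flow]
  · intro m hm
    simp [flow, Pi.single_eq_of_ne hm]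

theorem hierPhase_move (hΩ : SliceOpen Ω) {T : Times} (hT : Admissible T) {k : ℕ}
    (i : Fin k → FlowIdx) (c : Fin k → ℂ) {l : ℂ} (hl : l ≠ 0) :
    hierPhase ((hierDomain hΩ).move T i c) l = hierPhase T l
      + ∑ j, c j * evalSymb (Finsupp.single (i j).1 1) l := by
  have h1 : ∀ T : Times, ∀ n : FlowIdx, ∀ s : ℂ,
      (fun m : FlowIdx => (T + s • flow n) m * l ^ (m : ℤ))
        = fun m : FlowIdx => T m * l ^ (m : ℤ) + (s • flow n) m * l ^ (m : ℤ) := fun T n s => by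
    funext m
    rw [Pi.add_apply, add_mul]
  refine (hierDomain hΩ).phase_move (A := {T | Summable fun m : FlowIdx => T m * l ^ (m : ℤ)})
    (θ := fun T => hierPhase T l) (σ := fun n => evalSymb (Finsupp.single n.1 1) l)
    (fun T hT n s => ?_) (fun T hT n s => ?_) (hT l hl) i c
  · change Summable fun m : FlowIdx => (T + s • flow n) m * l ^ (m : ℤ)
    rw [h1]
    exact hT.add (hasSum_flow n s l).summable
  · change ∑' m : FlowIdx, (T + s • flow n) m * l ^ (m : ℤ) = _
    rw [h1, Summable.tsum_add hT (hasSum_flow n s l).summable, (hasSum_flow n s l).tsum_eq]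
    simp [evalSymb, hierPhase]

variable {D : DressingData} {a : ℂ} {f : Times → D.Pt → ℂ}

/-- A dressed family with the phase of the hierarchy. -/
def hierDressed (hΩ : SliceOpen Ω) (hadm : ∀ T ∈ Ω, Admissible T)
    (hD : D.IsDressedFamily hierPhase Ω f) : DressedDomain Times FlowIdx where
  D := D
  Y := hierDomain hΩ
  S n := Finsupp.single n.1 1
  θ := hierPhase
  phase T hT _ i c _ hl := hierPhase_move hΩ (hadm T hT) i c hl
  wellDefined := hD.wellDefined
  trivialNullspace := hD.trivialNullspace

/-- Dressing produces solutions of the Kaup-Broer hierarchy. -/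
theorem isKBHierarchySolution_of_isDressedFamily (ha : a ≠ 0) (hΩ : SliceOpen Ω)
    (hadm : ∀ T ∈ Ω, Admissible T) (hD : D.IsDressedFamily hierPhase Ω f)
    (hreg : D.NoOverlap ∨ ∀ (T : Times) (k : ℕ) (i : Fin k → FlowIdx),
      D.HolFamily (slice Ω T i) fun c => f (shift T i c)) {φ η : Times → ℂ} (hc : SliceCont Ω φ)
    (hφ : ∀ T ∈ Ω, Complex.exp (-φ T) = 1 - 1 / (Real.pi : ℂ) * D.massInv (f T))
    (hη : ∀ T ∈ Ω, η T = -(a / (Real.pi : ℂ)) * dTime v₁ (fun S => D.mass (f S)) T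
      - a / 2 * dTime v₁ (dTime u₁ φ) T) : IsKBHierarchySolution a Ω φ η := by
  let X := (hierDressed hΩ hadm hD).toSolved f hD.solves hreg
  have hf : ∀ T ∈ X.Y.carrier, ∀ p, X.Y.val (X.f p) T = f T p := fun T hT p =>
    DressedDomain.val_toSolved_f hT p
  obtain ⟨φ', hφr, hpot⟩ := SolvedDomain.exists_isPotential hf hc hφ
  have hd : ∀ {F x}, X.Y.Rep F x → ∀ n, X.Y.Rep (dTime n F) (X.Y.d n x) := fun h n => h.pd n
  refine SolvedDomain.isKBHierarchySolution (X := X) rfl hφr (fun T hT => ?_) hpot (fun n => rfl)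
    rfl ha
  have hπ : (Real.pi : ℂ) ≠ 0 := by exact_mod_cast Real.pi_ne_zero
  have hm : dTime v₁ (fun S => D.mass (f S)) T = _ := hd (SolvedDomain.rep_mass hf) v₁ T hT
  rw [hη T hT, hm, hd (hd hφr u₁) v₁ T hT, FlowDomain.val_sub,
    FlowDomain.val_neg, FlowDomain.val_smul, FlowDomain.val_smul, Derivation.map_smul,
    FlowDomain.val_smul]
  field_simp

end Hierarchy

/-! ### Reductions to the (1+1)D Kaup-Broer system -/

section Plane

variable {U : Set (ℂ × ℂ)}

theorem pd_eq_fderiv {E : Type*} [NormedAddCommGroup E] [NormedSpace ℂ E] {F : E → ℂ} {z : E}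
    (h : DifferentiableAt ℂ F z) (e : E) : pd ℂ e F z = fderiv ℂ F z e :=
  h.lineDeriv_eq_fderiv

theorem differentiableOn_pd (hU : IsOpen U) {F : ℂ × ℂ → ℂ} (hF : DifferentiableOn ℂ F U)
    (e : ℂ × ℂ) : DifferentiableOn ℂ (pd ℂ e F) U :=
  (differentiableOn_fderiv_apply hU hF e).congr fun _ hz =>
    pd_eq_fderiv (hF.differentiableAt (hU.mem_nhds hz)) e

/-- The linear map under which functions of `(x, t)` are pulled back to functions of `(u, v, t)`. -/
def pullMap (p q τ : ℂ) : ℂ × ℂ × ℂ →L[ℂ] ℂ × ℂ :=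
  (p • ContinuousLinearMap.fst ℂ ℂ (ℂ × ℂ)
    + q • (ContinuousLinearMap.fst ℂ ℂ ℂ).comp (ContinuousLinearMap.snd ℂ ℂ (ℂ × ℂ))).prod
  (τ • (ContinuousLinearMap.snd ℂ ℂ ℂ).comp (ContinuousLinearMap.snd ℂ ℂ (ℂ × ℂ)))

theorem pullMap_apply (p q τ : ℂ) (w : ℂ × ℂ × ℂ) :
    pullMap p q τ w = (p * w.1 + q * w.2.1, τ * w.2.2) := by
  simp [pullMap]

/-- On the preimage of `U` the function `G` is `c` times the pullback of the function `F`, which is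
holomorphic on `U`. -/
structure PullsBack (U : Set (ℂ × ℂ)) (p q τ : ℂ) (G : ℂ × ℂ × ℂ → ℂ) (c : ℂ) (F : ℂ × ℂ → ℂ) :
    Prop where
  hol : DifferentiableOn ℂ F U
  eq : ∀ w, pullMap p q τ w ∈ U → G w = c * F (pullMap p q τ w)

variable {p q τ : ℂ} {G G' : ℂ × ℂ × ℂ → ℂ} {F F' : ℂ × ℂ → ℂ} {c c' : ℂ}

theorem PullsBack.mul (h : PullsBack U p q τ G c F) (h' : PullsBack U p q τ G' c' F') :
    PullsBack U p q τ (fun w => G w * G' w) (c * c') fun z => F z * F' z where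
  hol := h.hol.mul h'.hol
  eq w hw := by
    rw [h.eq w hw, h'.eq w hw]
    ring

theorem PullsBack.pd (hU : IsOpen U) (h : PullsBack U p q τ G c F) {e : ℂ × ℂ × ℂ} {k : ℂ}
    {e' : ℂ × ℂ} (he : pullMap p q τ e = k • e') :
    PullsBack U p q τ (pd ℂ e G) (c * k) (pd ℂ e' F) where
  hol := differentiableOn_pd hU h.hol e'
  eq w hw := by
    have hF := h.hol.differentiableAt (hU.mem_nhds hw)
    have h1 : HasFDerivAt (fun w => c * F (pullMap p q τ w))
        (c • (fderiv ℂ F (pullMap p q τ w)).comp (pullMap p q τ)) w :=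
      (hF.hasFDerivAt.comp w (pullMap p q τ).hasFDerivAt).const_mul c
    have h2 : G =ᶠ[𝓝 w] fun w => c * F (pullMap p q τ w) := by
      filter_upwards [(hU.preimage (pullMap p q τ).continuous).mem_nhds hw] with w' hw'
        using h.eq w' hw'
    have h3 := h1.congr_of_eventuallyEq h2
    rw [pd_eq_fderiv h3.differentiableAt, h3.fderiv, pd_eq_fderiv hF]
    simp [he, mul_assoc]

variable (hU : IsOpen U) (h : PullsBack U p q τ G c F)

include hU h

theorem PullsBack.dU : PullsBack U p q τ (dU G) (c * p) (KaupBroer.pd ℂ (1, 0) F) :=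
  h.pd hU (by simp [pullMap_apply])

theorem PullsBack.dV : PullsBack U p q τ (dV G) (c * q) (KaupBroer.pd ℂ (1, 0) F) :=
  h.pd hU (by simp [pullMap_apply])

theorem PullsBack.dT : PullsBack U p q τ (dT G) (c * τ) (KaupBroer.pd ℂ (0, 1) F) :=
  h.pd hU (by simp [pullMap_apply])

end Plane

/-- The constants of the ansatz that turn the (2+1)D system into the (1+1)D system. -/
theorem isKB21At_pull_iff {U : Set (ℂ × ℂ)} (hU : IsOpen U) {Φ H : ℂ × ℂ → ℂ}
    (hΦ : DifferentiableOn ℂ Φ U) (hH : DifferentiableOn ℂ H U) {a α β ε μ p q κ s σ τ : ℂ}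
    (hκ : κ ≠ 0) (hs0 : s ≠ 0) (hτ0 : τ ≠ 0) (hs : s = -a) (hpq : p * q = 4 * s * μ)
    (hτ : τ = 2 * κ * (α * p ^ 2 - β * q ^ 2)) (hσ : σ = κ * τ * ε)
    (hεμ : 4 * ε * μ * κ ^ 2 = 1) {w : ℂ × ℂ × ℂ}
    (hw : (p * w.1 + q * w.2.1, τ * w.2.2) ∈ U) :
    IsKB21At a α β (fun z => κ * pull p q τ Φ z) (fun z => s * pull p q τ H z)
        (fun z => σ * pull p q τ H z) w ↔
      IsKB11At ε μ Φ H (p * w.1 + q * w.2.1, τ * w.2.2) := by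
  have hpull : ∀ {F : ℂ × ℂ → ℂ} (c : ℂ), DifferentiableOn ℂ F U →
      PullsBack U p q τ (fun z => c * pull p q τ F z) c F := fun c hF =>
    ⟨hF, fun w _ => by rw [pullMap_apply, pull]⟩
  have hf := hpull κ hΦ
  have hη := hpull s hH
  have hP := hpull σ hH
  rw [← pullMap_apply] at hw ⊢
  have hfu := hf.dU hU
  have hfv := hf.dV hU
  have hfuuu := (hfu.dU hU).dU hU
  rw [IsKB21At, IsKB11At, (hf.dT hU).eq w hw, hfu.eq w hw, hfv.eq w hw, hP.eq w hw,
    (hη.dT hU).eq w hw, ((hfu.mul hη).dU hU).eq w hw, ((hfv.mul hη).dV hU).eq w hw,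
    (hfu.dU hU).eq w hw, (hfv.dV hU).eq w hw, (hfuuu.dV hU).eq w hw,
    (((hfu.dV hU).dV hU).dV hU).eq w hw, ((hP.dU hU).dV hU).eq w hw, ((hη.dU hU).dU hU).eq w hw,
    ((hη.dV hU).dV hU).eq w hw]
  simp only [Function.iterate_succ, Function.iterate_zero, Function.comp_apply, id,
    mul_comm (H _) (pd ℂ (1, 0) Φ _)]
  subst hσ
  -- each equation is a nonzero multiple of the corresponding one; the third holds identically
  have h1 : ∀ x y z : ℂ, κ * τ * x + α * (κ * p * y) ^ 2 - β * (κ * q * y) ^ 2 + κ * τ * ε * z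
      = κ * τ * (x + 1 / 2 * y ^ 2 + ε * z) := fun x y z => by
    linear_combination -(κ * y ^ 2 / 2) * hτ
  have h2 : ∀ x y z r : ℂ, s * τ * x + 2 * α * (κ * p * s * p * y) - 2 * β * (κ * q * s * q * y)
      - 2 * a * α * (κ * p * p * z) + 2 * a * β * (κ * q * q * z) + α / 2 * (κ * p * p * p * q * r)
      - β / 2 * (κ * p * q * q * q * r) = s * τ * (x + z + y + μ * r) := fun x y z r => by
    linear_combination (-(s * y) - s * z - r * s * μ) * hτ
      - 2 * κ * z * (α * p ^ 2 - β * q ^ 2) * hs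
      + κ * r / 2 * (α * p ^ 2 - β * q ^ 2) * hpq
  have h3 : ∀ x : ℂ, κ * τ * ε * p * q * x = 2 * α * (s * p * p * x) - 2 * β * (s * q * q * x) :=
    fun x => by
      linear_combination x * κ * τ * ε * hpq + 4 * x * κ * ε * s * μ * hτ
        + 2 * x * s * (α * p ^ 2 - β * q ^ 2) * hεμ
  rw [h1, h2, mul_eq_zero_iff_left (mul_ne_zero hκ hτ0), mul_eq_zero_iff_left (mul_ne_zero hs0 hτ0)]
  exact ⟨fun h => ⟨h.1, h.2.1⟩, fun h => ⟨h.1, h.2, h3 _⟩⟩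

section RealPoints

variable {U : Set (ℂ × ℂ)}

/-- The function `F` is holomorphic on `U` and restricts to the real function `f` on the real points
of `U`. -/
structure RealOn (U : Set (ℂ × ℂ)) (F : ℂ × ℂ → ℂ) (f : ℝ × ℝ → ℝ) : Prop where
  hol : DifferentiableOn ℂ F U
  eq : ∀ z : ℝ × ℝ, ((z.1 : ℂ), (z.2 : ℂ)) ∈ U → F ((z.1 : ℂ), (z.2 : ℂ)) = (f z : ℂ)

variable {F G : ℂ × ℂ → ℂ} {f g : ℝ × ℝ → ℝ}

theorem RealOn.mul (hF : RealOn U F f) (hG : RealOn U G g) :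
    RealOn U (fun z => F z * G z) fun z => f z * g z where
  hol := hF.hol.mul hG.hol
  eq z hz := by
    push_cast
    rw [hF.eq z hz, hG.eq z hz]

theorem RealOn.pd (hU : IsOpen U) (hF : RealOn U F f) {e : ℂ × ℂ} {e' : ℝ × ℝ}
    (he : e = ((e'.1 : ℂ), (e'.2 : ℂ))) :
    RealOn U (KaupBroer.pd ℂ e F) (KaupBroer.pd ℝ e' f) where
  hol := differentiableOn_pd hU hF.hol e
  eq z hz := by
    subst he
    have h1 : HasDerivAt (fun s : ℂ => F (((z.1 : ℂ), (z.2 : ℂ)) + s • ((e'.1 : ℂ), (e'.2 : ℂ))))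
        (KaupBroer.pd ℂ ((e'.1 : ℂ), (e'.2 : ℂ)) F ((z.1 : ℂ), (z.2 : ℂ))) ((0 : ℝ) : ℂ) := by
      rw [Complex.ofReal_zero]
      exact ((hF.hol.differentiableAt (hU.mem_nhds hz)).lineDifferentiableAt
        (v := ((e'.1 : ℂ), (e'.2 : ℂ)))).hasLineDerivAt
    have h2 := h1.comp_ofReal
    have hcont : Tendsto (fun s : ℝ => ((z.1 : ℂ), (z.2 : ℂ)) + (s : ℂ) • ((e'.1 : ℂ), (e'.2 : ℂ)))
        (𝓝 0) (𝓝 ((z.1 : ℂ), (z.2 : ℂ))) :=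
      Continuous.tendsto' (by fun_prop) _ _ (by simp)
    have h3 : HasDerivAt (fun s : ℝ => (f (z + s • e') : ℂ))
        (KaupBroer.pd ℂ ((e'.1 : ℂ), (e'.2 : ℂ)) F ((z.1 : ℂ), (z.2 : ℂ))) 0 := by
      refine h2.congr_of_eventuallyEq ?_
      filter_upwards [hcont.eventually (hU.mem_nhds hz)] with s hs
      have hz' : ((z.1 : ℂ), (z.2 : ℂ)) + (s : ℂ) • ((e'.1 : ℂ), (e'.2 : ℂ))
          = (((z + s • e').1 : ℂ), ((z + s • e').2 : ℂ)) := by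
        ext <;> simp
      rw [hz'] at hs ⊢
      exact (hF.eq _ hs).symm
    have h4 : HasDerivAt (fun s : ℝ => f (z + s • e'))
        (KaupBroer.pd ℂ ((e'.1 : ℂ), (e'.2 : ℂ)) F ((z.1 : ℂ), (z.2 : ℂ))).re 0 := by
      have := HasFDerivAt.comp_hasDerivAt (0 : ℝ) Complex.reCLM.hasFDerivAt h3
      simpa [Function.comp_def] using this
    have h5 : KaupBroer.pd ℝ e' f z = _ := h4.deriv
    rw [h5]
    exact h3.unique h4.ofReal_comp

/-- On the real points the complex system is the real system. -/
theorem isKB11At_ofReal_iff (hU : IsOpen U) {Φ H : ℂ × ℂ → ℂ} {Φr Hr : ℝ × ℝ → ℝ}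
    (hΦ : RealOn U Φ Φr) (hH : RealOn U H Hr) {ε μ : ℝ} {z : ℝ × ℝ}
    (hz : ((z.1 : ℂ), (z.2 : ℂ)) ∈ U) :
    IsKB11At (ε : ℂ) (μ : ℂ) Φ H ((z.1 : ℂ), (z.2 : ℂ)) ↔ IsKB11At ε μ Φr Hr z := by
  have hx : ∀ {F f}, RealOn U F f → RealOn U (pd ℂ (1, 0) F) (pd ℝ (1, 0) f) := fun h =>
    h.pd hU (by simp)
  have ht : ∀ {F f}, RealOn U F f → RealOn U (pd ℂ (0, 1) F) (pd ℝ (0, 1) f) := fun h =>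
    h.pd hU (by simp)
  simp only [IsKB11At, Function.iterate_succ, Function.iterate_zero, Function.comp_apply, id]
  rw [(ht hΦ).eq z hz, (hx hΦ).eq z hz, hH.eq z hz, (ht hH).eq z hz, (hx (hx hΦ)).eq z hz,
    (hx (hH.mul (hx hΦ))).eq z hz, (hx (hx (hx (hx hΦ)))).eq z hz,
    show (1 / 2 : ℂ) = ((1 / 2 : ℝ) : ℂ) by norm_num]
  norm_cast

end RealPoints

theorem exists_isReduction {a α β : ℂ} (ha : a ≠ 0) (hαβ : α ≠ 0 ∨ β ≠ 0) {ε μ : ℝ}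
    (hε : ε ≠ 0) (hμ : μ ≠ 0) :
    ∃ p q κ s σ τ : ℂ, p ≠ 0 ∧ q ≠ 0 ∧ κ ≠ 0 ∧ s ≠ 0 ∧ σ ≠ 0 ∧ τ ≠ 0 ∧
      IsReduction a α β ε μ p q κ s σ τ := by
  have hε' : (ε : ℂ) ≠ 0 := by exact_mod_cast hε
  have hμ' : (μ : ℂ) ≠ 0 := by exact_mod_cast hμ
  -- `α p² - β q²` cannot vanish for both `p = 1` and `p = 2` when `p q` is fixed
  obtain ⟨p, q, hp, hpq, hΔ⟩ : ∃ p q : ℂ, p ≠ 0 ∧ p * q = 4 * (-a) * μ ∧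
      α * p ^ 2 - β * q ^ 2 ≠ 0 := by
    by_contra! h
    have h1 := h 1 (4 * (-a) * μ) one_ne_zero (by ring)
    have h2 := h 2 (4 * (-a) * μ / 2) two_ne_zero (by ring)
    have hα : α = 0 := by linear_combination (-1 / 15 : ℂ) * h1 + (4 / 15 : ℂ) * h2
    subst hα
    have hβ : β = 0 := by
      have h3 : β * (a * μ) ^ 2 = 0 := by linear_combination (-1 / 16 : ℂ) * h1
      simpa [ha, hμ'] using h3
    simp [hβ] at hαβ
  obtain ⟨κ, hκ⟩ := IsAlgClosed.exists_pow_nat_eq (1 / (4 * (ε : ℂ) * μ)) two_pos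
  have hκ1 : 4 * (ε : ℂ) * μ * κ ^ 2 = 1 := by
    rw [hκ]
    field_simp
  have hκ0 : κ ≠ 0 := by
    rintro rfl
    simp at hκ1
  have hq : q ≠ 0 := by
    rintro rfl
    rw [mul_zero] at hpq
    simp [ha, hμ'] at hpq
  have hτ : 2 * κ * (α * p ^ 2 - β * q ^ 2) ≠ 0 := mul_ne_zero (mul_ne_zero two_ne_zero hκ0) hΔ
  refine ⟨p, q, κ, -a, κ * (2 * κ * (α * p ^ 2 - β * q ^ 2)) * ε,
    2 * κ * (α * p ^ 2 - β * q ^ 2), hp, hq, hκ0, neg_ne_zero.2 ha,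
    mul_ne_zero (mul_ne_zero hκ0 hτ) hε', hτ, fun U Φ H hU hΦ hH => ?_⟩
  have key := fun w => isKB21At_pull_iff (w := w) hU hΦ hH hκ0 (neg_ne_zero.2 ha) hτ rfl hpq rfl rfl
    hκ1
  refine ⟨fun w hw => key w hw, fun Φr Hr hr w x t hU' hx ht => ?_⟩
  rw [key w (by rwa [hx, ht]), hx, ht]
  exact isKB11At_ofReal_iff hU ⟨hΦ, fun z hz => (hr z.1 z.2 hz).1⟩
    ⟨hH, fun z hz => (hr z.1 z.2 hz).2⟩ (z := (x, t)) hU'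

end KaupBroer

end

theorem mainTheorem3 :
    -- the (2+1)D Kaup-Broer system
    (∀ (D : DressingData) (a α β : ℂ) (Ω : Set (ℂ × ℂ × ℂ)) (f : ℂ × ℂ × ℂ → D.Pt → ℂ)
        (φ η : ℂ × ℂ × ℂ → ℂ),
      IsOpen Ω →
      D.IsDressedFamily (kbPhase a α β) Ω f →
      (D.NoOverlap ∨ D.HolFamily Ω f) →
      ContinuousOn φ Ω →
      (∀ w ∈ Ω, Complex.exp (-φ w) = 1 - 1 / (Real.pi : ℂ) * D.massInv (f w)) →
      (∀ w ∈ Ω, η w = -(1 / (Real.pi : ℂ)) * dV (fun z => D.mass (f z)) w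
        - 1 / 2 * dV (dU φ) w) →
      ∃ P : ℂ × ℂ × ℂ → ℂ, IsKB21Solution a α β Ω φ η P) ∧
    -- the Kaup-Broer hierarchy
    (∀ (D : DressingData) (a : ℂ) (Ω : Set Times) (f : Times → D.Pt → ℂ) (φ η : Times → ℂ),
      a ≠ 0 →
      SliceOpen Ω →
      (∀ T ∈ Ω, Admissible T) →
      D.IsDressedFamily hierPhase Ω f →
      (D.NoOverlap ∨ ∀ (T : Times) (k : ℕ) (i : Fin k → FlowIdx),
        D.HolFamily (slice Ω T i) fun c => f (shift T i c)) →
      SliceCont Ω φ →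
      (∀ T ∈ Ω, Complex.exp (-φ T) = 1 - 1 / (Real.pi : ℂ) * D.massInv (f T)) →
      (∀ T ∈ Ω, η T = -(a / (Real.pi : ℂ)) * dTime v₁ (fun S => D.mass (f S)) T
        - a / 2 * dTime v₁ (dTime u₁ φ) T) →
      IsKBHierarchySolution a Ω φ η) ∧
    -- the reductions to the four scaling classes of the (1+1)D Kaup-Broer system
    (∀ a α β : ℂ, a ≠ 0 → (α ≠ 0 ∨ β ≠ 0) →
      ∀ ε μ : ℝ, (ε = 1 ∨ ε = -1) → (μ = 1 / 4 ∨ μ = -1 / 4) →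
      ∃ p q κ s σ τ : ℂ, p ≠ 0 ∧ q ≠ 0 ∧ κ ≠ 0 ∧ s ≠ 0 ∧ σ ≠ 0 ∧ τ ≠ 0 ∧
        IsReduction a α β ε μ p q κ s σ τ) := by 
  refine ⟨fun D a α β Ω f φ η hΩ hD hreg hc hφ hη =>
    exists_isKB21Solution hΩ hD hreg hc hφ hη,
    fun D a Ω f φ η ha hΩ hadm hD hreg hc hφ hη =>
      isKBHierarchySolution_of_isDressedFamily ha hΩ hadm hD hreg hc hφ hη,
    fun a α β ha hαβ ε μ hε hμ => exists_isReduction ha hαβ ?_ ?_⟩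
  · rcases hε with rfl | rfl <;> norm_num
  · rcases hμ with rfl | rfl <;> norm_num
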